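/- **Setting.** Let $d,k\in\mathbb{N}$ with $d\ge 1$. An $(n,d)$-Steiner system is a collection $S$ of $(d+1)$-element subsets of $[n]=\{1,\dots,n\}$ such that every $d$-element subset of $[n]$ is contained in exactly one member of $S$. A number $n\ge d+1$ is $d$-admissible if $d-j$ divides $\binom{n-j-1}{d-j-1}$ for all $0\le j\le d-1$. A $(d,k,n)$-random Steiner complex is the random simplicial complex $X=K_n^{(d-1)}\cup S_1\cup\dots\cup S_k$ on the vertex set $[n]$, where $K_n^{(d-1)}$ consists of all subsets of $[n]$ with at most $d$ elements and $S_1,\dots,S_k$ are independent and uniformly distributed over the set of all $(n,d)$-Steiner systems (in particular such systems exist). Let $\Omega^{d-1}(X)$ be the real vector space of skew-symmetric functions on the oriented $(d-1)$-faces of $X$, i.e. $f(\overline\sigma)=-f(\sigma)$, where $\overline\sigma$ is $\sigma$ with the reversed orientation (for $d=1$: all real functions on the vertices). An oriented $d$-face $[\tau^0,\dots,\tau^d]$ has in its boundary the oriented faces $(-1)^i[\tau^0,\dots,\tau^{i-1},\tau^{i+1},\dots,\tau^d]$, $0\le i\le d$. Two oriented $(d-1)$-faces $\sigma,\sigma'$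 with distinct underlying faces are neighbours, $\sigma\sim\sigma'$, if $\sigma$ and $\overline{\sigma'}$ are both in the boundary of some oriented $d$-face of $X$. With $\deg(\sigma)$ the number of $d$-faces containing $\sigma$, the adjacency operator and the upper Laplacian on $\Omega^{d-1}(X)$ are $$A_Xf(\sigma)=\sum_{\sigma'\sim\sigma}f(\sigma'),\qquad \Delta^+_{d-1}(X)f(\sigma)=\deg(\sigma)f(\sigma)-\sum_{\sigma'\sim\sigma}f(\sigma').$$ The empirical spectral distribution of a self-adjoint operator $T$ on an $r$-dimensional real space with eigenvalues $\lambda_1,\dots,\lambda_r$ (with multiplicity) is $\mu_T=\frac1r\sum_{j=1}^r\delta_{\lambda_j}$. Random probability measures $\mu_i$ on $\mathbb{R}$ converge weakly in probability to $\mu$ if $\lim_{i\to\infty}\mathbb{P}\big(|\int f\,d\mu_i-\int f\,d\mu|>\varepsilon\big)=0$ for every $\varepsilon>0$ and every bounded continuous $f:\mathbb{R}\to\mathbb{R}$. **Theorem.** Let $k\ge d+1$, let $(n_i)$ be a sequence of $d$-admissible numbers with $n_i\to\infty$, and for each $i$ let $X_i$ be a $(d,k,n_i)$-random Steiner complex.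 Then: 1. There is a unique Borel probability measure $\nu_{d,k}$ on $\mathbb{R}$ such that for every Borel set $B\subset\mathbb{R}$ $$\nu_{d,k}(B)=\int_{B\cap I_{d,k}}\frac{k\sqrt{4(k-1)d-(k-1+d-x)^2}}{2\pi x((d+1)k-x)}\,dx,\qquad I_{d,k}=\big[(\sqrt{k-1}-\sqrt d)^2,(\sqrt{k-1}+\sqrt d)^2\big]$$ (the integrand being integrable on $I_{d,k}$), and $\mu_{\Delta^+_{d-1}(X_i)}$ converges weakly in probability to $\nu_{d,k}$ as $i\to\infty$. 2. Let $\mu_{d,k}$ be the image of $\nu_{d,k}$ under $x\mapsto k-x$. It is a Borel probability measure, for every Borel set $B\subset\mathbb{R}$ $$\mu_{d,k}(B)=\int_{B\cap J_{d,k}}\frac{k\sqrt{4(k-1)d-(x-1+d)^2}}{2\pi(k-x)(dk+x)}\,dx,\qquad J_{d,k}=\big[-d+1-2\sqrt{(k-1)d},\,-d+1+2\sqrt{(k-1)d}\big]$$ (the integrand being integrable on $J_{d,k}$), and $\mu_{A_{X_i}}$ converges weakly in probability to $\mu_{d,k}$ as $i\to\infty$. -/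

import Mathlib

open MeasureTheory ProbabilityTheory Filter Topology
open scoped ENNReal BoundedContinuousFunction

section OrientedFaces

variable {V : Type*} (X : PreAbstractSimplicialComplex V)

/-- The faces of `X` with `m` vertices (that is, of dimension `m - 1`), together with an ordering of
their vertices. -/
def OrderedFace (m : ℕ) : Type _ :=
  {σ : Fin m ↪ V // Finset.univ.map σ ∈ X.faces}

namespace OrderedFace

variable {X} {m : ℕ}

/-- Reordering the vertices of an ordered face. -/
def permute (π : Equiv.Perm (Fin m)) (σ : OrderedFace X m) : OrderedFace X m :=
  ⟨π.toEmbedding.trans σ.1, by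
    have h : Finset.univ.map (π.toEmbedding.trans σ.1) = Finset.univ.map σ.1 := by
      rw [← Finset.map_map, Finset.map_univ_equiv]
    rw [h]; exact σ.2⟩

end OrderedFace

/-- Two ordered faces with signs define the same oriented face if they differ by a permutation `π`
of the vertices and by the sign of `π`. -/
def orientationSetoid (m : ℕ) : Setoid (OrderedFace X m × ℤˣ) where
  r a b := ∃ π : Equiv.Perm (Fin m), b.1 = a.1.permute π ∧ b.2 = Equiv.Perm.sign π * a.2
  iseqv :=
    { refl := fun a => ⟨1, Subtype.ext (by ext; rfl), by simp⟩
      symm := by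
        rintro ⟨a, e⟩ ⟨b, e'⟩ ⟨π, hb, he⟩
        refine ⟨π⁻¹, ?_, ?_⟩
        · dsimp only at hb ⊢
          subst hb
          apply Subtype.ext
          ext i
          simp [OrderedFace.permute]
        · dsimp only at he ⊢
          subst he
          rw [Equiv.Perm.sign_inv, ← mul_assoc, Int.units_mul_self, one_mul]
      trans := by
        rintro ⟨a, e⟩ ⟨b, e'⟩ ⟨c, e''⟩ ⟨π, hb, he⟩ ⟨ρ, hc, he'⟩
        refine ⟨π * ρ, ?_, ?_⟩
        · dsimp only at hb hc ⊢
          subst hb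
          subst hc
          rfl
        · dsimp only at he he' ⊢
          subst he
          subst he'
          rw [Equiv.Perm.sign_mul, ← mul_assoc, mul_comm (Equiv.Perm.sign ρ)] }

/-- The oriented faces of `X` with `m` vertices, i.e. of dimension `m - 1`. For `m ≥ 2` these are
the orderings of the faces up to even permutations. For `m = 1` every vertex `v` has the two signed
versions `+v` and `-v`, so that skew-symmetric functions are the same as functions on vertices. -/
def OrientedFace (m : ℕ) : Type _ := Quotient (orientationSetoid X m)

namespace OrientedFace

variable {X} {m : ℕ}

/-- The oriented face `ε • [σ⁰, …, σ^{m-1}]`. -/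
def mk (σ : OrderedFace X m) (ε : ℤˣ) : OrientedFace X m :=
  Quotient.mk (orientationSetoid X m) (σ, ε)

/-- Flipping the orientation. -/
def flip : OrientedFace X m → OrientedFace X m :=
  Quotient.map (fun a => (a.1, -a.2)) (by
    rintro ⟨a, e⟩ ⟨b, e'⟩ ⟨π, hb, he⟩
    exact ⟨π, hb, by dsimp only at he ⊢; rw [he, mul_neg]⟩)

/-- The set of vertices of an oriented face. -/
def support : OrientedFace X m → Finset V :=
  Quotient.lift (fun a => Finset.univ.map a.1.1) (by
    rintro ⟨a, e⟩ ⟨b, e'⟩ ⟨π, hb, he⟩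
    dsimp only at hb ⊢
    subst hb
    change _ = Finset.univ.map (π.toEmbedding.trans a.1)
    rw [← Finset.map_map, Finset.map_univ_equiv])

/-- `σ` is in the boundary of `τ` as an oriented face: for some representation
`τ = ε • [τ⁰, …, τ^m]` and some `i`, it is `ε • (-1)^i • [τ⁰, …, τ^{i-1}, τ^{i+1}, …, τ^m]`. -/
def MemBoundary (σ : OrientedFace X m) (τ : OrientedFace X (m + 1)) : Prop :=
  ∃ (t : OrderedFace X (m + 1)) (ε : ℤˣ) (i : Fin (m + 1)) (s : OrderedFace X m),
    s.1 = (Fin.succAboveEmb i).trans t.1 ∧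
      τ = mk t ε ∧ σ = mk s ((-1) ^ (i : ℕ) * ε)

/-- The neighbouring relation: the oriented faces `σ` and `σ'` have distinct underlying faces, and
`σ` and the flip of `σ'` are both in the boundary of some oriented face `τ` of one dimension
higher. -/
def Neighbour (σ σ' : OrientedFace X m) : Prop :=
  σ.support ≠ σ'.support ∧
    ∃ τ : OrientedFace X (m + 1), MemBoundary σ τ ∧ MemBoundary σ'.flip τ

/-- The degree of a face with `m` vertices: the number of faces with `m + 1` vertices
containing it. -/
noncomputable def deg (σ : OrientedFace X m) : ℕ :=
  Set.ncard {τ : Finset V | τ ∈ X.faces ∧ τ.card = m + 1 ∧ σ.support ⊆ τ}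

theorem flip_mk (σ : OrderedFace X m) (ε : ℤˣ) : (mk σ ε).flip = mk σ (-ε) := rfl

theorem flip_flip (σ : OrientedFace X m) : σ.flip.flip = σ := by
  induction σ using Quotient.inductionOn with
  | _ a => exact congrArg (mk a.1) (neg_neg a.2)

theorem support_flip (σ : OrientedFace X m) : σ.flip.support = σ.support := by
  induction σ using Quotient.inductionOn with
  | _ a => rfl

theorem deg_flip (σ : OrientedFace X m) : σ.flip.deg = σ.deg := by
  rw [deg, deg, support_flip]

theorem MemBoundary.flip {σ : OrientedFace X m} {τ : OrientedFace X (m + 1)}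
    (h : MemBoundary σ τ) : MemBoundary σ.flip τ.flip := by
  obtain ⟨t, ε, i, s, hs, rfl, rfl⟩ := h
  exact ⟨t, -ε, i, s, hs, rfl, by rw [flip_mk, mul_neg]⟩

theorem Neighbour.flip {σ σ' : OrientedFace X m} (h : Neighbour σ σ') :
    Neighbour σ.flip σ'.flip := by
  obtain ⟨hne, τ, h₁, h₂⟩ := h
  exact ⟨by rwa [support_flip, support_flip], τ.flip, h₁.flip, h₂.flip⟩

/-- Flipping as a permutation of the set of oriented faces. -/
def flipEquiv : OrientedFace X m ≃ OrientedFace X m :=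
  ⟨flip, flip, flip_flip, flip_flip⟩

theorem neighbour_flip_iff {σ σ' : OrientedFace X m} :
    Neighbour σ.flip σ'.flip ↔ Neighbour σ σ' :=
  ⟨fun h => by simpa only [flip_flip] using h.flip, Neighbour.flip⟩

end OrientedFace

instance [Finite V] (m : ℕ) : Finite (OrderedFace X m) :=
  inferInstanceAs (Finite {σ : Fin m ↪ V // Finset.univ.map σ ∈ X.faces})

instance [Finite V] (m : ℕ) : Finite (OrientedFace X m) :=
  inferInstanceAs (Finite (Quotient (orientationSetoid X m)))

noncomputable instance [Finite V] (m : ℕ) : Fintype (OrientedFace X m) := Fintype.ofFinite _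

/-- The space of forms of degree `m - 1` on `X`: the skew-symmetric real functions on the oriented
faces with `m` vertices. -/
def Form (m : ℕ) : Submodule ℝ (OrientedFace X m → ℝ) where
  carrier := {f | ∀ σ, f σ.flip = -f σ}
  add_mem' := by
    intro f g hf hg σ
    simp only [Set.mem_ofPred_eq] at hf hg
    rw [Pi.add_apply, Pi.add_apply, hf, hg, neg_add]
  zero_mem' := by intro σ; simp
  smul_mem' := by
    intro c f hf σ
    simp only [Set.mem_ofPred_eq] at hf
    rw [Pi.smul_apply, Pi.smul_apply, hf, smul_neg]

variable [Finite V]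

open Classical in
/-- The adjacency operator on the forms of degree `m - 1`:
`(A f)(σ) = ∑ f(σ')`, the sum over all neighbours `σ'` of `σ`. -/
noncomputable def adjacencyOperator (m : ℕ) : Form X m →ₗ[ℝ] Form X m where
  toFun f :=
    ⟨fun σ => ∑ σ' with OrientedFace.Neighbour σ σ', f.1 σ', by
      intro σ
      rw [← Finset.sum_neg_distrib]
      refine Finset.sum_equiv OrientedFace.flipEquiv ?_ ?_
      · intro σ'
        simp only [Finset.mem_filter, Finset.mem_univ, true_and]
        change _ ↔ OrientedFace.Neighbour σ σ'.flip
        rw [← OrientedFace.neighbour_flip_iff (σ := σ), OrientedFace.flip_flip]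
      · intro σ' _
        change _ = -f.1 σ'.flip
        rw [f.2 σ', neg_neg]⟩
  map_add' f g := by
    apply Subtype.ext
    funext σ
    exact Finset.sum_add_distrib
  map_smul' c f := by
    apply Subtype.ext
    funext σ
    exact (Finset.mul_sum _ _ _).symm

/-- The operator `f ↦ deg · f`. -/
noncomputable def degreeOperator (m : ℕ) : Form X m →ₗ[ℝ] Form X m where
  toFun f := ⟨fun σ => (σ.deg : ℝ) * f.1 σ, by
    intro σ
    dsimp only
    rw [OrientedFace.deg_flip, f.2 σ, mul_neg]⟩
  map_add' f g := by
    apply Subtype.ext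
    funext σ
    exact mul_add _ _ _
  map_smul' c f := by
    apply Subtype.ext
    funext σ
    exact mul_left_comm _ _ _

/-- The upper Laplacian on the forms of degree `m - 1`:
`(Δ⁺ f)(σ) = deg(σ) f(σ) - ∑ f(σ')`, the sum over all neighbours `σ'` of `σ`. -/
noncomputable def upperLaplacian (m : ℕ) : Form X m →ₗ[ℝ] Form X m :=
  degreeOperator X m - adjacencyOperator X m

end OrientedFaces

section Steiner

/-- `n` is `d`-admissible. -/
def IsAdmissible (d n : ℕ) : Prop :=
  d + 1 ≤ n ∧ ∀ j < d, (d - j) ∣ (n - j - 1).choose (d - j - 1)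

/-- The `(n, d)`-Steiner systems on the vertex set `Fin n`: collections of subsets of size `d + 1`
such that every subset of size `d` is contained in exactly one of them. -/
def SteinerSystem (d n : ℕ) : Type :=
  {S : Finset (Finset (Fin n)) //
    (∀ τ ∈ S, τ.card = d + 1) ∧ ∀ σ : Finset (Fin n), σ.card = d → ∃! τ, τ ∈ S ∧ σ ⊆ τ}

instance (d n : ℕ) : MeasurableSpace (SteinerSystem d n) := ⊤

/-- The complex whose faces are all non-empty sets of at most `d` vertices (the complete complex of
dimension `d - 1`) and all members of the Steiner systems `S j`. -/
def steinerComplex {d k n : ℕ} (S : Fin k → SteinerSystem d n) :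
    PreAbstractSimplicialComplex (Fin n) where
  faces := {σ | σ.Nonempty ∧ σ.card ≤ d} ∪ ⋃ j, {σ | σ ∈ (S j).1}
  isRelLowerSet_faces := by
    intro σ hσ
    simp only [Set.mem_union, Set.mem_ofPred_eq, Set.mem_iUnion] at hσ ⊢
    rcases hσ with ⟨hne, hc⟩ | ⟨j, hj⟩
    · exact ⟨hne, fun ρ hρ hρ' => Or.inl ⟨hρ', (Finset.card_le_card hρ).trans hc⟩⟩
    · have hc := (S j).2.1 σ hj
      refine ⟨Finset.card_pos.1 (by omega), fun ρ hρ hρ' => ?_⟩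
      by_cases h : ρ = σ
      · exact Or.inr ⟨j, by rwa [h]⟩
      · have := Finset.card_lt_card (Finset.ssubset_iff_subset_ne.2 ⟨hρ, h⟩)
        exact Or.inl ⟨hρ', by omega⟩

/-- `X` is a `(d, k, n)`-random Steiner complex: the union of the complete complex of dimension
`d - 1` on `n` vertices and of `k` independent uniformly distributed `(n, d)`-Steiner systems. -/
def IsRandomSteinerComplex {Ω : Type*} [MeasurableSpace Ω] (P : Measure Ω) (d k n : ℕ)
    (X : Ω → PreAbstractSimplicialComplex (Fin n)) : Prop :=
  ∃ S : Fin k → Ω → SteinerSystem d n,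
    iIndepFun S P ∧ (∀ j, HasLaw (S j) (uniformOn Set.univ) P) ∧
      ∀ ω, X ω = steinerComplex (fun j => S j ω)

end Steiner

section Spectral

/-- The empirical spectral distribution `r⁻¹ ∑ δ_{λ_i}` of a self-adjoint operator on a real vector
space of dimension `r`; the eigenvalues `λ_i` with their multiplicities are the roots of the
characteristic polynomial. -/
noncomputable def empiricalSpectralDistribution {W : Type*} [AddCommGroup W] [Module ℝ W]
    [Module.Finite ℝ W] (T : W →ₗ[ℝ] W) : Measure ℝ :=
  (Module.finrank ℝ W : ℝ≥0∞)⁻¹ • (T.charpoly.roots.map Measure.dirac).sum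

/-- Weak convergence in probability of a sequence of random measures `m i` (each defined on its own
probability space) to `μ`. -/
def ConvergesWeaklyInProbability {Ω : ℕ → Type*} [∀ i, MeasurableSpace (Ω i)]
    (P : ∀ i, Measure (Ω i)) (m : ∀ i, Ω i → Measure ℝ) (μ : Measure ℝ) : Prop :=
  ∀ f : ℝ →ᵇ ℝ, ∀ ε : ℝ, 0 < ε →
    Tendsto (fun i => P i {ω | ε < |∫ x, f x ∂(m i ω) - ∫ x, f x ∂μ|}) atTop (𝓝 0)

/-- The interval `I_{d,k}`. -/
noncomputable def laplacianInterval (d k : ℕ) : Set ℝ :=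
  Set.Icc ((√((k : ℝ) - 1) - √(d : ℝ)) ^ 2) ((√((k : ℝ) - 1) + √(d : ℝ)) ^ 2)

/-- The density of `ν_{d,k}` on `I_{d,k}`. -/
noncomputable def laplacianDensity (d k : ℕ) (x : ℝ) : ℝ :=
  k * √(4 * ((k : ℝ) - 1) * d - ((k : ℝ) - 1 + d - x) ^ 2) /
    (2 * Real.pi * x * (((d : ℝ) + 1) * k - x))

/-- The measure `ν_{d,k}`. -/
noncomputable def laplacianLimit (d k : ℕ) : Measure ℝ :=
  (volume.restrict (laplacianInterval d k)).withDensity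
    fun x => ENNReal.ofReal (laplacianDensity d k x)

/-- The interval `J_{d,k}`. -/
noncomputable def adjacencyInterval (d k : ℕ) : Set ℝ :=
  Set.Icc (-(d : ℝ) + 1 - 2 * √(((k : ℝ) - 1) * d)) (-(d : ℝ) + 1 + 2 * √(((k : ℝ) - 1) * d))

/-- The density of `μ_{d,k}` on `J_{d,k}`. -/
noncomputable def adjacencyDensity (d k : ℕ) (x : ℝ) : ℝ :=
  k * √(4 * ((k : ℝ) - 1) * d - (x - 1 + d) ^ 2) /
    (2 * Real.pi * ((k : ℝ) - x) * ((d : ℝ) * k + x))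

/-- The measure `μ_{d,k}`: the image of `ν_{d,k}` under `x ↦ k - x`. -/
noncomputable def adjacencyLimit (d k : ℕ) : Measure ℝ :=
  (laplacianLimit d k).map fun x => (k : ℝ) - x

/-- `ν` is a Borel probability measure with `ν(B) = ∫_{B ∩ I} ρ(x) dx` for all Borel sets `B`, the
function `ρ` being integrable over `I`. -/
def IsProbabilityWithDensity (ν : Measure ℝ) (I : Set ℝ) (ρ : ℝ → ℝ) : Prop :=
  IsProbabilityMeasure ν ∧ IntegrableOn ρ I ∧
    ∀ B : Set ℝ, MeasurableSet B → ν.real B = ∫ x in B ∩ I, ρ x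

end Spectral

/-!
# Spectra of random Steiner complexes

The proof is a moment method, organised so that the moments never have to be computed.

Let `A j` be the adjacency matrix of the `j`-th Steiner system on the sets with `d` vertices.
Every such set lies in exactly one block, so `1 - A j` is `d + 1` times a projection: it is a
direct sum of the rank one matrices given by the signed facets of the blocks. Hence
`A j ^ 2 = d + (1 - d) A j` (`adjacencyMatrix_blockWeight_mul_self`). Consequently, for certain monic
polynomials `wordPoly d k m` given by a three-term recurrence, `wordPoly d k m` at `∑ A j` is,
for `m ≥ 1`, the sum of all products of `m` matrices `A j` with distinct neighbouring indices
(`aeval_wordPoly`). Its trace is at most the number of closed walks with `m` steps that change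
the system at each step (`abs_trace_reducedWords_le`).

Such walks rarely close up, as most of them meet a new vertex at every step. Otherwise, take the
first step that stays within the old vertices, and let `v` be the new vertex of the step before
it. The two steps use different systems, and the history uses no block of the second system that
contains `v`. So in the second system `v` can be exchanged with any vertex that the walk has not
met, without changing the history or the probability, and this costs a factor `O(1 / n)`
(`card_isReducedWalk_cons_le`, `exists_sum_closedWalks_le`). Therefore the normalised traces of
`wordPoly d k m` tend to zero in `L¹` for `m ≥ 1`; in other words, the `A j` are asymptotically
free.

The limit law is characterised by the same orthogonality: `∫ wordPoly d k m = 0` for `m ≥ 1`.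
With `x = 1 - d + 2 q cos θ`, `q² = d (k - 1)`, the integrals satisfy a linear recurrence with
no characteristic root inside the unit disc, and they tend to zero by the Riemann–Lebesgue
lemma, so they vanish (`integral_angleWeight_mul_angleFun`). The case `m = 0` of the recurrence
gives the total mass `1`. The argument covers the borderline case `k = d + 1`, where a root has
modulus one and the density is unbounded.

Finally, the adjacency matrix of the union differs from `∑ A j`, and its upper Laplacian from
`k - ∑ A j`, only through blocks common to two systems. These are counted by closed walks with two
steps (`sum_abs_faceWeight_sub_le`), so traces of polynomials are hardly affected
(`exists_abs_trace_aeval_sub_le`). As all spectra lie in a fixed interval, polynomial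
approximation and Markov's inequality give weak convergence in probability
(`convergesWeaklyInProbability_of_trace`).
-/

/-! ### Orientations and boundaries -/

/-- If a permutation `π` of the vertices of a simplex matches the facet opposite to `i'` with the
facet opposite to `i` through `ρ`, then the signs of `π` and `ρ` differ by `(-1) ^ (i + i')`. -/
theorem sign_eq_of_succAbove {m : ℕ} (π : Equiv.Perm (Fin (m + 1))) (ρ : Equiv.Perm (Fin m))
    (i i' : Fin (m + 1)) (h : ∀ j, π (i'.succAbove j) = i.succAbove (ρ j)) :
    Equiv.Perm.sign π = (-1) ^ (i : ℕ) * (-1) ^ (i' : ℕ) * Equiv.Perm.sign ρ := by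
  -- Cycling the omitted vertices `i'` and `i` to the front turns `π` into the extension of `ρ` that
  -- fixes `0`.
  have key : (i.cycleRange * π * (i'.cycleRange)⁻¹ : Equiv.Perm (Fin (m + 1)))
      = Equiv.Perm.decomposeFin.symm (0, ρ) := by
    have hs : ∀ j : Fin m, (i.cycleRange * π * (i'.cycleRange)⁻¹ : Equiv.Perm _) j.succ
        = (ρ j).succ := by
      intro j
      rw [Equiv.Perm.mul_apply, Equiv.Perm.mul_apply]
      change i.cycleRange (π (i'.cycleRange.symm j.succ)) = _
      rw [Fin.cycleRange_symm_succ, h, ← Fin.cycleRange_symm_succ, Equiv.apply_symm_apply]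
    have hs' : ∀ j : Fin m, (i.cycleRange * π * (i'.cycleRange)⁻¹ : Equiv.Perm _) j.succ
        = Equiv.Perm.decomposeFin.symm (0, ρ) j.succ := by
      intro j
      rw [hs, Equiv.Perm.decomposeFin_symm_apply_succ]
      simp
    generalize (i.cycleRange * π * (i'.cycleRange)⁻¹ : Equiv.Perm (Fin (m + 1))) = θ at hs hs'
    ext x
    refine Fin.cases ?_ (fun j => ?_) x
    · have h0 : θ 0 = 0 := by
        by_contra hne
        obtain ⟨y, hy⟩ := Fin.exists_succ_eq.2 hne
        have := hs (ρ.symm y)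
        rw [Equiv.apply_symm_apply, hy] at this
        exact Fin.succ_ne_zero _ (θ.injective this)
      rw [h0]; simp
    · rw [hs']
  have := congrArg Equiv.Perm.sign key
  rw [Equiv.Perm.decomposeFin.symm_sign, Equiv.Perm.sign_mul, Equiv.Perm.sign_mul,
    Equiv.Perm.sign_inv, Fin.sign_cycleRange, Fin.sign_cycleRange, if_pos rfl, one_mul] at this
  rw [← this]
  have h1 : ∀ j : ℕ, ((-1 : ℤˣ) ^ j) * (-1) ^ j = 1 := fun j => Int.units_mul_self _
  calc Equiv.Perm.sign π = (((-1) ^ (i : ℕ)) * (-1) ^ (i : ℕ)) *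
        (((-1) ^ (i' : ℕ)) * (-1) ^ (i' : ℕ)) * Equiv.Perm.sign π := by rw [h1, h1]; simp
    _ = _ := by simp only [mul_comm, mul_left_comm, mul_assoc]

namespace OrientedFace

variable {V : Type*} {X : PreAbstractSimplicialComplex V} {m : ℕ}

theorem mk_eq_mk_iff {s s' : OrderedFace X m} {ε ε' : ℤˣ} :
    mk s ε = mk s' ε' ↔
      ∃ π : Equiv.Perm (Fin m), s' = s.permute π ∧ ε' = Equiv.Perm.sign π * ε :=
  Quotient.eq (r := orientationSetoid X m)

theorem support_mk (s : OrderedFace X m) (ε : ℤˣ) :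
    (mk s ε).support = Finset.univ.map s.1 := rfl

theorem exists_mk (σ : OrientedFace X m) : ∃ s ε, σ = mk s ε := by
  induction σ using Quotient.inductionOn with
  | _ a => exact ⟨a.1, a.2, rfl⟩

theorem mk_left_injective {s : OrderedFace X m} {ε ε' : ℤˣ} (h : mk s ε = mk s ε') : ε = ε' := by
  obtain ⟨π, h1, h2⟩ := mk_eq_mk_iff.1 h
  have : π = 1 := by
    ext j
    have := congrArg (fun t : OrderedFace X m => t.1 j) h1
    exact congrArg Fin.val (s.1.injective this.symm)
  rw [h2, this]; simp

theorem exists_permute {s s' : OrderedFace X m}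
    (h : Finset.univ.map s'.1 = Finset.univ.map s.1) :
    ∃ π : Equiv.Perm (Fin m), s' = s.permute π := by
  have h1 : ∀ j, ∃ i, s.1 i = s'.1 j := fun j => by
    have : s'.1 j ∈ Finset.univ.map s'.1 := Finset.mem_map_of_mem _ (Finset.mem_univ j)
    rw [h] at this
    simpa using this
  choose π hπ using h1
  have hinj : Function.Injective π := fun a b hab => s'.1.injective (by rw [← hπ, ← hπ, hab])
  refine ⟨Equiv.ofBijective π (Finite.injective_iff_bijective.1 hinj), ?_⟩
  apply Subtype.ext
  ext j
  exact (hπ j).symm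

/-- An ordering of the underlying face represents each of its two orientations. -/
theorem exists_eq_mk (σ : OrientedFace X m) (s : OrderedFace X m)
    (h : σ.support = Finset.univ.map s.1) : ∃ ε, σ = mk s ε := by
  obtain ⟨s', ε, rfl⟩ := exists_mk σ
  obtain ⟨π, hπ⟩ := exists_permute (h.symm : Finset.univ.map s.1 = Finset.univ.map s'.1)
  exact ⟨Equiv.Perm.sign π * ε, mk_eq_mk_iff.2 ⟨π, hπ, rfl⟩⟩

theorem MemBoundary.support_subset {σ : OrientedFace X m} {τ : OrientedFace X (m + 1)}
    (h : MemBoundary σ τ) : σ.support ⊆ τ.support := by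
  obtain ⟨t, ε, i, s, hs, rfl, rfl⟩ := h
  rw [support_mk, support_mk, hs, ← Finset.map_map]
  exact Finset.map_subset_map.2 (Finset.subset_univ _)

/-- Only one of the two orientations of a facet lies in the boundary of an oriented face. -/
theorem MemBoundary.not_flip {σ : OrientedFace X m} {τ : OrientedFace X (m + 1)}
    (h : MemBoundary σ τ) : ¬ MemBoundary σ.flip τ := by
  intro h'
  obtain ⟨t, ε, i, s, hs, rfl, rfl⟩ := h
  obtain ⟨t', ε', i', s', hs', hτ, hσ⟩ := h'
  obtain ⟨π, hπ, hε⟩ := mk_eq_mk_iff.1 hτ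
  rw [flip_mk] at hσ
  obtain ⟨ρ, hρ, hε'⟩ := mk_eq_mk_iff.1 hσ
  have key := sign_eq_of_succAbove π ρ i i' (fun j => by
    apply t.1.injective
    have e1 : s'.1 j = t'.1 (i'.succAbove j) := by rw [hs']; rfl
    have e2 : s'.1 j = s.1 (ρ j) := by rw [hρ]; rfl
    have e3 : s.1 (ρ j) = t.1 (i.succAbove (ρ j)) := by rw [hs]; rfl
    have e4 : t'.1 (i'.succAbove j) = t.1 (π (i'.succAbove j)) := by rw [hπ]; rfl
    rw [← e4, ← e1, e2, e3])
  rw [hε, key] at hε'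
  have h1 : ((-1 : ℤˣ) ^ (i' : ℕ)) * (-1) ^ (i' : ℕ) = 1 := Int.units_mul_self _
  have h2 : (-1 : ℤˣ) ^ (i' : ℕ) * ((-1) ^ (i : ℕ) * (-1) ^ (i' : ℕ) * Equiv.Perm.sign ρ * ε)
      = Equiv.Perm.sign ρ * ((-1) ^ (i : ℕ) * ε) := by
    calc _ = ((-1 : ℤˣ) ^ (i' : ℕ) * (-1) ^ (i' : ℕ)) *
        (Equiv.Perm.sign ρ * ((-1) ^ (i : ℕ) * ε)) := by
          simp only [mul_comm, mul_left_comm, mul_assoc]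
      _ = _ := by rw [h1, one_mul]
  rw [h2] at hε'
  have h3 := mul_left_cancel hε'
  generalize (-1 : ℤˣ) ^ (i : ℕ) * ε = u at h3
  rcases Int.units_eq_one_or u with rfl | rfl <;> revert h3 <;> decide

theorem MemBoundary.unique {s : OrderedFace X m} {ε ε' : ℤˣ} {τ : OrientedFace X (m + 1)}
    (h : MemBoundary (mk s ε) τ) (h' : MemBoundary (mk s ε') τ) : ε' = ε := by
  by_contra hne
  exact h.not_flip (by rwa [flip_mk, ← Int.units_ne_iff_eq_neg.1 hne])

end OrientedFace

/-! ### Incidence signs -/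

/-- The subsets of `{0, …, n - 1}` with `m` elements. -/
abbrev Facet (n m : ℕ) : Type := {σ : Finset (Fin n) // σ.card = m}

namespace Facet

variable {n m : ℕ}

/-- The increasing ordering of the vertices. -/
def ordering (σ : Facet n m) : Fin m ↪ Fin n := (σ.1.orderEmbOfFin σ.2).toEmbedding

theorem map_ordering (σ : Facet n m) : Finset.univ.map σ.ordering = σ.1 :=
  Finset.map_orderEmbOfFin_univ _ _

theorem exists_succAbove {σ : Facet n m} {τ : Facet n (m + 1)} (h : σ.1 ⊆ τ.1) :
    ∃ i : Fin (m + 1), σ.ordering = (Fin.succAboveEmb i).trans τ.ordering := by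
  have hne : (τ.1 \ σ.1).Nonempty := by
    apply Finset.card_pos.1
    rw [Finset.card_sdiff_of_subset h, σ.2, τ.2]; omega
  obtain ⟨x, hx⟩ := hne
  rw [Finset.mem_sdiff, ← τ.map_ordering] at hx
  obtain ⟨i, -, hi⟩ := Finset.mem_map.1 hx.1
  refine ⟨i, ?_⟩
  ext j
  have hmono : StrictMono ((Fin.succAboveEmb i).trans τ.ordering) := fun a b hab =>
    (τ.1.orderEmbOfFin τ.2).strictMono (Fin.strictMono_succAbove i hab)
  have hsub : Finset.univ.map ((Fin.succAboveEmb i).trans τ.ordering) = σ.1 := by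
    symm
    apply Finset.eq_of_subset_of_card_le
    · intro y hy
      have hy' := h hy
      rw [← τ.map_ordering] at hy'
      obtain ⟨l, -, hl⟩ := Finset.mem_map.1 hy'
      have hli : l ≠ i := by
        rintro rfl
        exact hx.2 (by rw [← hi, hl]; exact hy)
      obtain ⟨j, rfl⟩ := Fin.exists_succAbove_eq hli
      exact Finset.mem_map.2 ⟨j, Finset.mem_univ _, hl⟩
    · rw [Finset.card_map, Finset.card_univ, Fintype.card_fin, σ.2]
  have := Finset.orderEmbOfFin_unique σ.2 (f := (Fin.succAboveEmb i).trans τ.ordering)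
    (fun x => by rw [← hsub]; exact Finset.mem_map_of_mem _ (Finset.mem_univ x)) hmono
  exact congrArg Fin.val (congrFun this j).symm

open Classical in
/-- The incidence sign of the facet `σ` in `τ`, both with the increasing orientation, and `1` if
`σ` is not a facet of `τ`. -/
noncomputable def sign (σ : Facet n m) (τ : Facet n (m + 1)) : ℤˣ :=
  if h : σ.1 ⊆ τ.1 then (-1) ^ ((exists_succAbove h).choose : ℕ) else 1

variable {X : PreAbstractSimplicialComplex (Fin n)}

/-- A face of `X` with the increasing ordering of its vertices. -/
def toOrdered (σ : Facet n m) (h : σ.1 ∈ X.faces) : OrderedFace X m :=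
  ⟨σ.ordering, by rwa [σ.map_ordering]⟩

theorem support_mk_toOrdered (σ : Facet n m) (h : σ.1 ∈ X.faces) (ε : ℤˣ) :
    (OrientedFace.mk (σ.toOrdered h) ε).support = σ.1 := σ.map_ordering

theorem memBoundary_iff (σ : Facet n m) (τ : Facet n (m + 1)) (hσ : σ.1 ∈ X.faces)
    (hτ : τ.1 ∈ X.faces) (ε δ : ℤˣ) :
    OrientedFace.MemBoundary (OrientedFace.mk (σ.toOrdered hσ) ε)
      (OrientedFace.mk (τ.toOrdered hτ) δ) ↔ σ.1 ⊆ τ.1 ∧ ε = sign σ τ * δ := by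
  have key : σ.1 ⊆ τ.1 → OrientedFace.MemBoundary
      (OrientedFace.mk (σ.toOrdered hσ) (sign σ τ * δ)) (OrientedFace.mk (τ.toOrdered hτ) δ) := by
    intro h
    refine ⟨τ.toOrdered hτ, δ, (exists_succAbove h).choose, σ.toOrdered hσ,
      (exists_succAbove h).choose_spec, rfl, ?_⟩
    rw [sign, dif_pos h]
  constructor
  · intro h
    have hsub := h.support_subset
    rw [support_mk_toOrdered, support_mk_toOrdered] at hsub
    exact ⟨hsub, (key hsub).unique h⟩
  · rintro ⟨h, rfl⟩
    exact key h

/-- Neighbours in terms of incidence signs: orient `τ` so that its boundary contains `σ` with the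
increasing orientation; then the boundary must contain `σ'` with the sign `-ε`. -/
theorem neighbour_iff (σ σ' : Facet n m) (hσ : σ.1 ∈ X.faces) (hσ' : σ'.1 ∈ X.faces) (ε : ℤˣ) :
    OrientedFace.Neighbour (OrientedFace.mk (σ.toOrdered hσ) 1)
        (OrientedFace.mk (σ'.toOrdered hσ') ε) ↔
      σ ≠ σ' ∧ ∃ τ : Facet n (m + 1), τ.1 ∈ X.faces ∧ σ.1 ⊆ τ.1 ∧ σ'.1 ⊆ τ.1 ∧
        ε = - (sign σ τ * sign σ' τ) := by
  rw [OrientedFace.Neighbour, support_mk_toOrdered, support_mk_toOrdered, OrientedFace.flip_mk,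
    Ne, ← Subtype.ext_iff, ← Ne]
  refine and_congr_right fun _ => ?_
  constructor
  · rintro ⟨o, h1, h2⟩
    obtain ⟨t, δ, rfl⟩ := OrientedFace.exists_mk o
    let τ : Facet n (m + 1) := ⟨Finset.univ.map t.1, by simp⟩
    obtain ⟨δ', hδ'⟩ := OrientedFace.exists_eq_mk (OrientedFace.mk t δ) (τ.toOrdered t.2)
      (τ.map_ordering.symm)
    rw [hδ', memBoundary_iff] at h1 h2
    refine ⟨τ, t.2, h1.1, h2.1, ?_⟩
    have e1 : δ' = sign σ τ := by
      rw [← one_mul δ', ← Int.units_mul_self (sign σ τ), mul_assoc, ← h1.2, mul_one]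
    rw [← neg_neg ε, h2.2, e1, mul_comm]
  · rintro ⟨τ, hτ, h1, h2, rfl⟩
    refine ⟨OrientedFace.mk (τ.toOrdered hτ) (sign σ τ), ?_, ?_⟩
    · rw [memBoundary_iff]; exact ⟨h1, (Int.units_mul_self _).symm⟩
    · rw [memBoundary_iff]; exact ⟨h2, by rw [neg_neg, mul_comm]⟩

variable (hX : ∀ σ : Facet n m, σ.1 ∈ X.faces)

/-- If `X` contains all the sets with `m` vertices, its oriented faces with `m` vertices are these
sets with a sign, which compares the orientation with the increasing one. -/
noncomputable def orientedEquiv : Facet n m × ℤˣ ≃ OrientedFace X m :=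
  Equiv.ofBijective (fun a => OrientedFace.mk (a.1.toOrdered (hX a.1)) a.2) (by
    constructor
    · rintro ⟨σ, ε⟩ ⟨σ', ε'⟩ h
      have h1 := congrArg OrientedFace.support h
      simp only [support_mk_toOrdered] at h1
      obtain rfl : σ = σ' := Subtype.ext h1
      exact Prod.ext rfl (OrientedFace.mk_left_injective h)
    · intro o
      obtain ⟨s, ε, rfl⟩ := OrientedFace.exists_mk o
      let σ : Facet n m := ⟨Finset.univ.map s.1, by simp⟩
      obtain ⟨δ, hδ⟩ := OrientedFace.exists_eq_mk (OrientedFace.mk s ε) (σ.toOrdered (hX σ))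
        σ.map_ordering.symm
      exact ⟨(σ, δ), hδ.symm⟩)

theorem orientedEquiv_apply (σ : Facet n m) (ε : ℤˣ) :
    orientedEquiv hX (σ, ε) = OrientedFace.mk (σ.toOrdered (hX σ)) ε := rfl

theorem flip_orientedEquiv (a : Facet n m × ℤˣ) :
    (orientedEquiv hX a).flip = orientedEquiv hX (a.1, -a.2) := rfl

/-- The forms of degree `m - 1` are the functions on the sets with `m` vertices, if `X` contains all
these sets. -/
noncomputable def formEquiv : Form X m ≃ₗ[ℝ] (Facet n m → ℝ) where
  toFun f σ := f.1 (orientedEquiv hX (σ, 1))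
  map_add' _ _ := rfl
  map_smul' _ _ := rfl
  invFun g := ⟨fun o => (((orientedEquiv hX).symm o).2 : ℤ) * g ((orientedEquiv hX).symm o).1, by
    intro o
    obtain ⟨a, rfl⟩ := (orientedEquiv hX).surjective o
    dsimp only
    rw [flip_orientedEquiv, Equiv.symm_apply_apply, Equiv.symm_apply_apply]
    simp⟩
  left_inv f := by
    apply Subtype.ext
    funext o
    obtain ⟨⟨σ, ε⟩, rfl⟩ := (orientedEquiv hX).surjective o
    simp only [Equiv.symm_apply_apply]
    rcases Int.units_eq_one_or ε with rfl | rfl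
    · simp
    · have := f.2 (orientedEquiv hX (σ, 1))
      rw [flip_orientedEquiv] at this
      rw [this]; simp
  right_inv g := by
    funext σ
    simp

theorem form_apply (f : Form X m) (σ : Facet n m) (ε : ℤˣ) :
    f.1 (orientedEquiv hX (σ, ε)) = ((ε : ℤ) : ℝ) * formEquiv hX f σ := by
  rcases Int.units_eq_one_or ε with rfl | rfl
  · simp [formEquiv]
  · have := f.2 (orientedEquiv hX (σ, 1))
    rw [flip_orientedEquiv] at this
    rw [this]; simp [formEquiv]

end Facet

/-! ### The matrices of the operators -/

namespace Facet

variable {n m : ℕ}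

/-- Two different sets with `m` vertices have at most one common superset with `m + 1` vertices. -/
theorem eq_of_subset_of_subset {σ σ' : Facet n m} {τ τ' : Facet n (m + 1)} (hne : σ ≠ σ')
    (h1 : σ.1 ⊆ τ.1) (h2 : σ'.1 ⊆ τ.1) (h1' : σ.1 ⊆ τ'.1) (h2' : σ'.1 ⊆ τ'.1) : τ = τ' := by
  have hc : m + 1 ≤ (σ.1 ∪ σ'.1).card := by
    by_contra hlt
    have hle : (σ.1 ∪ σ'.1).card ≤ m := by omega
    have e1 : σ.1 = σ.1 ∪ σ'.1 :=
      Finset.eq_of_subset_of_card_le Finset.subset_union_left (by rw [σ.2]; exact hle)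
    have e2 : σ'.1 = σ.1 ∪ σ'.1 :=
      Finset.eq_of_subset_of_card_le Finset.subset_union_right (by rw [σ'.2]; exact hle)
    exact hne (Subtype.ext (e1.trans e2.symm))
  have e : ∀ t : Facet n (m + 1), σ.1 ⊆ t.1 → σ'.1 ⊆ t.1 → σ.1 ∪ σ'.1 = t.1 := fun t a b =>
    Finset.eq_of_subset_of_card_le (Finset.union_subset a b) (by rw [t.2]; exact hc)
  exact Subtype.ext ((e τ h1 h2).symm.trans (e τ' h1' h2'))

theorem card_facets (τ : Facet n (m + 1)) :
    (Finset.univ.filter fun σ : Facet n m => σ.1 ⊆ τ.1).card = m + 1 := by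
  have h : ((Finset.univ.filter fun σ : Facet n m => σ.1 ⊆ τ.1).map
      (Function.Embedding.subtype _)) = τ.1.powersetCard m := by
    ext s
    simp only [Finset.mem_map, Finset.mem_filter, Finset.mem_univ, true_and,
      Finset.mem_powersetCard, Function.Embedding.subtype_apply]
    constructor
    · rintro ⟨σ, h, rfl⟩; exact ⟨h, σ.2⟩
    · rintro ⟨h, h'⟩; exact ⟨⟨s, h'⟩, h, rfl⟩
  rw [← Finset.card_map, h, Finset.card_powersetCard, τ.2, Nat.choose_succ_self_right]

theorem card_eq : Fintype.card (Facet n m) = n.choose m := by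
  rw [Fintype.card_finset_len, Fintype.card_fin]

end Facet

section Matrices

variable {n m : ℕ}

/-- The signed incidence matrix between the sets with `m` and with `m + 1` vertices, all with the
increasing orientation. -/
noncomputable def incidence (σ : Facet n m) (τ : Facet n (m + 1)) : ℝ :=
  if σ.1 ⊆ τ.1 then ((Facet.sign σ τ : ℤ) : ℝ) else 0

theorem incidence_of_subset {σ : Facet n m} {τ : Facet n (m + 1)} (h : σ.1 ⊆ τ.1) :
    incidence σ τ = ((Facet.sign σ τ : ℤ) : ℝ) := if_pos h

theorem incidence_of_not_subset {σ : Facet n m} {τ : Facet n (m + 1)} (h : ¬ σ.1 ⊆ τ.1) :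
    incidence σ τ = 0 := if_neg h

theorem abs_incidence (σ : Facet n m) (τ : Facet n (m + 1)) :
    |incidence σ τ| = if σ.1 ⊆ τ.1 then 1 else 0 := by
  rw [incidence]
  split_ifs
  · rcases Int.units_eq_one_or (Facet.sign σ τ) with h | h <;> simp [h]
  · simp

theorem incidence_mul_self (σ : Facet n m) (τ : Facet n (m + 1)) :
    incidence σ τ * incidence σ τ = if σ.1 ⊆ τ.1 then 1 else 0 := by
  rw [← abs_mul_abs_self, abs_incidence]
  split_ifs <;> simp

/-- The upper Laplacian of the complex in which every set `τ` with `m + 1` vertices has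
weight `w τ`. -/
noncomputable def laplacianMatrix (w : Facet n (m + 1) → ℝ) :
    Matrix (Facet n m) (Facet n m) ℝ :=
  Matrix.of fun σ σ' => ∑ τ, w τ * (incidence σ τ * incidence σ' τ)

/-- The adjacency matrix of the complex in which every set `τ` with `m + 1` vertices has
weight `w τ`. -/
noncomputable def adjacencyMatrix (w : Facet n (m + 1) → ℝ) :
    Matrix (Facet n m) (Facet n m) ℝ :=
  Matrix.of fun σ σ' => if σ = σ' then 0 else - laplacianMatrix w σ σ'

theorem laplacianMatrix_diag (w : Facet n (m + 1) → ℝ) (σ : Facet n m) :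
    laplacianMatrix w σ σ = ∑ τ with σ.1 ⊆ τ.1, w τ := by
  simp only [laplacianMatrix, Matrix.of_apply, incidence_mul_self, mul_ite, mul_one, mul_zero,
    Finset.sum_filter]

theorem laplacianMatrix_isHermitian (w : Facet n (m + 1) → ℝ) :
    (laplacianMatrix (m := m) w).IsHermitian := by
  ext σ σ'
  simp only [laplacianMatrix, Matrix.conjTranspose_apply, Matrix.of_apply, star_trivial]
  exact Finset.sum_congr rfl fun τ _ => by rw [mul_comm (incidence σ' τ)]

theorem adjacencyMatrix_isHermitian (w : Facet n (m + 1) → ℝ) :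
    (adjacencyMatrix (m := m) w).IsHermitian := by
  ext σ σ'
  have := congrFun (congrFun (laplacianMatrix_isHermitian w) σ) σ'
  simp only [Matrix.conjTranspose_apply, star_trivial] at this
  simp only [adjacencyMatrix, Matrix.conjTranspose_apply, Matrix.of_apply, star_trivial, this,
    eq_comm (a := σ) (b := σ')]

theorem laplacianMatrix_sub (w w' : Facet n (m + 1) → ℝ) :
    laplacianMatrix (m := m) w - laplacianMatrix w' = laplacianMatrix (w - w') := by
  ext σ σ'
  simp only [laplacianMatrix, Matrix.sub_apply, Matrix.of_apply, Pi.sub_apply, sub_mul,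
    Finset.sum_sub_distrib]

theorem adjacencyMatrix_sub (w w' : Facet n (m + 1) → ℝ) :
    adjacencyMatrix (m := m) w - adjacencyMatrix w' = adjacencyMatrix (w - w') := by
  ext σ σ'
  rw [adjacencyMatrix, adjacencyMatrix, adjacencyMatrix, Matrix.sub_apply, Matrix.of_apply,
    Matrix.of_apply, Matrix.of_apply, ← laplacianMatrix_sub, Matrix.sub_apply]
  split_ifs <;> ring

theorem sum_laplacianMatrix {κ : Type*} [Fintype κ] (w : κ → Facet n (m + 1) → ℝ) :
    ∑ j, laplacianMatrix (m := m) (w j) = laplacianMatrix (∑ j, w j) := by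
  ext σ σ'
  simp only [laplacianMatrix, Matrix.sum_apply, Matrix.of_apply, Finset.sum_apply, Finset.sum_mul]
  rw [Finset.sum_comm]

theorem sum_adjacencyMatrix {κ : Type*} [Fintype κ] (w : κ → Facet n (m + 1) → ℝ) :
    ∑ j, adjacencyMatrix (m := m) (w j) = adjacencyMatrix (∑ j, w j) := by
  ext σ σ'
  rw [adjacencyMatrix, Matrix.of_apply, ← sum_laplacianMatrix, Matrix.sum_apply]
  simp only [adjacencyMatrix, Matrix.of_apply]
  split_ifs
  · simp
  · rw [Matrix.sum_apply, Finset.sum_neg_distrib]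

theorem abs_adjacencyMatrix_le (w : Facet n (m + 1) → ℝ) (σ σ' : Facet n m) :
    |adjacencyMatrix w σ σ'| ≤ |laplacianMatrix w σ σ'| := by
  rw [adjacencyMatrix, Matrix.of_apply]
  split_ifs
  · rw [abs_zero]; exact abs_nonneg _
  · rw [abs_neg]

theorem sum_abs_laplacianMatrix_le (w : Facet n (m + 1) → ℝ) (σ : Facet n m) :
    ∑ σ', |laplacianMatrix w σ σ'| ≤ (m + 1) * ∑ τ with σ.1 ⊆ τ.1, |w τ| := by
  calc ∑ σ', |laplacianMatrix w σ σ'|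
      ≤ ∑ σ' : Facet n m, ∑ τ : Facet n (m + 1),
          |w τ| * ((if σ.1 ⊆ τ.1 then 1 else 0) * if σ'.1 ⊆ τ.1 then 1 else 0) := by
        refine Finset.sum_le_sum fun σ' _ => ?_
        rw [laplacianMatrix, Matrix.of_apply]
        refine (Finset.abs_sum_le_sum_abs _ _).trans_eq ?_
        exact Finset.sum_congr rfl fun τ _ => by rw [abs_mul, abs_mul, abs_incidence, abs_incidence]
    _ = ∑ τ : Facet n (m + 1), (if σ.1 ⊆ τ.1 then |w τ| else 0) * (m + 1) := by
        rw [Finset.sum_comm]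
        refine Finset.sum_congr rfl fun τ _ => ?_
        rw [← Finset.mul_sum, ← Finset.mul_sum, Finset.sum_boole, Facet.card_facets]
        push_cast
        split_ifs <;> ring
    _ = _ := by rw [← Finset.sum_mul, Finset.sum_filter, mul_comm]

theorem sum_sum_abs_laplacianMatrix_le (w : Facet n (m + 1) → ℝ) :
    ∑ σ : Facet n m, ∑ σ', |laplacianMatrix w σ σ'| ≤ (m + 1) ^ 2 * ∑ τ, |w τ| := by
  calc _ ≤ ∑ σ : Facet n m, (m + 1) * ∑ τ : Facet n (m + 1), if σ.1 ⊆ τ.1 then |w τ| else 0 :=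
        Finset.sum_le_sum fun σ _ => (sum_abs_laplacianMatrix_le w σ).trans_eq (by
          rw [Finset.sum_filter])
    _ = (m + 1) * ∑ τ : Facet n (m + 1), (m + 1) * |w τ| := by
        rw [← Finset.mul_sum, Finset.sum_comm]
        congr 1
        refine Finset.sum_congr rfl fun τ _ => ?_
        rw [← Finset.sum_filter, Finset.sum_const, Facet.card_facets]
        simp
    _ = _ := by rw [← Finset.mul_sum]; ring

open Classical in
/-- The indicator function of the faces of `X` with `m` vertices. -/
noncomputable def faceWeight (X : PreAbstractSimplicialComplex (Fin n)) (τ : Facet n m) : ℝ :=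
  if τ.1 ∈ X.faces then 1 else 0

section Operators

variable {X : PreAbstractSimplicialComplex (Fin n)} (hX : ∀ σ : Facet n m, σ.1 ∈ X.faces)

theorem deg_orientedEquiv (a : Facet n m × ℤˣ) :
    ((Facet.orientedEquiv hX a).deg : ℝ) = laplacianMatrix (faceWeight X) a.1 a.1 := by
  classical
  rw [laplacianMatrix_diag]
  simp only [faceWeight]
  rw [Finset.sum_boole, Finset.filter_filter, OrientedFace.deg]
  have h : {τ : Finset (Fin n) | τ ∈ X.faces ∧ τ.card = m + 1 ∧
      (Facet.orientedEquiv hX a).support ⊆ τ} =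
      ((Finset.univ.filter fun τ : Facet n (m + 1) => a.1.1 ⊆ τ.1 ∧ τ.1 ∈ X.faces).map
        (Function.Embedding.subtype _) : Finset (Finset (Fin n))) := by
    obtain ⟨σ, ε⟩ := a
    ext τ
    rw [Facet.orientedEquiv_apply, Facet.support_mk_toOrdered]
    simp only [Set.mem_ofPred_eq, Finset.coe_map, Set.mem_image, Finset.mem_coe, Finset.mem_filter,
      Finset.mem_univ, true_and, Function.Embedding.subtype_apply]
    constructor
    · rintro ⟨h1, h2, h3⟩; exact ⟨⟨τ, h2⟩, ⟨h3, h1⟩, rfl⟩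
    · rintro ⟨τ, ⟨h3, h1⟩, rfl⟩; exact ⟨h1, τ.2, h3⟩
  rw [h, Set.ncard_coe_finset, Finset.card_map]

open Classical in
/-- The entries of the adjacency matrix count the orientations of `σ'` that are neighbours of `σ`,
with their signs. -/
theorem sum_neighbour_sign (σ σ' : Facet n m) :
    (∑ ε : ℤˣ, if OrientedFace.Neighbour (Facet.orientedEquiv hX (σ, 1))
      (Facet.orientedEquiv hX (σ', ε)) then ((ε : ℤ) : ℝ) else 0) =
    adjacencyMatrix (faceWeight X) σ σ' := by
  simp only [Facet.orientedEquiv_apply, Facet.neighbour_iff]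
  rw [adjacencyMatrix, Matrix.of_apply]
  by_cases hσ : σ = σ'
  · simp [hσ]
  rw [if_neg hσ, laplacianMatrix, Matrix.of_apply]
  by_cases hτ : ∃ τ : Facet n (m + 1), τ.1 ∈ X.faces ∧ σ.1 ⊆ τ.1 ∧ σ'.1 ⊆ τ.1
  · obtain ⟨τ, h0, h1, h2⟩ := hτ
    rw [Finset.sum_eq_single τ, faceWeight, if_pos h0, incidence_of_subset h1,
      incidence_of_subset h2]
    · have : ∀ ε : ℤˣ, (σ ≠ σ' ∧ ∃ τ : Facet n (m + 1), τ.1 ∈ X.faces ∧ σ.1 ⊆ τ.1 ∧ σ'.1 ⊆ τ.1 ∧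
          ε = -(Facet.sign σ τ * Facet.sign σ' τ)) ↔
          ε = -(Facet.sign σ τ * Facet.sign σ' τ) := fun ε => by
        constructor
        · rintro ⟨-, τ', -, h1', h2', h⟩
          rwa [Facet.eq_of_subset_of_subset hσ h1 h2 h1' h2']
        · exact fun h => ⟨hσ, τ, h0, h1, h2, h⟩
      simp only [this, Finset.sum_ite_eq', Finset.mem_univ, if_true]
      simp
    · intro τ' _ hne
      by_cases h1' : σ.1 ⊆ τ'.1
      · by_cases h2' : σ'.1 ⊆ τ'.1
        · exact absurd (Facet.eq_of_subset_of_subset hσ h1' h2' h1 h2) hne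
        · rw [incidence_of_not_subset h2', mul_zero, mul_zero]
      · rw [incidence_of_not_subset h1', zero_mul, mul_zero]
    · simp
  · rw [Finset.sum_eq_zero, Finset.sum_eq_zero, neg_zero]
    · intro τ _
      by_cases h0 : τ.1 ∈ X.faces
      · by_cases h1' : σ.1 ⊆ τ.1
        · by_cases h2' : σ'.1 ⊆ τ.1
          · exact absurd ⟨τ, h0, h1', h2'⟩ hτ
          · rw [incidence_of_not_subset h2', mul_zero, mul_zero]
        · rw [incidence_of_not_subset h1', zero_mul, mul_zero]
      · rw [faceWeight, if_neg h0, zero_mul]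
    · intro ε _
      rw [if_neg]
      rintro ⟨-, τ, h0, h1, h2, -⟩
      exact hτ ⟨τ, h0, h1, h2⟩

/-- In the coordinates of `Facet.formEquiv` the adjacency operator is the adjacency matrix. -/
theorem formEquiv_adjacencyOperator (f : Form X m) :
    Facet.formEquiv hX (adjacencyOperator X m f) =
      (adjacencyMatrix (faceWeight X)).mulVec (Facet.formEquiv hX f) := by
  classical
  funext σ
  change (∑ σ' with OrientedFace.Neighbour (Facet.orientedEquiv hX (σ, 1)) σ', f.1 σ') = _
  rw [Finset.sum_filter, ← (Facet.orientedEquiv hX).sum_comp, Fintype.sum_prod_type,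
    Matrix.mulVec, dotProduct]
  refine Finset.sum_congr rfl fun σ' _ => ?_
  rw [← sum_neighbour_sign hX, Finset.sum_mul]
  refine Finset.sum_congr rfl fun ε _ => ?_
  rw [Facet.form_apply, ite_mul, zero_mul]

/-- In the coordinates of `Facet.formEquiv` the upper Laplacian is the Laplacian matrix. -/
theorem formEquiv_upperLaplacian (f : Form X m) :
    Facet.formEquiv hX (upperLaplacian X m f) =
      (laplacianMatrix (faceWeight X)).mulVec (Facet.formEquiv hX f) := by
  classical
  rw [upperLaplacian, LinearMap.sub_apply, map_sub, formEquiv_adjacencyOperator]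
  funext σ
  have h1 : Facet.formEquiv hX (degreeOperator X m f) σ =
      laplacianMatrix (faceWeight X) σ σ * Facet.formEquiv hX f σ := by
    rw [← deg_orientedEquiv hX (σ, 1)]; rfl
  rw [Pi.sub_apply, h1, Matrix.mulVec, Matrix.mulVec, dotProduct, dotProduct,
    ← Finset.add_sum_erase _ _ (Finset.mem_univ σ), ← Finset.add_sum_erase _ _ (Finset.mem_univ σ)]
  have h2 : ∀ σ' ∈ Finset.univ.erase σ, adjacencyMatrix (faceWeight X) σ σ' *
      Facet.formEquiv hX f σ' = - (laplacianMatrix (faceWeight X) σ σ' *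
      Facet.formEquiv hX f σ') := fun σ' h => by
    rw [adjacencyMatrix, Matrix.of_apply, if_neg (Finset.ne_of_mem_erase h).symm, neg_mul]
  rw [Finset.sum_congr rfl h2, Finset.sum_neg_distrib, adjacencyMatrix, Matrix.of_apply,
    if_pos rfl]
  ring

end Operators

end Matrices

/-! ### Empirical spectral distributions and traces -/

section Spectrum

variable {ι : Type*} [Fintype ι]

theorem trace_aeval_eq_sum_eigenvalues [DecidableEq ι] {M : Matrix ι ι ℝ} (hM : M.IsHermitian)
    (p : Polynomial ℝ) : (Polynomial.aeval M p).trace = ∑ i, p.eval (hM.eigenvalues i) := by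
  have h1 : Polynomial.aeval M p = Unitary.conjStarAlgAut ℝ _ hM.eigenvectorUnitary
      (Polynomial.aeval (Matrix.diagonal hM.eigenvalues) p) := by
    rw [← Polynomial.aeval_algHom_apply]
    congr 1
    exact congrArg (fun x => Polynomial.aeval (R := ℝ) x) hM.spectral_theorem
  have h2 : Polynomial.aeval (Matrix.diagonal hM.eigenvalues) p =
      Matrix.diagonal fun i => p.eval (hM.eigenvalues i) := by
    have := Polynomial.aeval_algHom_apply (Matrix.diagonalAlgHom (n := ι) (α := ℝ) ℝ)
      hM.eigenvalues p
    rw [Matrix.diagonalAlgHom_apply] at this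
    rw [this, Polynomial.aeval_pi_apply, Matrix.diagonalAlgHom_apply]
    rfl
  rw [h1, h2, Unitary.conjStarAlgAut_apply, Matrix.trace_mul_cycle, Unitary.coe_star_mul_self,
    one_mul, Matrix.trace_diagonal]

/-- Gershgorin's bound. -/
theorem abs_eigenvalues_le [DecidableEq ι] {M : Matrix ι ι ℝ} (hM : M.IsHermitian) {K : ℝ}
    (hK : ∀ i, ∑ j, |M i j| ≤ K) (i : ι) : |hM.eigenvalues i| ≤ K := by
  have h0 : Module.End.HasEigenvalue (Matrix.toLin' M) (hM.eigenvalues i) := by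
    rw [Module.End.hasEigenvalue_iff_mem_spectrum, Matrix.spectrum_toLin']
    exact hM.eigenvalues_mem_spectrum_real i
  obtain ⟨l, hl⟩ := eigenvalue_mem_ball h0
  rw [Metric.mem_closedBall, Real.dist_eq] at hl
  have h1 := hK l
  rw [← Finset.add_sum_erase _ _ (Finset.mem_univ l)] at h1
  simp only [Real.norm_eq_abs] at hl
  have h2 := abs_sub_abs_le_abs_sub (hM.eigenvalues i) (M l l)
  linarith

theorem integral_empiricalSpectralDistribution [DecidableEq ι] {W : Type*}
    [AddCommGroup W] [Module ℝ W] [Module.Finite ℝ W] (T : W →ₗ[ℝ] W)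
    (φ : W ≃ₗ[ℝ] (ι → ℝ)) {M : Matrix ι ι ℝ} (hM : M.IsHermitian)
    (h : ∀ f, φ (T f) = M.mulVec (φ f)) (f : ℝ → ℝ) :
    ∫ x, f x ∂(empiricalSpectralDistribution T) =
      (Fintype.card ι : ℝ)⁻¹ * ∑ i, f (hM.eigenvalues i) := by
  have hc : T.charpoly = M.charpoly := by
    rw [← LinearEquiv.charpoly_conj φ T, ← LinearMap.charpoly_toMatrix _ (Pi.basisFun ℝ ι)]
    congr 1
    have : φ.conj T = Matrix.toLin' M := by
      ext1 i
      ext1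
      rw [LinearMap.comp_apply, LinearMap.comp_apply, LinearEquiv.conj_apply_apply, h,
        LinearEquiv.apply_symm_apply, Matrix.toLin'_apply]
    rw [this]
    exact LinearMap.toMatrix'_toLin' M
  have hr : Module.finrank ℝ W = Fintype.card ι := by
    rw [LinearEquiv.finrank_eq φ, Module.finrank_fintype_fun_eq_card]
  rw [empiricalSpectralDistribution, hc, hM.roots_charpoly_eq_eigenvalues, hr,
    integral_smul_measure, Multiset.map_map]
  change _ • ∫ x, f x ∂(∑ i, Measure.dirac (hM.eigenvalues i)) = _
  rw [integral_finsetSum_measure (fun i _ => integrable_dirac (by simp))]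
  simp [integral_dirac]

/-! ### Perturbation of traces -/

theorem sum_abs_mul_le_of_row {K : ℝ} {Y N : Matrix ι ι ℝ} (hN : ∀ i, ∑ j, |N i j| ≤ K) :
    ∑ i, ∑ j, |(Y * N) i j| ≤ K * ∑ i, ∑ j, |Y i j| := by
  rw [Finset.mul_sum]
  refine Finset.sum_le_sum fun i _ => ?_
  calc ∑ j, |(Y * N) i j| ≤ ∑ j, ∑ l, |Y i l| * |N l j| := by
        refine Finset.sum_le_sum fun j _ => ?_
        rw [Matrix.mul_apply]
        refine (Finset.abs_sum_le_sum_abs _ _).trans_eq ?_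
        simp only [abs_mul]
    _ = ∑ l, |Y i l| * ∑ j, |N l j| := by
        rw [Finset.sum_comm]; simp only [Finset.mul_sum]
    _ ≤ ∑ l, |Y i l| * K := by
        gcongr with l; exact hN l
    _ = _ := by rw [← Finset.sum_mul, mul_comm]

theorem sum_abs_mul_le_of_col {K : ℝ} {Y N : Matrix ι ι ℝ} (hN : ∀ j, ∑ i, |N i j| ≤ K) :
    ∑ i, ∑ j, |(N * Y) i j| ≤ K * ∑ i, ∑ j, |Y i j| := by
  have := sum_abs_mul_le_of_row (Y := Y.transpose) (N := N.transpose) (K := K) hN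
  rw [← Matrix.transpose_mul] at this
  simp only [Matrix.transpose_apply] at this
  rw [Finset.sum_comm, Finset.sum_comm (f := fun i j => |Y i j|)]
  exact this

/-- A telescoping sum, in the norm given by the sum of the absolute values of the entries. -/
theorem sum_abs_pow_sub_pow_le [DecidableEq ι] {K : ℝ} {M N : Matrix ι ι ℝ} (hK : 0 ≤ K)
    (hM : ∀ i, ∑ j, |M i j| ≤ K) (hN : ∀ j, ∑ i, |N i j| ≤ K) (l : ℕ) :
    ∑ i, ∑ j, |(M ^ l - N ^ l) i j| ≤ l * K ^ (l - 1) * ∑ i, ∑ j, |(M - N) i j| := by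
  have hpow : ∀ (l : ℕ) (Y : Matrix ι ι ℝ),
      ∑ i, ∑ j, |(N ^ l * Y) i j| ≤ K ^ l * ∑ i, ∑ j, |Y i j| := by
    intro l
    induction l with
    | zero => intro Y; simp
    | succ l ih =>
      intro Y
      rw [pow_succ, mul_assoc]
      refine (ih _).trans ?_
      rw [pow_succ, mul_assoc]
      gcongr
      exact sum_abs_mul_le_of_col hN
  induction l with
  | zero => simp
  | succ l ih =>
    have e : M ^ (l + 1) - N ^ (l + 1) = (M ^ l - N ^ l) * M + N ^ l * (M - N) := by
      rw [pow_succ, pow_succ]; noncomm_ring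
    rw [e]
    calc ∑ i, ∑ j, |((M ^ l - N ^ l) * M + N ^ l * (M - N)) i j|
        ≤ ∑ i, ∑ j, (|((M ^ l - N ^ l) * M) i j| + |(N ^ l * (M - N)) i j|) := by
          gcongr with i _ j _; exact abs_add_le _ _
      _ = (∑ i, ∑ j, |((M ^ l - N ^ l) * M) i j|) + ∑ i, ∑ j, |(N ^ l * (M - N)) i j| := by
          simp only [Finset.sum_add_distrib]
      _ ≤ K * (l * K ^ (l - 1) * ∑ i, ∑ j, |(M - N) i j|) +
          K ^ l * ∑ i, ∑ j, |(M - N) i j| := by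
          refine add_le_add ((sum_abs_mul_le_of_row hM).trans ?_) (hpow _ _)
          gcongr
      _ = _ := by
          cases l with
          | zero => simp
          | succ l => simp only [Nat.add_sub_cancel]; push_cast; ring

theorem abs_trace_le (M : Matrix ι ι ℝ) : |M.trace| ≤ ∑ i, ∑ j, |M i j| := by
  rw [Matrix.trace]
  refine (Finset.abs_sum_le_sum_abs _ _).trans (Finset.sum_le_sum fun i _ => ?_)
  exact Finset.single_le_sum (f := fun j => |M i j|) (fun j _ => abs_nonneg _) (Finset.mem_univ i)

end Spectrum

/-- The trace of a polynomial in a matrix depends in a Lipschitz way on the entries of the matrix,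
with a constant that does not depend on the size of the matrix. -/
theorem exists_abs_trace_aeval_sub_le (p : Polynomial ℝ) (K : ℝ) (hK : 0 ≤ K) :
    ∃ C : ℝ, 0 ≤ C ∧ ∀ (ι : Type) [Fintype ι] [DecidableEq ι] (M N : Matrix ι ι ℝ),
      (∀ i, ∑ j, |M i j| ≤ K) → (∀ j, ∑ i, |N i j| ≤ K) →
      |(Polynomial.aeval M p).trace - (Polynomial.aeval N p).trace| ≤
        C * ∑ i, ∑ j, |(M - N) i j| := by
  induction p using Polynomial.induction_on' with
  | add p q hp hq =>
    obtain ⟨C, hC, h⟩ := hp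
    obtain ⟨C', hC', h'⟩ := hq
    refine ⟨C + C', add_nonneg hC hC', fun ι _ _ M N hM hN => ?_⟩
    rw [map_add, map_add, Matrix.trace_add, Matrix.trace_add, add_mul, add_sub_add_comm]
    exact (abs_add_le _ _).trans (add_le_add (h ι M N hM hN) (h' ι M N hM hN))
  | monomial l a =>
    refine ⟨|a| * (l * K ^ (l - 1)), by positivity, fun ι _ _ M N hM hN => ?_⟩
    rw [Polynomial.aeval_monomial, Polynomial.aeval_monomial, ← Algebra.smul_def,
      ← Algebra.smul_def, ← Matrix.trace_sub, ← smul_sub, Matrix.trace_smul, smul_eq_mul, abs_mul,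
      mul_assoc]
    gcongr
    exact (abs_trace_le _).trans (sum_abs_pow_sub_pow_le hK hM hN l)

/-! ### One Steiner system -/

section OneSystem

variable {d n : ℕ}

/-- The indicator function of the blocks of a Steiner system. -/
noncomputable def blockWeight (S : SteinerSystem d n) (τ : Facet n (d + 1)) : ℝ :=
  if τ.1 ∈ S.1 then 1 else 0

/-- The block that contains `σ`. -/
theorem exists_block (S : SteinerSystem d n) (σ : Facet n d) :
    ∃ τ : Facet n (d + 1), ∀ τ' : Facet n (d + 1), τ'.1 ∈ S.1 ∧ σ.1 ⊆ τ'.1 ↔ τ' = τ := by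
  obtain ⟨τ, ⟨h1, h2⟩, h3⟩ := S.2.2 σ.1 σ.2
  refine ⟨⟨τ, S.2.1 τ h1⟩, fun τ' => ⟨fun h => Subtype.ext (h3 _ h), ?_⟩⟩
  rintro rfl
  exact ⟨h1, h2⟩

theorem sum_blockWeight (S : SteinerSystem d n) (σ : Facet n d) :
    ∑ τ with σ.1 ⊆ τ.1, blockWeight S τ = 1 := by
  obtain ⟨τ, hτ⟩ := exists_block S σ
  simp only [blockWeight]
  rw [Finset.sum_boole, Finset.filter_filter]
  have : (Finset.univ.filter fun τ' : Facet n (d + 1) => σ.1 ⊆ τ'.1 ∧ τ'.1 ∈ S.1) = {τ} := by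
    ext τ'
    rw [Finset.mem_filter, Finset.mem_singleton, ← hτ τ', and_comm (a := σ.1 ⊆ τ'.1)]
    simp
  rw [this]; simp

/-- Different blocks have no common facet, so the columns of the incidence matrix that belong to the
blocks are orthogonal, with squared length `d + 1`. -/
theorem laplacianMatrix_blockWeight_mul_self (S : SteinerSystem d n) :
    laplacianMatrix (blockWeight S) * laplacianMatrix (blockWeight S) =
      ((d : ℝ) + 1) • laplacianMatrix (blockWeight S) := by
  have key : ∀ τ τ' : Facet n (d + 1), blockWeight S τ * blockWeight S τ' *
      ∑ ρ : Facet n d, incidence ρ τ * incidence ρ τ' =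
      if τ = τ' then ((d : ℝ) + 1) * blockWeight S τ else 0 := by
    intro τ τ'
    by_cases h : τ = τ'
    · subst h
      rw [if_pos rfl]
      simp only [incidence_mul_self]
      rw [Finset.sum_boole, Facet.card_facets, blockWeight]
      split_ifs <;> simp
    · rw [if_neg h]
      by_cases h1 : τ.1 ∈ S.1
      · by_cases h2 : τ'.1 ∈ S.1
        · rw [Finset.sum_eq_zero, mul_zero]
          intro ρ _
          by_cases h3 : ρ.1 ⊆ τ.1
          · by_cases h4 : ρ.1 ⊆ τ'.1
            · obtain ⟨t, ht⟩ := exists_block S ρ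
              exact absurd (((ht τ).1 ⟨h1, h3⟩).trans ((ht τ').1 ⟨h2, h4⟩).symm) h
            · rw [incidence_of_not_subset h4, mul_zero]
          · rw [incidence_of_not_subset h3, zero_mul]
        · rw [blockWeight, blockWeight, if_neg h2, mul_zero, zero_mul]
      · rw [blockWeight, if_neg h1, zero_mul, zero_mul]
  ext σ σ'
  rw [Matrix.mul_apply, Matrix.smul_apply, smul_eq_mul]
  simp only [laplacianMatrix, Matrix.of_apply]
  calc ∑ ρ : Facet n d, (∑ τ, blockWeight S τ * (incidence σ τ * incidence ρ τ)) *
        ∑ τ', blockWeight S τ' * (incidence ρ τ' * incidence σ' τ')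
      = ∑ τ, ∑ τ', (incidence σ τ * incidence σ' τ') * (blockWeight S τ * blockWeight S τ' *
          ∑ ρ : Facet n d, incidence ρ τ * incidence ρ τ') := by
        simp only [Finset.sum_mul_sum]
        rw [Finset.sum_comm]
        refine Finset.sum_congr rfl fun τ _ => ?_
        rw [Finset.sum_comm]
        refine Finset.sum_congr rfl fun τ' _ => ?_
        rw [Finset.mul_sum, Finset.mul_sum]
        exact Finset.sum_congr rfl fun ρ _ => by ring
    _ = _ := by
        simp only [key]
        rw [Finset.mul_sum]
        refine Finset.sum_congr rfl fun τ _ => ?_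
        simp only [mul_ite, mul_zero]
        rw [Finset.sum_ite_eq, if_pos (Finset.mem_univ _)]
        ring

/-- The diagonal of the Laplacian matrix of one Steiner system is `1`, as every set with `d`
vertices lies in one block. -/
theorem adjacencyMatrix_blockWeight (S : SteinerSystem d n) :
    adjacencyMatrix (blockWeight S) = 1 - laplacianMatrix (blockWeight S) := by
  ext σ σ'
  rw [adjacencyMatrix, Matrix.of_apply, Matrix.sub_apply, Matrix.one_apply]
  split_ifs with h
  · subst h
    rw [laplacianMatrix_diag, sum_blockWeight, sub_self]
  · rw [zero_sub]

theorem adjacencyMatrix_blockWeight_mul_self (S : SteinerSystem d n) :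
    adjacencyMatrix (blockWeight S) * adjacencyMatrix (blockWeight S) =
      (d : ℝ) • (1 : Matrix (Facet n d) (Facet n d) ℝ) +
        (1 - (d : ℝ)) • adjacencyMatrix (blockWeight S) := by
  have h := laplacianMatrix_blockWeight_mul_self S
  rw [adjacencyMatrix_blockWeight, sub_mul, mul_sub, mul_sub, h, mul_one, one_mul, mul_one]
  module

/-- Two sets with `d` vertices are adjacent in `S` if they are different facets of a block. -/
def BlockAdj (S : SteinerSystem d n) (σ σ' : Facet n d) : Prop :=
  σ ≠ σ' ∧ σ.1 ∪ σ'.1 ∈ S.1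

theorem union_eq_of_subset {σ σ' : Facet n d} {τ : Facet n (d + 1)} (hne : σ ≠ σ')
    (h1 : σ.1 ⊆ τ.1) (h2 : σ'.1 ⊆ τ.1) : σ.1 ∪ σ'.1 = τ.1 := by
  have hc : d < (σ.1 ∪ σ'.1).card := by
    have := Finset.card_lt_card (Finset.ssubset_iff_subset_ne.2
      ⟨(Finset.subset_union_left : σ.1 ⊆ σ.1 ∪ σ'.1), fun h => hne (Subtype.ext
        (Finset.eq_of_subset_of_card_le (h ▸ Finset.subset_union_right) (by rw [σ.2, σ'.2])).symm)⟩)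
    rwa [σ.2] at this
  exact Finset.eq_of_subset_of_card_le (Finset.union_subset h1 h2) (by rw [τ.2]; exact hc)

theorem BlockAdj.exists_block {S : SteinerSystem d n} {σ σ' : Facet n d} (h : BlockAdj S σ σ') :
    ∃ τ : Facet n (d + 1), τ.1 ∈ S.1 ∧ σ.1 ⊆ τ.1 ∧ σ'.1 ⊆ τ.1 :=
  ⟨⟨_, S.2.1 _ h.2⟩, h.2, Finset.subset_union_left, Finset.subset_union_right⟩

theorem blockAdj_of_subset {S : SteinerSystem d n} {σ σ' : Facet n d} (hne : σ ≠ σ')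
    {τ : Facet n (d + 1)} (hτ : τ.1 ∈ S.1) (h1 : σ.1 ⊆ τ.1) (h2 : σ'.1 ⊆ τ.1) :
    BlockAdj S σ σ' :=
  ⟨hne, by rwa [union_eq_of_subset hne h1 h2]⟩

open Classical in
theorem abs_adjacencyMatrix_blockWeight_le (S : SteinerSystem d n) (σ σ' : Facet n d) :
    |adjacencyMatrix (blockWeight S) σ σ'| ≤ if BlockAdj S σ σ' then 1 else 0 := by
  by_cases hne : σ = σ'
  · rw [adjacencyMatrix, Matrix.of_apply, if_pos hne, abs_zero]
    split_ifs <;> simp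
  refine (abs_adjacencyMatrix_le _ _ _).trans ?_
  rw [laplacianMatrix, Matrix.of_apply]
  obtain ⟨τ, hτ⟩ := exists_block S σ
  rw [Finset.sum_eq_single τ]
  · rw [abs_mul, abs_mul, abs_incidence, abs_incidence]
    have h := (hτ τ).2 rfl
    by_cases h2 : σ'.1 ⊆ τ.1
    · rw [if_pos (blockAdj_of_subset hne h.1 h.2 h2), blockWeight, if_pos h.1, if_pos h.2,
        if_pos h2]
      simp
    · rw [if_neg h2, mul_zero, mul_zero]
      split_ifs <;> simp
  · intro τ' _ hne'
    by_cases h1 : τ'.1 ∈ S.1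
    · rw [incidence_of_not_subset fun h2 => hne' ((hτ τ').1 ⟨h1, h2⟩), zero_mul, mul_zero]
    · rw [blockWeight, if_neg h1, zero_mul]
  · simp

open Classical in
theorem card_blockAdj_le (S : SteinerSystem d n) (σ : Facet n d) :
    (Finset.univ.filter fun σ' => BlockAdj S σ σ').card ≤ d + 1 := by
  obtain ⟨τ, hτ⟩ := exists_block S σ
  rw [← Facet.card_facets τ]
  apply Finset.card_le_card
  intro σ' h
  rw [Finset.mem_filter] at h ⊢
  obtain ⟨τ', h1, h2, h3⟩ := h.2.exists_block
  rw [← (hτ τ').1 ⟨h1, h2⟩]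
  exact ⟨Finset.mem_univ _, h3⟩

end OneSystem

/-! ### Reduced words -/

section Words

variable {R : Type*} [Ring R] [Algebra ℝ R] {k : ℕ}

/-- The sum of the words `A i₀ * ⋯ * A iₘ` with `iₗ ≠ iₗ₊₁` for all `l` and last letter `iₘ = j`;
these words have `m + 1` letters. -/
def reducedWords (A : Fin k → R) : ℕ → Fin k → R
  | 0, j => A j
  | m + 1, j => (∑ i with i ≠ j, reducedWords A m i) * A j

open Polynomial in
/-- The polynomials that turn `∑ A j` into sums of reduced words, if `A j ^ 2 = d + (1 - d) A j`.
The step from `1` to `2` is exceptional: a nonempty word can be extended in `k - 1` ways, but the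
empty word in `k` ways. -/
noncomputable def wordPoly (d k : ℝ) : ℕ → ℝ[X]
  | 0 => 1
  | 1 => X
  | 2 => (X + C (d - 1)) * X - C (d * k)
  | m + 3 => (X + C (d - 1)) * wordPoly d k (m + 2) - C (d * (k - 1)) * wordPoly d k (m + 1)

/-- When `∑ A j` multiplies the reduced words with `m + 1` letters, a repeated last letter is
replaced through `A j ^ 2 = d + (1 - d) A j`; this gives the recurrence of `wordPoly`. -/
theorem aeval_wordPoly {d : ℝ} {A : Fin k → R}
    (hA : ∀ j, A j * A j = d • (1 : R) + (1 - d) • A j) (m : ℕ) :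
    Polynomial.aeval (∑ j, A j) (wordPoly d k (m + 1)) = ∑ j, reducedWords A m j := by
  have hne : ∀ m j, ∑ i with i ≠ j, reducedWords A m i =
      ∑ i, reducedWords A m i - reducedWords A m j := fun m j => by
    rw [eq_sub_iff_add_eq, Finset.filter_ne', Finset.sum_erase_add _ _ (Finset.mem_univ j)]
  have hcomm : ∀ p : Polynomial ℝ, (∑ j, A j) * Polynomial.aeval (∑ j, A j) p =
      Polynomial.aeval (∑ j, A j) p * ∑ j, A j := fun p => by
    have h := congrArg (Polynomial.aeval (∑ j, A j)) (Polynomial.X_mul (p := p))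
    simpa only [map_mul, Polynomial.aeval_X] using h
  induction m using Nat.strong_induction_on with
  | _ m ih =>
    match m, ih with
    | 0, _ => simp [wordPoly, reducedWords]
    | 1, _ =>
      have h1 : ∑ j, reducedWords A 1 j = (∑ j, A j) * (∑ j, A j) - ∑ j, A j * A j := by
        rw [Finset.mul_sum, ← Finset.sum_sub_distrib]
        refine Finset.sum_congr rfl fun j _ => ?_
        rw [reducedWords, hne]
        simp only [reducedWords]
        rw [sub_mul]
      rw [h1]
      simp only [hA, wordPoly, Finset.sum_add_distrib, ← Finset.smul_sum, Finset.sum_const,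
        Finset.card_univ, Fintype.card_fin, map_sub, map_add, map_mul, Polynomial.aeval_X,
        Polynomial.aeval_C, map_one, add_mul, Algebra.algebraMap_eq_smul_one]
      rw [← Nat.cast_smul_eq_nsmul ℝ]
      simp only [sub_mul, smul_mul_assoc, one_mul]
      module
    | m + 2, ih =>
      have h1 : ∀ j, reducedWords A (m + 2) j = (∑ i, reducedWords A (m + 1) i) * A j -
          (d • (∑ i, reducedWords A m i - reducedWords A m j) +
            (1 - d) • reducedWords A (m + 1) j) := by
        intro j
        have h2 : reducedWords A (m + 1) j * A j =
            d • (∑ i, reducedWords A m i - reducedWords A m j) +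
            (1 - d) • reducedWords A (m + 1) j := by
          rw [reducedWords, mul_assoc, hA, hne, mul_add, mul_smul_comm, mul_one, mul_smul_comm]
        rw [← h2, reducedWords, hne, sub_mul]
      rw [show m + 2 + 1 = m + 3 from rfl, wordPoly]
      simp only [h1, Finset.sum_sub_distrib, Finset.sum_add_distrib, ← Finset.smul_sum,
        ← Finset.mul_sum, Finset.sum_const, Finset.card_univ, Fintype.card_fin, map_sub, map_mul,
        map_add, Polynomial.aeval_X, Polynomial.aeval_C, add_mul, ← Algebra.smul_def, hcomm]
      rw [ih m (by omega), ih (m + 1) (by omega), ← Nat.cast_smul_eq_nsmul ℝ]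
      simp only [Algebra.algebraMap_eq_smul_one, map_one, sub_mul, smul_mul_assoc, one_mul]
      module

end Words

/-- The polynomials `wordPoly d k m` span all polynomials, since their span is closed under
multiplication by `X`. -/
theorem mem_span_wordPoly (d k : ℝ) (p : Polynomial ℝ) :
    p ∈ Submodule.span ℝ (Set.range (wordPoly d k)) := by
  have hmem : ∀ m, wordPoly d k m ∈ Submodule.span ℝ (Set.range (wordPoly d k)) := fun m =>
    Submodule.subset_span ⟨m, rfl⟩
  have hC : ∀ (c : ℝ) (q : Polynomial ℝ), q ∈ Submodule.span ℝ (Set.range (wordPoly d k)) →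
      Polynomial.C c * q ∈ Submodule.span ℝ (Set.range (wordPoly d k)) := fun c q hq => by
    rw [← Polynomial.smul_eq_C_mul]; exact Submodule.smul_mem _ _ hq
  have hX : ∀ q ∈ Submodule.span ℝ (Set.range (wordPoly d k)),
      Polynomial.X * q ∈ Submodule.span ℝ (Set.range (wordPoly d k)) := by
    intro q hq
    induction hq using Submodule.span_induction with
    | mem q h =>
      obtain ⟨m, rfl⟩ := h
      match m with
      | 0 => simpa [wordPoly] using hmem 1
      | 1 =>
        have : Polynomial.X * wordPoly d k 1 = wordPoly d k 2 -
            Polynomial.C (d - 1) * wordPoly d k 1 + Polynomial.C (d * k) * wordPoly d k 0 := by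
          simp only [wordPoly]; ring
        rw [this]
        exact add_mem (sub_mem (hmem _) (hC _ _ (hmem _))) (hC _ _ (hmem _))
      | m + 2 =>
        have : Polynomial.X * wordPoly d k (m + 2) = wordPoly d k (m + 3) -
            Polynomial.C (d - 1) * wordPoly d k (m + 2) +
            Polynomial.C (d * (k - 1)) * wordPoly d k (m + 1) := by
          rw [wordPoly]; ring
        rw [this]
        exact add_mem (sub_mem (hmem _) (hC _ _ (hmem _))) (hC _ _ (hmem _))
    | zero => rw [mul_zero]; exact zero_mem _
    | add q q' _ _ h h' => rw [mul_add]; exact add_mem h h'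
    | smul c q _ h => rw [mul_smul_comm]; exact Submodule.smul_mem _ _ h
  have hpow : ∀ l : ℕ, (Polynomial.X ^ l : Polynomial ℝ) ∈
      Submodule.span ℝ (Set.range (wordPoly d k)) := by
    intro l
    induction l with
    | zero => simpa [wordPoly] using hmem 0
    | succ l ih => rw [pow_succ']; exact hX _ ih
  induction p using Polynomial.induction_on' with
  | add p q hp hq => exact add_mem hp hq
  | monomial l a => rw [← Polynomial.C_mul_X_pow_eq_monomial]; exact hC _ _ (hpow l)

/-! ### Reduced walks -/

section Walks

variable {d k n : ℕ}

/-- The last set of a walk from `σ₀`. Walks are lists of steps, the latest step first; a step is a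
colour in `Fin k` together with the set that it reaches. -/
def lastFacet (σ₀ : Facet n d) : List (Fin k × Facet n d) → Facet n d
  | [] => σ₀
  | a :: _ => a.2

/-- A walk in the union of the Steiner systems `S j` that starts at `σ₀`: a step of colour `j` goes
to another facet of the block of `S j`, and consecutive steps have different colours. -/
def IsReducedWalk (S : Fin k → SteinerSystem d n) (σ₀ : Facet n d) :
    List (Fin k × Facet n d) → Prop
  | [] => True
  | a :: l => IsReducedWalk S σ₀ l ∧ (∀ b ∈ l.head?, b.1 ≠ a.1) ∧
      BlockAdj (S a.1) (lastFacet σ₀ l) a.2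

/-- The vertices that a walk has visited. -/
def visited (σ₀ : Facet n d) : List (Fin k × Facet n d) → Finset (Fin n)
  | [] => σ₀.1
  | a :: l => a.2.1 ∪ visited σ₀ l

/-- Every step of the walk reaches a vertex that was not visited before. -/
def IsFresh (σ₀ : Facet n d) : List (Fin k × Facet n d) → Prop
  | [] => True
  | a :: l => IsFresh σ₀ l ∧ ¬ a.2.1 ⊆ visited σ₀ l

/-- All lists of `m` steps. -/
def stepLists (d k n : ℕ) : ℕ → Finset (List (Fin k × Facet n d))
  | 0 => {[]}
  | m + 1 => (Finset.univ ×ˢ stepLists d k n m).map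
      ⟨fun p : (Fin k × Facet n d) × List (Fin k × Facet n d) => p.1 :: p.2, fun p q h => by
        rw [List.cons.injEq] at h
        exact Prod.ext h.1 h.2⟩

theorem sum_stepLists_succ (m : ℕ) (g : List (Fin k × Facet n d) → ℝ) :
    ∑ l ∈ stepLists d k n (m + 1), g l = ∑ a, ∑ l ∈ stepLists d k n m, g (a :: l) := by
  rw [stepLists, Finset.sum_map, Finset.sum_product]
  rfl

theorem length_of_mem_stepLists {m : ℕ} {l : List (Fin k × Facet n d)}
    (h : l ∈ stepLists d k n m) : l.length = m := by
  induction m generalizing l with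
  | zero => rw [Finset.mem_singleton.1 h]; rfl
  | succ m ih =>
    obtain ⟨p, hp, rfl⟩ := Finset.mem_map.1 h
    change p.2.length + 1 = _
    rw [ih (Finset.mem_product.1 hp).2]

theorem card_visited_le (σ₀ : Facet n d) (l : List (Fin k × Facet n d)) :
    (visited σ₀ l).card ≤ (l.length + 1) * d := by
  induction l with
  | nil => rw [visited, σ₀.2]; simp
  | cons a l ih =>
    refine (Finset.card_union_le _ _).trans ?_
    rw [a.2.2, List.length_cons, add_mul (l.length + 1)]
    omega

theorem lastFacet_subset_visited (σ₀ : Facet n d) (l : List (Fin k × Facet n d)) :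
    (lastFacet σ₀ l).1 ⊆ visited σ₀ l := by
  cases l with
  | nil => exact subset_rfl
  | cons a l => exact Finset.subset_union_left

theorem start_subset_visited (σ₀ : Facet n d) (l : List (Fin k × Facet n d)) :
    σ₀.1 ⊆ visited σ₀ l := by
  induction l with
  | nil => exact subset_rfl
  | cons a l ih => exact ih.trans Finset.subset_union_right

/-- Whether a list is a walk depends only on the blocks within the visited vertices. -/
theorem IsReducedWalk.congr {S S' : Fin k → SteinerSystem d n} {σ₀ : Facet n d}
    {l : List (Fin k × Facet n d)}
    (h : ∀ j, ∀ τ ⊆ visited σ₀ l, τ ∈ (S j).1 → τ ∈ (S' j).1) (hl : IsReducedWalk S σ₀ l) :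
    IsReducedWalk S' σ₀ l := by
  induction l with
  | nil => trivial
  | cons a l ih =>
    refine ⟨ih (fun j τ hτ => h j τ (hτ.trans Finset.subset_union_right)) hl.1, hl.2.1,
      hl.2.2.1, h _ _ ?_ hl.2.2.2⟩
    exact Finset.union_subset ((lastFacet_subset_visited _ _).trans Finset.subset_union_right)
      Finset.subset_union_left

open Classical in
theorem sum_isReducedWalk_cons_le (S : Fin k → SteinerSystem d n) (σ₀ : Facet n d)
    (l : List (Fin k × Facet n d)) :
    (∑ a, if IsReducedWalk S σ₀ (a :: l) then (1 : ℝ) else 0) ≤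
      k * (d + 1) * if IsReducedWalk S σ₀ l then 1 else 0 := by
  by_cases hl : IsReducedWalk S σ₀ l
  · rw [if_pos hl, mul_one, Fintype.sum_prod_type]
    calc _ ≤ ∑ j : Fin k, ((d : ℝ) + 1) := by
          refine Finset.sum_le_sum fun j _ => ?_
          rw [Finset.sum_boole]
          have h1 := card_blockAdj_le (S j) (lastFacet σ₀ l)
          have h2 : (Finset.univ.filter fun σ => IsReducedWalk S σ₀ ((j, σ) :: l)) ⊆
              Finset.univ.filter fun σ' => BlockAdj (S j) (lastFacet σ₀ l) σ' := by
            intro σ h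
            rw [Finset.mem_filter] at h ⊢
            exact ⟨h.1, h.2.2.2⟩
          exact_mod_cast (Finset.card_le_card h2).trans h1
      _ = _ := by rw [Finset.sum_const, Finset.card_univ, Fintype.card_fin, nsmul_eq_mul]
  · rw [Finset.sum_eq_zero fun a _ => if_neg fun h => hl h.1, if_neg hl, mul_zero]

open Classical in
/-- The number of closed reduced walks with `m` steps. -/
noncomputable def closedWalks (S : Fin k → SteinerSystem d n) (m : ℕ) : ℝ :=
  ∑ σ₀ : Facet n d, ∑ l ∈ stepLists d k n m,
    if IsReducedWalk S σ₀ l ∧ lastFacet σ₀ l = σ₀ then 1 else 0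

theorem closedWalks_nonneg (S : Fin k → SteinerSystem d n) (m : ℕ) : 0 ≤ closedWalks S m :=
  Finset.sum_nonneg fun _ _ => Finset.sum_nonneg fun _ _ => by split_ifs <;> norm_num

open Classical in
theorem abs_reducedWords_le (S : Fin k → SteinerSystem d n) (m : ℕ) (j : Fin k)
    (σ₀ σ : Facet n d) :
    |reducedWords (fun j => adjacencyMatrix (blockWeight (S j))) m j σ₀ σ| ≤
      ∑ l ∈ stepLists d k n m, if IsReducedWalk S σ₀ ((j, σ) :: l) then 1 else 0 := by
  induction m generalizing j σ with
  | zero =>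
    rw [stepLists, Finset.sum_singleton, reducedWords]
    refine (abs_adjacencyMatrix_blockWeight_le _ _ _).trans_eq ?_
    simp [IsReducedWalk, lastFacet]
  | succ m ih =>
    rw [reducedWords, Matrix.mul_apply, sum_stepLists_succ, Fintype.sum_prod_type, Finset.sum_comm]
    refine (Finset.abs_sum_le_sum_abs _ _).trans (Finset.sum_le_sum fun ρ _ => ?_)
    rw [Matrix.sum_apply, Finset.sum_filter, Finset.sum_mul]
    refine (Finset.abs_sum_le_sum_abs _ _).trans (Finset.sum_le_sum fun i _ => ?_)
    by_cases hij : i ≠ j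
    · rw [if_pos hij, abs_mul]
      refine (mul_le_mul (ih i ρ) (abs_adjacencyMatrix_blockWeight_le _ _ _) (abs_nonneg _)
        (Finset.sum_nonneg fun _ _ => by split_ifs <;> norm_num)).trans_eq ?_
      rw [Finset.sum_mul]
      refine Finset.sum_congr rfl fun l _ => ?_
      rw [ite_zero_mul_ite_zero, mul_one]
      refine if_congr ?_ rfl rfl
      change _ ↔ IsReducedWalk S σ₀ ((i, ρ) :: l) ∧ (∀ b ∈ some (i, ρ), b.1 ≠ j) ∧ _
      simp only [Option.mem_def, Option.some.injEq, forall_eq', hij, ne_eq, not_false_eq_true,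
        true_and]
      rfl
    · rw [if_neg hij, zero_mul, abs_zero]
      exact Finset.sum_nonneg fun _ _ => by split_ifs <;> norm_num

theorem abs_trace_reducedWords_le (S : Fin k → SteinerSystem d n) (m : ℕ) :
    |(∑ j, reducedWords (fun j => adjacencyMatrix (blockWeight (S j))) m j).trace| ≤
      closedWalks S (m + 1) := by
  classical
  rw [Matrix.trace, closedWalks]
  refine (Finset.abs_sum_le_sum_abs _ _).trans (Finset.sum_le_sum fun σ _ => ?_)
  rw [Matrix.diag_apply, Matrix.sum_apply, sum_stepLists_succ, Fintype.sum_prod_type]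
  refine (Finset.abs_sum_le_sum_abs _ _).trans (Finset.sum_le_sum fun j _ => ?_)
  refine (abs_reducedWords_le S m j σ σ).trans ?_
  refine le_trans (le_of_eq ?_) (Finset.single_le_sum (f := fun σ' =>
    ∑ l ∈ stepLists d k n m, if IsReducedWalk S σ ((j, σ') :: l) ∧
      lastFacet σ ((j, σ') :: l) = σ then (1 : ℝ) else 0)
    (fun σ' _ => Finset.sum_nonneg fun _ _ => by split_ifs <;> norm_num) (Finset.mem_univ σ))
  refine Finset.sum_congr rfl fun l _ => if_congr ?_ rfl rfl
  simp [lastFacet]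

/-! ### Random Steiner systems: few walks close up -/

instance instFiniteSteinerSystem (d n : ℕ) : Finite (SteinerSystem d n) :=
  inferInstanceAs (Finite {_S : Finset (Finset (Fin n)) // _})

noncomputable instance instFintypeSteinerSystem (d n : ℕ) : Fintype (SteinerSystem d n) :=
  Fintype.ofFinite _

theorem SteinerSystem.eq_of_subset {S : SteinerSystem d n} {σ τ τ' : Finset (Fin n)}
    (hσ : σ.card = d) (h1 : τ ∈ S.1) (h1' : τ' ∈ S.1) (h2 : σ ⊆ τ) (h2' : σ ⊆ τ') : τ = τ' :=
  (S.2.2 σ hσ).unique ⟨h1, h2⟩ ⟨h1', h2'⟩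

/-- The Steiner system whose blocks are the sets that `θ` maps to blocks of `S`. -/
def SteinerSystem.relabel (θ : Equiv.Perm (Fin n)) (S : SteinerSystem d n) : SteinerSystem d n :=
  ⟨Finset.univ.filter fun τ => τ.map θ.toEmbedding ∈ S.1, by
    constructor
    · intro τ hτ
      rw [← Finset.card_map θ.toEmbedding]
      exact S.2.1 _ (Finset.mem_filter.1 hτ).2
    · intro σ hσ
      obtain ⟨τ, ⟨h1, h2⟩, h3⟩ := S.2.2 (σ.map θ.toEmbedding) (by rw [Finset.card_map, hσ])
      have e : (τ.map θ.symm.toEmbedding).map θ.toEmbedding = τ := by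
        rw [Finset.map_map]
        simp
      refine ⟨τ.map θ.symm.toEmbedding, ⟨?_, ?_⟩, ?_⟩
      · rw [Finset.mem_filter, e]; exact ⟨Finset.mem_univ _, h1⟩
      · rw [← Finset.map_subset_map (f := θ.toEmbedding), e]; exact h2
      · rintro τ' ⟨h4, h5⟩
        apply Finset.map_injective θ.toEmbedding
        rw [e]
        exact h3 _ ⟨(Finset.mem_filter.1 h4).2, Finset.map_subset_map.2 h5⟩⟩

theorem SteinerSystem.mem_relabel {θ : Equiv.Perm (Fin n)} {S : SteinerSystem d n}
    {τ : Finset (Fin n)} : τ ∈ (S.relabel θ).1 ↔ τ.map θ.toEmbedding ∈ S.1 := by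
  simp [SteinerSystem.relabel]

theorem SteinerSystem.relabel_swap_relabel_swap (x y : Fin n) (S : SteinerSystem d n) :
    (S.relabel (Equiv.swap x y)).relabel (Equiv.swap x y) = S := by
  apply Subtype.ext
  ext τ
  have h : (τ.map (Equiv.swap x y).toEmbedding).map (Equiv.swap x y).toEmbedding = τ := by
    rw [Finset.map_map]
    have : (Equiv.swap x y).toEmbedding.trans (Equiv.swap x y).toEmbedding =
        Function.Embedding.refl _ := by
      ext z
      simp
    rw [this, Finset.map_refl]
  rw [mem_relabel, mem_relabel, h]

theorem map_swap_of_notMem {x y : Fin n} {τ : Finset (Fin n)} (hx : x ∉ τ) (hy : y ∉ τ) :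
    τ.map (Equiv.swap x y).toEmbedding = τ := by
  have : ∀ z ∈ τ, Equiv.swap x y z = z := fun z hz =>
    Equiv.swap_apply_of_ne_of_ne (fun h => hx (h ▸ hz)) (fun h => hy (h ▸ hz))
  ext z
  rw [Finset.mem_map]
  constructor
  · rintro ⟨w, hw, rfl⟩
    change Equiv.swap x y w ∈ τ
    rwa [this w hw]
  · exact fun hz => ⟨z, hz, this z hz⟩

open Classical in
/-- Given a fresh walk `l`, its next step stays inside the visited vertices for only few of the
families `S`. Say that this step has colour `j`, and let `v` be the vertex that the last step of `l`
has added. Exchanging `v` with an unvisited vertex `y` in `S j` does not affect `l`, since its last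
step has another colour. The block of the next step turns into a block that determines `y`. -/
theorem card_isReducedWalk_cons_le (σ₀ : Facet n d) (l : List (Fin k × Facet n d))
    (a : Fin k × Facet n d) (hl : IsFresh σ₀ l) (ha : a.2.1 ⊆ visited σ₀ l) :
    (visited σ₀ l)ᶜ.card *
        (Finset.univ.filter fun S : Fin k → SteinerSystem d n =>
          IsReducedWalk S σ₀ (a :: l)).card ≤
      (Finset.univ.filter fun S : Fin k → SteinerSystem d n => IsReducedWalk S σ₀ l).card := by
  by_cases hG : (Finset.univ.filter fun S : Fin k → SteinerSystem d n =>
          IsReducedWalk S σ₀ (a :: l)).Nonempty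
  swap
  · rw [Finset.not_nonempty_iff_eq_empty.1 hG]; simp
  obtain ⟨S₀, hS₀⟩ := hG
  obtain ⟨hw, hcol, hadj⟩ := (Finset.mem_filter.1 hS₀).2
  match l, hl, ha, hw, hcol, hadj with
  | [], _, ha, _, _, hadj =>
    -- The first step leaves `σ₀`, so it cannot stay within the visited vertices.
    exact absurd (Subtype.ext (Finset.eq_of_subset_of_card_le ha (by
      rw [a.2.2]; exact σ₀.2.le))) hadj.1.symm
  | b :: l, hl, ha, hw, hcol, hadj =>
    have hij : b.1 ≠ a.1 := hcol b rfl
    obtain ⟨v, hv, hvl⟩ := Finset.not_subset.1 hl.2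
    -- `κ` consists of the old vertices of the block of the next step.
    set κ : Finset (Fin n) := (b.2.1 ∪ a.2.1).erase v with hκ
    have hvτ : v ∈ b.2.1 ∪ a.2.1 := Finset.mem_union_left _ hv
    have hτc : (b.2.1 ∪ a.2.1).card = d + 1 := (S₀ a.1).2.1 _ hadj.2
    have hκc : κ.card = d := by rw [hκ, Finset.card_erase_of_mem hvτ, hτc]; rfl
    have hbv : b.2.1 ⊆ insert v (visited σ₀ l) := by
      have h1 : ((lastFacet σ₀ l).1 ∪ b.2.1).card = d + 1 := (S₀ b.1).2.1 _ hw.2.2.2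
      have h2 : insert v (lastFacet σ₀ l).1 = (lastFacet σ₀ l).1 ∪ b.2.1 := by
        apply Finset.eq_of_subset_of_card_le
        · exact Finset.insert_subset (Finset.mem_union_right _ hv) Finset.subset_union_left
        · rw [h1, Finset.card_insert_of_notMem fun h => hvl (lastFacet_subset_visited _ _ h),
            (lastFacet σ₀ l).2]
      exact (Finset.subset_union_right.trans h2.symm.subset).trans
        (Finset.insert_subset_insert _ (lastFacet_subset_visited _ _))
    have hτV : b.2.1 ∪ a.2.1 ⊆ visited σ₀ (b :: l) :=
      Finset.union_subset Finset.subset_union_left ha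
    have hVv : visited σ₀ (b :: l) ⊆ insert v (visited σ₀ l) :=
      Finset.union_subset hbv (Finset.subset_insert _ _)
    have hvκ : v ∉ κ := Finset.notMem_erase _ _
    have hyκ : ∀ y ∉ visited σ₀ (b :: l), y ∉ κ := fun y hy h =>
      hy (hτV (Finset.mem_of_mem_erase h))
    -- `T (y, S)` exchanges `v` and `y` in the system of the next step.
    let T : Fin n × (Fin k → SteinerSystem d n) → (Fin k → SteinerSystem d n) := fun p =>
      Function.update p.2 a.1 ((p.2 a.1).relabel (Equiv.swap v p.1))
    have hT : ∀ (y : Fin n) (S : Fin k → SteinerSystem d n), y ∉ visited σ₀ (b :: l) →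
        IsReducedWalk S σ₀ (a :: b :: l) → insert y κ ∈ (T (y, S) a.1).1 := by
      intro y S hy hS
      have h1 : (insert y κ).map (Equiv.swap v y).toEmbedding = b.2.1 ∪ a.2.1 := by
        rw [Finset.map_insert, map_swap_of_notMem hvκ (hyκ y hy)]
        change insert (Equiv.swap v y y) κ = _
        rw [Equiv.swap_apply_right, hκ, Finset.insert_erase hvτ]
      change _ ∈ (Function.update S a.1 _ a.1).1
      rw [Function.update_self, SteinerSystem.mem_relabel, h1]
      exact hS.2.2.2
    rw [← Finset.card_product]
    refine Finset.card_le_card_of_injOn T ?_ ?_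
    · rintro ⟨y, S⟩ hp
      obtain ⟨hy, hS⟩ := Finset.mem_product.1 (Finset.mem_coe.1 hp)
      replace hy : y ∉ visited σ₀ (b :: l) := Finset.mem_compl.1 hy
      replace hS : IsReducedWalk S σ₀ (a :: b :: l) := (Finset.mem_filter.1 hS).2
      refine Finset.mem_coe.2 (Finset.mem_filter.2 ⟨Finset.mem_univ _, ?_⟩)
      refine ⟨hS.1.1.congr ?_, hS.1.2.1, hS.1.2.2.1, ?_⟩
      · intro j τ hτ hj
        change τ ∈ (Function.update S a.1 _ j).1
        by_cases hja : j = a.1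
        · subst hja
          rw [Function.update_self, SteinerSystem.mem_relabel, map_swap_of_notMem]
          · exact hj
          · exact fun h => hvl (hτ h)
          · exact fun h => hy (Finset.mem_union_right _ (hτ h))
        · rwa [Function.update_of_ne hja]
      · change _ ∈ (Function.update S a.1 _ b.1).1
        rw [Function.update_of_ne hij]
        exact hS.1.2.2.2
    · rintro ⟨y, S⟩ hp ⟨y', S'⟩ hp' heq
      obtain ⟨hy, hS⟩ := Finset.mem_product.1 (Finset.mem_coe.1 hp)
      obtain ⟨hy', hS'⟩ := Finset.mem_product.1 (Finset.mem_coe.1 hp')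
      replace hy : y ∉ visited σ₀ (b :: l) := Finset.mem_compl.1 hy
      replace hS : IsReducedWalk S σ₀ (a :: b :: l) := (Finset.mem_filter.1 hS).2
      replace hy' : y' ∉ visited σ₀ (b :: l) := Finset.mem_compl.1 hy'
      replace hS' : IsReducedWalk S' σ₀ (a :: b :: l) := (Finset.mem_filter.1 hS').2
      have h1 := hT y S hy hS
      have h2 := hT y' S' hy' hS'
      rw [← heq] at h2
      have h3 := SteinerSystem.eq_of_subset hκc h1 h2 (Finset.subset_insert _ _)
        (Finset.subset_insert _ _)
      have h4 : y = y' := by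
        have : y ∈ insert y' κ := h3 ▸ Finset.mem_insert_self y κ
        exact (Finset.mem_insert.1 this).resolve_right (hyκ y hy)
      subst h4
      refine Prod.ext rfl (funext fun j => ?_)
      have h5 := congrFun heq j
      change Function.update S a.1 _ j = Function.update S' a.1 _ j at h5
      by_cases hja : j = a.1
      · subst hja
        rw [Function.update_self, Function.update_self] at h5
        have := congrArg (SteinerSystem.relabel (Equiv.swap v y)) h5
        rwa [SteinerSystem.relabel_swap_relabel_swap,
          SteinerSystem.relabel_swap_relabel_swap] at this
      · rwa [Function.update_of_ne hja, Function.update_of_ne hja] at h5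

open Classical in
theorem sum_isReducedWalk_le (m : ℕ) (σ₀ : Facet n d) :
    ∑ l ∈ stepLists d k n m, ∑ S : Fin k → SteinerSystem d n,
        (if IsReducedWalk S σ₀ l then (1 : ℝ) else 0) ≤
      (k * (d + 1)) ^ m * Fintype.card (Fin k → SteinerSystem d n) := by
  induction m with
  | zero =>
    have h : ∀ S : Fin k → SteinerSystem d n, IsReducedWalk S σ₀ [] := fun _ => trivial
    simp only [stepLists, Finset.sum_singleton, h, if_true, Finset.sum_const, Finset.card_univ,
      nsmul_eq_mul, pow_zero, one_mul, mul_one]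
    rfl
  | succ m ih =>
    rw [sum_stepLists_succ, Finset.sum_comm, pow_succ', mul_assoc]
    refine le_trans ?_ (mul_le_mul_of_nonneg_left ih (by positivity))
    rw [Finset.mul_sum]
    refine Finset.sum_le_sum fun l _ => ?_
    rw [Finset.sum_comm, Finset.mul_sum]
    exact Finset.sum_le_sum fun S _ => sum_isReducedWalk_cons_le S σ₀ l

open Classical in
/-- A proportion `O(1 / n)` of the reduced walks with `m` steps is not fresh. -/
theorem exists_sum_not_isFresh_le (d k m : ℕ) : ∃ C : ℝ, 0 ≤ C ∧ ∀ (n : ℕ) (σ₀ : Facet n d),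
    ((n : ℝ) - m * d) * ∑ l ∈ stepLists d k n m, ∑ S : Fin k → SteinerSystem d n,
        (if IsReducedWalk S σ₀ l ∧ ¬ IsFresh σ₀ l then (1 : ℝ) else 0) ≤
      C * Fintype.card (Fin k → SteinerSystem d n) := by
  induction m with
  | zero => exact ⟨0, le_rfl, fun n σ₀ => by simp [stepLists, IsFresh]⟩
  | succ m ih =>
    obtain ⟨C, hC, ih⟩ := ih
    refine ⟨k * (d + 1) * C + k * 2 ^ ((m + 1) * d) * (k * (d + 1)) ^ m, by positivity,
      fun n σ₀ => ?_⟩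
    by_cases hneg : (n : ℝ) - (m + 1 : ℕ) * d < 0
    · refine (mul_nonpos_of_nonpos_of_nonneg hneg.le ?_).trans (by positivity)
      exact Finset.sum_nonneg fun _ _ => Finset.sum_nonneg fun _ _ => by split_ifs <;> norm_num
    rw [not_lt] at hneg
    -- A walk fails to be fresh either before its last step or at this step.
    have hsplit : ∀ (a : Fin k × Facet n d) (l : List (Fin k × Facet n d))
        (S : Fin k → SteinerSystem d n),
        (if IsReducedWalk S σ₀ (a :: l) ∧ ¬ IsFresh σ₀ (a :: l) then (1 : ℝ) else 0) ≤
        (if IsReducedWalk S σ₀ (a :: l) ∧ ¬ IsFresh σ₀ l then (1 : ℝ) else 0) +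
        (if IsFresh σ₀ l ∧ a.2.1 ⊆ visited σ₀ l then
          (if IsReducedWalk S σ₀ (a :: l) then (1 : ℝ) else 0) else 0) := by
      intro a l S
      by_cases h1 : IsReducedWalk S σ₀ (a :: l) <;> by_cases h2 : IsFresh σ₀ l <;>
        by_cases h3 : a.2.1 ⊆ visited σ₀ l <;> simp [h1, h2, h3, IsFresh]
    have hfirst : ((n : ℝ) - (m + 1 : ℕ) * d) * ∑ l ∈ stepLists d k n m, ∑ a,
        ∑ S : Fin k → SteinerSystem d n,
        (if IsReducedWalk S σ₀ (a :: l) ∧ ¬ IsFresh σ₀ l then (1 : ℝ) else 0) ≤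
        k * (d + 1) * C * Fintype.card (Fin k → SteinerSystem d n) := by
      have h1 : ∑ l ∈ stepLists d k n m, ∑ a, ∑ S : Fin k → SteinerSystem d n,
          (if IsReducedWalk S σ₀ (a :: l) ∧ ¬ IsFresh σ₀ l then (1 : ℝ) else 0) ≤
          k * (d + 1) * ∑ l ∈ stepLists d k n m, ∑ S : Fin k → SteinerSystem d n,
          (if IsReducedWalk S σ₀ l ∧ ¬ IsFresh σ₀ l then (1 : ℝ) else 0) := by
        rw [Finset.mul_sum]
        refine Finset.sum_le_sum fun l _ => ?_
        rw [Finset.sum_comm, Finset.mul_sum]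
        refine Finset.sum_le_sum fun S _ => ?_
        by_cases hf : IsFresh σ₀ l
        · simp [hf]
        · simpa [hf] using sum_isReducedWalk_cons_le S σ₀ l
      have h0 : (0 : ℝ) ≤ ∑ l ∈ stepLists d k n m, ∑ S : Fin k → SteinerSystem d n,
          (if IsReducedWalk S σ₀ l ∧ ¬ IsFresh σ₀ l then (1 : ℝ) else 0) :=
        Finset.sum_nonneg fun _ _ => Finset.sum_nonneg fun _ _ => by split_ifs <;> norm_num
      have h2 := ih n σ₀
      have h3 : (n : ℝ) - (m + 1 : ℕ) * d ≤ n - m * d := by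
        push_cast
        nlinarith [Nat.cast_nonneg (α := ℝ) d]
      refine (mul_le_mul_of_nonneg_left h1 hneg).trans ?_
      generalize (∑ l ∈ stepLists d k n m, ∑ S : Fin k → SteinerSystem d n,
        (if IsReducedWalk S σ₀ l ∧ ¬ IsFresh σ₀ l then (1 : ℝ) else 0)) = Q at h0 h2
      calc _ ≤ ((n : ℝ) - m * d) * (k * (d + 1) * Q) := by gcongr
        _ = k * (d + 1) * (((n : ℝ) - m * d) * Q) := by ring
        _ ≤ k * (d + 1) * (C * Fintype.card (Fin k → SteinerSystem d n)) := by gcongr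
        _ = _ := by ring
    have hsecond : ((n : ℝ) - (m + 1 : ℕ) * d) * ∑ l ∈ stepLists d k n m, ∑ a,
        ∑ S : Fin k → SteinerSystem d n,
        (if IsFresh σ₀ l ∧ a.2.1 ⊆ visited σ₀ l then
          (if IsReducedWalk S σ₀ (a :: l) then (1 : ℝ) else 0) else 0) ≤
        k * 2 ^ ((m + 1) * d) * (k * (d + 1)) ^ m *
          Fintype.card (Fin k → SteinerSystem d n) := by
      rw [mul_assoc _ (_ ^ m)]
      refine le_trans ?_ (mul_le_mul_of_nonneg_left (sum_isReducedWalk_le m σ₀) (by positivity))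
      rw [Finset.mul_sum, Finset.mul_sum]
      refine Finset.sum_le_sum fun l hl => ?_
      have hcard : ((n : ℝ) - (m + 1 : ℕ) * d) ≤ (visited σ₀ l)ᶜ.card := by
        rw [Finset.card_compl, Fintype.card_fin, Nat.cast_sub (by
          simpa using Finset.card_le_univ (visited σ₀ l))]
        have := card_visited_le σ₀ l
        rw [length_of_mem_stepLists hl] at this
        have : ((visited σ₀ l).card : ℝ) ≤ (m + 1 : ℕ) * d := by exact_mod_cast this
        linarith
      have hterm : ∀ a : Fin k × Facet n d, ((n : ℝ) - (m + 1 : ℕ) * d) *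
          ∑ S : Fin k → SteinerSystem d n, (if IsFresh σ₀ l ∧ a.2.1 ⊆ visited σ₀ l then
            (if IsReducedWalk S σ₀ (a :: l) then (1 : ℝ) else 0) else 0) ≤
          (if a.2.1 ⊆ visited σ₀ l then 1 else 0) *
          ∑ S : Fin k → SteinerSystem d n, (if IsReducedWalk S σ₀ l then (1 : ℝ) else 0) := by
        intro a
        by_cases h : IsFresh σ₀ l ∧ a.2.1 ⊆ visited σ₀ l
        · simp only [if_pos h, if_pos h.2, one_mul, Finset.sum_boole]
          refine (mul_le_mul_of_nonneg_right hcard (by positivity)).trans ?_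
          exact_mod_cast card_isReducedWalk_cons_le σ₀ l a h.1 h.2
        · simp only [if_neg h, Finset.sum_const_zero, mul_zero]
          exact mul_nonneg (by split_ifs <;> norm_num)
            (Finset.sum_nonneg fun _ _ => by split_ifs <;> norm_num)
      rw [Finset.mul_sum]
      refine (Finset.sum_le_sum fun a _ => hterm a).trans ?_
      rw [← Finset.sum_mul]
      refine mul_le_mul_of_nonneg_right ?_
        (Finset.sum_nonneg fun _ _ => by split_ifs <;> norm_num)
      rw [Fintype.sum_prod_type]
      simp only [Finset.sum_boole, Finset.sum_const, Finset.card_univ, Fintype.card_fin,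
        nsmul_eq_mul]
      gcongr
      have h1 : (Finset.univ.filter fun σ : Facet n d => σ.1 ⊆ visited σ₀ l).card ≤
          (visited σ₀ l).powerset.card := by
        refine Finset.card_le_card_of_injOn Subtype.val ?_ Subtype.val_injective.injOn
        intro σ hσ
        exact Finset.mem_coe.2 (Finset.mem_powerset.2 (Finset.mem_filter.1 hσ).2)
      rw [Finset.card_powerset] at h1
      have h2 : 2 ^ (visited σ₀ l).card ≤ 2 ^ ((m + 1) * d) := by
        refine Nat.pow_le_pow_right (by norm_num) ?_
        rw [← length_of_mem_stepLists hl]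
        exact card_visited_le σ₀ l
      exact_mod_cast h1.trans h2
    rw [add_mul]
    refine le_trans ?_ (add_le_add hfirst hsecond)
    rw [← mul_add, ← Finset.sum_add_distrib, sum_stepLists_succ, Finset.sum_comm]
    refine mul_le_mul_of_nonneg_left (Finset.sum_le_sum fun l _ => ?_) hneg
    rw [← Finset.sum_add_distrib]
    refine Finset.sum_le_sum fun a _ => ?_
    rw [← Finset.sum_add_distrib]
    exact Finset.sum_le_sum fun S _ => hsplit a l S

/-- The mean number of closed reduced walks with `m + 1` steps is `O(1 / n)` times the number of
starting points. -/
theorem exists_sum_closedWalks_le (d k m : ℕ) : ∃ C : ℝ, 0 ≤ C ∧ ∀ n : ℕ,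
    ((n : ℝ) - (m + 1 : ℕ) * d) * ∑ S : Fin k → SteinerSystem d n, closedWalks S (m + 1) ≤
      C * Fintype.card (Facet n d) * Fintype.card (Fin k → SteinerSystem d n) := by
  classical
  obtain ⟨C, hC, h⟩ := exists_sum_not_isFresh_le d k (m + 1)
  refine ⟨C, hC, fun n => ?_⟩
  by_cases hneg : (n : ℝ) - (m + 1 : ℕ) * d < 0
  · exact (mul_nonpos_of_nonpos_of_nonneg hneg.le
      (Finset.sum_nonneg fun S _ => closedWalks_nonneg S _)).trans (by positivity)
  rw [not_lt] at hneg
  have h1 : ∑ S : Fin k → SteinerSystem d n, closedWalks S (m + 1) ≤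
      ∑ σ₀ : Facet n d, ∑ l ∈ stepLists d k n (m + 1), ∑ S : Fin k → SteinerSystem d n,
        (if IsReducedWalk S σ₀ l ∧ ¬ IsFresh σ₀ l then (1 : ℝ) else 0) := by
    simp only [closedWalks]
    rw [Finset.sum_comm]
    refine Finset.sum_le_sum fun σ₀ _ => ?_
    rw [Finset.sum_comm]
    refine Finset.sum_le_sum fun l hl => Finset.sum_le_sum fun S _ => ?_
    have h2 : lastFacet σ₀ l = σ₀ → ¬ IsFresh σ₀ l := by
      match l, length_of_mem_stepLists hl with
      | a :: l, _ =>
        intro e hf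
        change a.2 = σ₀ at e
        exact hf.2 (e ▸ start_subset_visited σ₀ l)
    split_ifs with h3 h4 h4
    · rfl
    · exact absurd ⟨h3.1, h2 h3.2⟩ h4
    · norm_num
    · rfl
  refine (mul_le_mul_of_nonneg_left h1 hneg).trans ?_
  rw [Finset.mul_sum]
  refine (Finset.sum_le_sum fun σ₀ _ => h n σ₀).trans_eq ?_
  rw [Finset.sum_const, Finset.card_univ, nsmul_eq_mul]
  ring

end Walks

/-! ### Integrals against the limit measure -/

section Angle

variable {d k q : ℝ}

/-- The denominator of the limit density at `x = 1 - d + 2 q cos θ`. -/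
noncomputable def angleDen (d k q θ : ℝ) : ℝ :=
  (k - 1 + d - 2 * q * Real.cos θ) * (q ^ 2 + 1 + 2 * q * Real.cos θ)

/-- The limit density in the variable `θ`, where `x = 1 - d + 2 q cos θ`, divided by `sin θ`. Where
the denominator vanishes (only possible for `sin θ = 0`) the value is `0`. -/
noncomputable def angleWeight (d k q θ : ℝ) : ℝ :=
  k * (4 * q ^ 2 * Real.sin θ) / (2 * Real.pi * angleDen d k q θ)

/-- Up to a constant, `wordPoly d k m` times `sin θ` at `x = 1 - d + 2 q cos θ`, for `m ≥ 1`. -/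
noncomputable def angleFun (d q : ℝ) (m : ℕ) (θ : ℝ) : ℝ :=
  ((q ^ 2 - d) * Real.cos θ + q * (1 - d)) * Real.sin (m * θ) +
    (q ^ 2 + d) * Real.sin θ * Real.cos (m * θ)

theorem angleFun_add_two (d q : ℝ) (m : ℕ) (θ : ℝ) :
    angleFun d q (m + 2) θ = 2 * Real.cos θ * angleFun d q (m + 1) θ - angleFun d q m θ := by
  have e1 : ((m + 1 : ℕ) : ℝ) * θ = m * θ + θ := by push_cast; ring
  have e2 : ((m + 2 : ℕ) : ℝ) * θ = m * θ + 2 * θ := by push_cast; ring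
  simp only [angleFun, e1, e2, Real.sin_add, Real.cos_add, Real.cos_two_mul, Real.sin_two_mul]
  ring

theorem sin_mul_eval_wordPoly (hq : q ^ 2 = d * (k - 1)) (m : ℕ) (θ : ℝ) :
    q ^ 2 * (Real.sin θ * (wordPoly d k (m + 1)).eval (1 - d + 2 * q * Real.cos θ)) =
      q ^ (m + 1) * angleFun d q (m + 1) θ := by
  induction m using Nat.strong_induction_on with
  | _ m ih =>
    match m, ih with
    | 0, _ =>
      simp only [wordPoly, angleFun, Polynomial.eval_X]
      norm_num
      ring
    | 1, _ =>
      simp only [wordPoly, angleFun, Polynomial.eval_X, Polynomial.eval_sub, Polynomial.eval_mul,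
        Polynomial.eval_add, Polynomial.eval_C]
      rw [show ((1 + 1 : ℕ) : ℝ) = 2 by norm_num, Real.sin_two_mul, Real.cos_two_mul]
      have : d * k = q ^ 2 + d := by rw [hq]; ring
      rw [this]
      ring
    | m + 2, ih =>
      have h1 := ih m (by omega)
      have h2 := ih (m + 1) (by omega)
      rw [show m + 2 + 1 = m + 3 from rfl, wordPoly, show m + 3 = m + 1 + 2 from rfl,
        angleFun_add_two]
      simp only [Polynomial.eval_X, Polynomial.eval_sub, Polynomial.eval_mul,
        Polynomial.eval_add, Polynomial.eval_C, ← hq]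
      rw [show m + 1 + 1 = m + 2 from rfl] at h2 ⊢
      linear_combination (2 * q * Real.cos θ) * h2 - q ^ 2 * h1

/-- The linear combination of the `angleFun d q m` that cancels the denominator of the density. -/
theorem angleFun_combination (hq : q ^ 2 = d * (k - 1)) (m : ℕ) (θ : ℝ) :
    q ^ 2 * angleFun d q m θ - (d - 1) * q * angleFun d q (m + 1) θ -
      d * angleFun d q (m + 2) θ = d * angleDen d k q θ * Real.sin ((m + 1 : ℕ) * θ) := by
  have e1 : ((m + 1 : ℕ) : ℝ) * θ = m * θ + θ := by push_cast; ring
  have e2 : ((m + 2 : ℕ) : ℝ) * θ = m * θ + 2 * θ := by push_cast; ring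
  have e3 : d * angleDen d k q θ =
      (q ^ 2 + d ^ 2 - 2 * d * q * Real.cos θ) * (q ^ 2 + 1 + 2 * q * Real.cos θ) := by
    rw [angleDen]; linear_combination -(q ^ 2 + 1 + 2 * q * Real.cos θ) * hq
  rw [e3]
  simp only [angleFun, e1, e2, Real.sin_add, Real.cos_add, Real.cos_two_mul, Real.sin_two_mul]
  have h' := Real.sin_sq θ
  ring_nf
  simp only [h']
  ring

theorem sq_add_sq_eq_angleDen (hq : q ^ 2 = d * (k - 1)) (θ : ℝ) :
    ((q ^ 2 - d) * Real.cos θ + q * (1 - d)) ^ 2 + ((q ^ 2 + d) * Real.sin θ) ^ 2 =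
      d * angleDen d k q θ := by
  have e3 : d * angleDen d k q θ =
      (q ^ 2 + d ^ 2 - 2 * d * q * Real.cos θ) * (q ^ 2 + 1 + 2 * q * Real.cos θ) := by
    rw [angleDen]; linear_combination -(q ^ 2 + 1 + 2 * q * Real.cos θ) * hq
  rw [e3, mul_pow _ (Real.sin θ), Real.sin_sq]
  ring

/-- The denominator vanishes at most to the order of `sin θ ^ 2`. It does so at `θ = 0` if
`k = d + 1`, and also at `θ = π` if moreover `d = 1`. -/
theorem four_mul_sin_sq_le_angleDen (hd : 1 ≤ d) (hk : d + 1 ≤ k) (hq0 : 0 < q)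
    (hq : q ^ 2 = d * (k - 1)) (θ : ℝ) :
    4 * q ^ 2 * Real.sin θ ^ 2 ≤ angleDen d k q θ := by
  have h1 : 2 * q ≤ k - 1 + d := by
    refine (le_abs_self _).trans (abs_le_of_sq_le_sq ?_ (by linarith))
    nlinarith [sq_nonneg (k - 1 - d)]
  have h2 : 2 * q ≤ q ^ 2 + 1 := by nlinarith [sq_nonneg (q - 1)]
  have hc1 := Real.cos_le_one θ
  have hc2 := Real.neg_one_le_cos θ
  rw [Real.sin_sq, angleDen]
  calc 4 * q ^ 2 * (1 - Real.cos θ ^ 2)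
      = (2 * q * (1 - Real.cos θ)) * (2 * q * (1 + Real.cos θ)) := by ring
    _ ≤ _ := by
      apply mul_le_mul
      · linarith
      · linarith
      · exact mul_nonneg (by linarith) (by linarith)
      · have : 0 ≤ 2 * q * (1 - Real.cos θ) := mul_nonneg (by linarith) (by linarith)
        linarith

theorem angleWeight_mul_angleDen (hd : 1 ≤ d) (hk : d + 1 ≤ k) (hq0 : 0 < q)
    (hq : q ^ 2 = d * (k - 1)) (θ : ℝ) :
    angleWeight d k q θ * angleDen d k q θ = k * (4 * q ^ 2) / (2 * Real.pi) * Real.sin θ := by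
  have h := four_mul_sin_sq_le_angleDen hd hk hq0 hq θ
  by_cases h0 : angleDen d k q θ = 0
  · have hs : Real.sin θ = 0 := by
      rw [h0] at h
      have : 0 < 4 * q ^ 2 := by positivity
      exact pow_eq_zero_iff two_ne_zero |>.1 (le_antisymm (by nlinarith) (sq_nonneg _))
    rw [h0, hs]; simp
  · rw [angleWeight]
    field_simp

theorem measurable_angleWeight (d k q : ℝ) : Measurable (angleWeight d k q) := by
  unfold angleWeight angleDen
  fun_prop

/-- Any function `g` with `g ^ 2` at most a multiple of the denominator is integrable against the
weight, even where the denominator vanishes at an end of the interval. -/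
theorem integrableOn_angleWeight_mul (hd : 1 ≤ d) (hk : d + 1 ≤ k) (hq0 : 0 < q)
    (hq : q ^ 2 = d * (k - 1)) {g : ℝ → ℝ} (hg : Measurable g)
    (h : ∀ θ, g θ ^ 2 ≤ d * angleDen d k q θ) :
    IntegrableOn (fun θ => angleWeight d k q θ * g θ) (Set.Icc 0 Real.pi) := by
  refine Measure.integrableOn_of_bounded (M := k * (2 * q) / (2 * Real.pi) * √d) (by simp)
    ((measurable_angleWeight d k q).mul hg).aestronglyMeasurable (ae_of_all _ fun θ => ?_)
  have hD := four_mul_sin_sq_le_angleDen hd hk hq0 hq θ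
  have hpi := Real.pi_pos
  have hk0 : 0 < k := by linarith
  rw [Real.norm_eq_abs]
  by_cases h0 : angleDen d k q θ = 0
  · rw [angleWeight, h0]; simp only [mul_zero, div_zero, zero_mul, abs_zero]; positivity
  have hDpos : 0 < angleDen d k q θ := lt_of_le_of_ne ((by positivity : (0 : ℝ) ≤ _).trans hD)
    (Ne.symm h0)
  apply abs_le_of_sq_le_sq _ (by positivity)
  have e : (angleWeight d k q θ * g θ) ^ 2 = (k * (2 * q) / (2 * Real.pi)) ^ 2 *
      ((4 * q ^ 2 * Real.sin θ ^ 2) * g θ ^ 2 / angleDen d k q θ ^ 2) := by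
    rw [angleWeight]; field_simp; ring
  rw [e, mul_pow _ (√d), Real.sq_sqrt (by linarith)]
  gcongr
  rw [div_le_iff₀ (by positivity)]
  calc _ ≤ angleDen d k q θ * (d * angleDen d k q θ) :=
        mul_le_mul hD (h θ) (sq_nonneg _) hDpos.le
    _ = _ := by ring

theorem integrableOn_angleWeight_left (hd : 1 ≤ d) (hk : d + 1 ≤ k) (hq0 : 0 < q)
    (hq : q ^ 2 = d * (k - 1)) :
    IntegrableOn (fun θ => angleWeight d k q θ * ((q ^ 2 - d) * Real.cos θ + q * (1 - d)))
      (Set.Icc 0 Real.pi) :=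
  integrableOn_angleWeight_mul hd hk hq0 hq (by fun_prop) fun θ => by
    rw [← sq_add_sq_eq_angleDen hq]; nlinarith [sq_nonneg ((q ^ 2 + d) * Real.sin θ)]

theorem integrableOn_angleWeight_right (hd : 1 ≤ d) (hk : d + 1 ≤ k) (hq0 : 0 < q)
    (hq : q ^ 2 = d * (k - 1)) :
    IntegrableOn (fun θ => angleWeight d k q θ * ((q ^ 2 + d) * Real.sin θ))
      (Set.Icc 0 Real.pi) :=
  integrableOn_angleWeight_mul hd hk hq0 hq (by fun_prop) fun θ => by
    rw [← sq_add_sq_eq_angleDen hq]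
    nlinarith [sq_nonneg ((q ^ 2 - d) * Real.cos θ + q * (1 - d))]

theorem integrableOn_angleWeight_mul_angleFun (hd : 1 ≤ d) (hk : d + 1 ≤ k) (hq0 : 0 < q)
    (hq : q ^ 2 = d * (k - 1)) (m : ℕ) :
    IntegrableOn (fun θ => angleWeight d k q θ * angleFun d q m θ) (Set.Icc 0 Real.pi) := by
  have h1 := (integrableOn_angleWeight_left hd hk hq0 hq).mul_bdd (c := 1)
    (g := fun θ => Real.sin (m * θ)) (by fun_prop) (ae_of_all _ fun θ => Real.abs_sin_le_one _)
  have h2 := (integrableOn_angleWeight_right hd hk hq0 hq).mul_bdd (c := 1)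
    (g := fun θ => Real.cos (m * θ)) (by fun_prop) (ae_of_all _ fun θ => Real.abs_cos_le_one _)
  refine (h1.add h2).congr (ae_of_all _ fun θ => ?_)
  simp only [Pi.add_apply, angleFun]
  ring

/-- The Riemann–Lebesgue lemma for the functions `angleFun d q m`. -/
theorem tendsto_integral_angleWeight_mul_angleFun (hd : 1 ≤ d) (hk : d + 1 ≤ k) (hq0 : 0 < q)
    (hq : q ^ 2 = d * (k - 1)) :
    Tendsto (fun m : ℕ => ∫ θ in Set.Icc 0 Real.pi, angleWeight d k q θ * angleFun d q m θ)
      atTop (𝓝 0) := by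
  let f : ℝ → ℂ := fun θ =>
    ((angleWeight d k q θ * ((q ^ 2 - d) * Real.cos θ + q * (1 - d)) : ℝ) : ℂ) +
      ((angleWeight d k q θ * ((q ^ 2 + d) * Real.sin θ) : ℝ) : ℂ) * Complex.I
  have hf : IntegrableOn f (Set.Icc 0 Real.pi) :=
    (integrableOn_angleWeight_left hd hk hq0 hq).ofReal.add
      ((integrableOn_angleWeight_right hd hk hq0 hq).ofReal.mul_const _)
  have hRL := Real.tendsto_integral_exp_smul_cocompact ((Set.Icc 0 Real.pi).indicator f)
  have hw : Tendsto (fun m : ℕ => -((m : ℝ) / (2 * Real.pi))) atTop (cocompact ℝ) := by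
    refine Tendsto.mono_right ?_ atBot_le_cocompact
    exact tendsto_neg_atTop_atBot.comp
      (tendsto_natCast_atTop_atTop.atTop_div_const (by positivity))
  have h0 := (Complex.continuous_im.tendsto _).comp (hRL.comp hw)
  rw [Complex.zero_im] at h0
  refine h0.congr fun m => ?_
  have e1 : ∀ θ : ℝ, Real.fourierChar (-(θ * -((m : ℝ) / (2 * Real.pi)))) •
      (Set.Icc 0 Real.pi).indicator f θ = (Set.Icc 0 Real.pi).indicator
        (fun θ => Complex.exp ((m * θ : ℝ) * Complex.I) * f θ) θ := by
    intro θ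
    by_cases h : θ ∈ Set.Icc 0 Real.pi
    · rw [Set.indicator_of_mem h, Set.indicator_of_mem h, Circle.smul_def, Real.fourierChar_apply,
        smul_eq_mul]
      congr 4
      have := Real.pi_pos.ne'
      field_simp
    · rw [Set.indicator_of_notMem h, Set.indicator_of_notMem h, smul_zero]
  simp only [Function.comp_apply, e1]
  rw [integral_indicator measurableSet_Icc]
  have hint : IntegrableOn (fun θ : ℝ => Complex.exp ((m * θ : ℝ) * Complex.I) * f θ)
      (Set.Icc 0 Real.pi) :=
    hf.bdd_mul (c := 1) (by fun_prop)
      (ae_of_all _ fun θ => (Complex.norm_exp_ofReal_mul_I _).le)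
  have him := integral_im (𝕜 := ℂ) hint
  change _ = (∫ θ in Set.Icc 0 Real.pi, Complex.exp ((m * θ : ℝ) * Complex.I) * f θ).im at him
  rw [← him]
  refine setIntegral_congr_fun measurableSet_Icc fun θ _ => ?_
  change (Complex.exp ((m * θ : ℝ) * Complex.I) * f θ).im = _
  rw [Complex.exp_mul_I, ← Complex.ofReal_cos, ← Complex.ofReal_sin]
  simp only [f, Complex.mul_im, Complex.add_re, Complex.add_im, Complex.mul_re, Complex.ofReal_re,
    Complex.ofReal_im, Complex.I_re, Complex.I_im, angleFun]
  ring

theorem integral_sin_mul_sin (m : ℕ) :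
    ∫ θ in Set.Icc 0 Real.pi, Real.sin θ * Real.sin ((m + 1 : ℕ) * θ) =
      if m = 0 then Real.pi / 2 else 0 := by
  rw [integral_Icc_eq_integral_Ioc, ← intervalIntegral.integral_of_le Real.pi_pos.le]
  split_ifs with h
  · subst h
    have := integral_sin_sq (a := 0) (b := Real.pi)
    simp only [Real.sin_zero, Real.sin_pi, zero_mul, sub_zero, zero_add] at this
    rw [← this]
    refine intervalIntegral.integral_congr fun θ _ => ?_
    norm_num
    ring
  · have hm : (m : ℝ) ≠ 0 := by exact_mod_cast h
    have hm2 : (m : ℝ) + 2 ≠ 0 := by positivity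
    have hderiv : ∀ θ ∈ Set.uIcc 0 Real.pi, HasDerivAt
        (fun θ => (Real.sin (m * θ) / m - Real.sin ((m + 2) * θ) / (m + 2)) / 2)
        (Real.sin θ * Real.sin ((m + 1 : ℕ) * θ)) θ := by
      intro θ _
      have h1 : HasDerivAt (fun θ : ℝ => (m : ℝ) * θ) m θ := by
        simpa using (hasDerivAt_id θ).const_mul (m : ℝ)
      have h2 : HasDerivAt (fun θ : ℝ => ((m : ℝ) + 2) * θ) (m + 2) θ := by
        simpa using (hasDerivAt_id θ).const_mul ((m : ℝ) + 2)
      refine (((h1.sin.div_const (m : ℝ)).sub (h2.sin.div_const ((m : ℝ) + 2))).div_const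
        2).congr_deriv ?_
      rw [mul_div_cancel_right₀ _ hm, mul_div_cancel_right₀ _ hm2]
      have e1 : (m : ℝ) * θ = (m + 1 : ℕ) * θ - θ := by push_cast; ring
      have e2 : ((m : ℝ) + 2) * θ = (m + 1 : ℕ) * θ + θ := by push_cast; ring
      rw [e1, e2, Real.cos_sub, Real.cos_add]
      ring
    rw [intervalIntegral.integral_eq_sub_of_hasDerivAt hderiv
      (Continuous.intervalIntegrable (by fun_prop) _ _)]
    have e : ((m : ℝ) + 2) * Real.pi = (m + 2 : ℕ) * Real.pi := by push_cast; ring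
    rw [e, Real.sin_nat_mul_pi, Real.sin_nat_mul_pi]
    simp

theorem eq_zero_of_eq_mul_succ {c : ℝ} (hc : |c| ≤ 1) {u : ℕ → ℝ} (hu : Tendsto u atTop (𝓝 0))
    {N : ℕ} (h : ∀ m, N ≤ m → u m = c * u (m + 1)) {m : ℕ} (hm : N ≤ m) : u m = 0 := by
  have h1 : ∀ l, |u m| ≤ |u (m + l)| := by
    intro l
    induction l with
    | zero => exact le_rfl
    | succ l ih =>
      refine ih.trans ?_
      rw [h (m + l) (by omega), abs_mul]
      exact mul_le_of_le_one_left (abs_nonneg _) hc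
  have h2 : Tendsto (fun l => |u (m + l)|) atTop (𝓝 0) := by
    have := (hu.comp (tendsto_add_atTop_nat m)).abs
    rw [abs_zero] at this
    exact this.congr fun l => by rw [Function.comp_apply, add_comm]
  exact abs_eq_zero.1 (le_antisymm (ge_of_tendsto' h2 h1) (abs_nonneg _))

/-- The integrals `H m` of `angleFun d q m` satisfy a linear recurrence whose characteristic roots
`q / d` and `-q` do not lie inside the unit disc. As they tend to zero, they vanish. -/
theorem integral_angleWeight_mul_angleFun (hd : 1 ≤ d) (hk : d + 1 ≤ k) (hq0 : 0 < q)
    (hq : q ^ 2 = d * (k - 1)) (m : ℕ) :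
    ∫ θ in Set.Icc 0 Real.pi, angleWeight d k q θ * angleFun d q m θ =
      if m = 0 then d * k else 0 := by
  set H : ℕ → ℝ := fun m => ∫ θ in Set.Icc 0 Real.pi, angleWeight d k q θ * angleFun d q m θ
    with hH
  have hlim : Tendsto H atTop (𝓝 0) := tendsto_integral_angleWeight_mul_angleFun hd hk hq0 hq
  have hint := integrableOn_angleWeight_mul_angleFun hd hk hq0 hq
  have hrec : ∀ m, q ^ 2 * H m - (d - 1) * q * H (m + 1) - d * H (m + 2) =
      if m = 0 then d * k * q ^ 2 else 0 := by
    intro m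
    have e : ∀ θ, q ^ 2 * (angleWeight d k q θ * angleFun d q m θ) -
        (d - 1) * q * (angleWeight d k q θ * angleFun d q (m + 1) θ) -
        d * (angleWeight d k q θ * angleFun d q (m + 2) θ) =
        d * (k * (4 * q ^ 2) / (2 * Real.pi)) * (Real.sin θ * Real.sin ((m + 1 : ℕ) * θ)) := by
      intro θ
      linear_combination angleWeight d k q θ * angleFun_combination hq m θ +
        d * Real.sin ((m + 1 : ℕ) * θ) * angleWeight_mul_angleDen hd hk hq0 hq θ
    simp only [hH]
    have hi : Integrable (fun θ => q ^ 2 * (angleWeight d k q θ * angleFun d q m θ) -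
        (d - 1) * q * (angleWeight d k q θ * angleFun d q (m + 1) θ))
        (volume.restrict (Set.Icc 0 Real.pi)) :=
      ((hint m).const_mul _).sub ((hint (m + 1)).const_mul _)
    rw [← integral_const_mul, ← integral_const_mul, ← integral_const_mul,
      ← integral_sub ((hint m).const_mul _) ((hint (m + 1)).const_mul _),
      ← integral_sub hi ((hint (m + 2)).const_mul _)]
    simp only [e]
    rw [integral_const_mul, integral_sin_mul_sin]
    have := Real.pi_pos.ne'
    split_ifs
    · field_simp
      norm_num
    · rw [mul_zero]
  -- This is where `d + 1 ≤ k` enters: for `d > q` the limit law has an atom.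
  have hdq : d ≤ q := by
    refine (le_abs_self _).trans (abs_le_of_sq_le_sq ?_ hq0.le)
    rw [hq]; nlinarith
  have hq1 : 1 ≤ q := hd.trans hdq
  -- The recurrence factors as `(1 - (d / q) E) (1 + (1 / q) E) H = 0` for the shift `E`.
  have hg : ∀ m, 1 ≤ m → H m + 1 / q * H (m + 1) = 0 := fun m hm => by
    refine eq_zero_of_eq_mul_succ (c := d / q) (u := fun m => H m + 1 / q * H (m + 1)) ?_ ?_
      (N := 1) ?_ hm
    · rw [abs_of_nonneg (by positivity)]; exact (div_le_one hq0).2 hdq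
    · simpa using hlim.add ((hlim.comp (tendsto_add_atTop_nat 1)).const_mul (1 / q))
    · intro m hm
      have := hrec m
      rw [if_neg (by omega)] at this
      field_simp
      linear_combination this
  have hzero : ∀ m, 1 ≤ m → H m = 0 := fun m hm => by
    refine eq_zero_of_eq_mul_succ (c := -(1 / q)) ?_ hlim (N := 1) ?_ hm
    · rw [abs_neg, abs_of_nonneg (by positivity)]; exact (div_le_one hq0).2 hq1
    · intro m hm
      linear_combination hg m hm
  split_ifs with h
  · subst h
    have := hrec 0
    rw [if_pos rfl, hzero 1 le_rfl, hzero 2 (by norm_num)] at this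
    have hq2 : q ^ 2 ≠ 0 := by positivity
    apply mul_left_cancel₀ hq2
    linear_combination this
  · exact hzero m (by omega)

end Angle

/-! ### The limit measures -/

section LimitMeasure

theorem measurableSet_adjacencyInterval (d k : ℕ) : MeasurableSet (adjacencyInterval d k) :=
  measurableSet_Icc

theorem measurableSet_laplacianInterval (d k : ℕ) : MeasurableSet (laplacianInterval d k) :=
  measurableSet_Icc

theorem integral_withDensity_ofReal {I : Set ℝ} (hI : MeasurableSet I) {ρ : ℝ → ℝ}
    (hρ : Measurable ρ) (h0 : ∀ x ∈ I, 0 ≤ ρ x) (F : ℝ → ℝ) :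
    ∫ x, F x ∂((volume.restrict I).withDensity fun x => ENNReal.ofReal (ρ x)) =
      ∫ x in I, ρ x * F x := by
  rw [integral_withDensity_eq_integral_toReal_smul hρ.ennreal_ofReal
    (ae_of_all _ fun x => ENNReal.ofReal_lt_top)]
  refine setIntegral_congr_fun hI fun x hx => ?_
  simp only [ENNReal.toReal_ofReal (h0 x hx), smul_eq_mul]

theorem isProbabilityWithDensity_withDensity {I : Set ℝ} (hI : MeasurableSet I) {ρ : ℝ → ℝ}
    (h0 : ∀ x ∈ I, 0 ≤ ρ x) (hint : IntegrableOn ρ I) (h1 : ∫ x in I, ρ x = 1) :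
    IsProbabilityWithDensity
      ((volume.restrict I).withDensity fun x => ENNReal.ofReal (ρ x)) I ρ := by
  have key : ∀ B, MeasurableSet B →
      (volume.restrict I).withDensity (fun x => ENNReal.ofReal (ρ x)) B =
        ENNReal.ofReal (∫ x in B ∩ I, ρ x) := by
    intro B hB
    rw [withDensity_apply _ hB, Measure.restrict_restrict hB, ofReal_integral_eq_lintegral_ofReal]
    · exact hint.mono_set Set.inter_subset_right
    · exact (ae_restrict_iff' (hB.inter hI)).2 (ae_of_all _ fun x hx => h0 x hx.2)
  refine ⟨⟨?_⟩, hint, fun B hB => ?_⟩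
  · rw [key _ MeasurableSet.univ, Set.univ_inter, h1, ENNReal.ofReal_one]
  · rw [measureReal_def, key B hB, ENNReal.toReal_ofReal]
    exact setIntegral_nonneg (hB.inter hI) fun x hx => h0 x hx.2

theorem IsProbabilityWithDensity.unique {ν ν' : Measure ℝ} {I : Set ℝ} {ρ : ℝ → ℝ}
    (h : IsProbabilityWithDensity ν I ρ) (h' : IsProbabilityWithDensity ν' I ρ) : ν = ν' := by
  have := h.1
  have := h'.1
  ext B hB
  rw [← ENNReal.toReal_eq_toReal_iff' (measure_ne_top _ _) (measure_ne_top _ _)]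
  exact (h.2.2 B hB).trans (h'.2.2 B hB).symm

variable {d k : ℕ}

theorem sq_sqrt_sub_one_mul (hk : 1 ≤ k) :
    √(((k : ℝ) - 1) * d) ^ 2 = (d : ℝ) * ((k : ℝ) - 1) := by
  have : (1 : ℝ) ≤ k := by exact_mod_cast hk
  rw [Real.sq_sqrt (mul_nonneg (by linarith) (by positivity)), mul_comm]

theorem sqrt_sub_one_mul_pos (hd : 1 ≤ d) (hk : d + 1 ≤ k) : 0 < √(((k : ℝ) - 1) * d) := by
  have h1 : (1 : ℝ) ≤ d := by exact_mod_cast hd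
  have h2 : (d : ℝ) + 1 ≤ k := by exact_mod_cast hk
  exact Real.sqrt_pos.2 (mul_pos (by linarith) (by linarith))

theorem adjacencyInterval_eq_image (d k : ℕ) (hq : 0 < √(((k : ℝ) - 1) * d)) :
    adjacencyInterval d k =
      (fun θ => 1 - d + 2 * √(((k : ℝ) - 1) * d) * Real.cos θ) '' Set.Icc 0 Real.pi := by
  have : (fun θ => 1 - (d : ℝ) + 2 * √(((k : ℝ) - 1) * d) * Real.cos θ) =
      (fun y => (2 * √(((k : ℝ) - 1) * d)) * y + (1 - d)) ∘ Real.cos := by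
    funext θ; simp only [Function.comp_apply]; ring
  rw [this, Set.image_comp, Real.bijOn_cos.image_eq, Set.image_affine_Icc' (by positivity),
    adjacencyInterval]
  congr 1 <;> ring

theorem mul_adjacencyDensity (hd : 1 ≤ d) (hk : d + 1 ≤ k) {θ : ℝ}
    (hθ : θ ∈ Set.Icc 0 Real.pi) :
    |-(2 * √(((k : ℝ) - 1) * d) * Real.sin θ)| *
        adjacencyDensity d k (1 - d + 2 * √(((k : ℝ) - 1) * d) * Real.cos θ) =
      angleWeight d k (√(((k : ℝ) - 1) * d)) θ * Real.sin θ := by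
  have hq := sq_sqrt_sub_one_mul (d := d) (k := k) (by omega)
  have hq0 := sqrt_sub_one_mul_pos hd hk
  have hs : 0 ≤ Real.sin θ := Real.sin_nonneg_of_nonneg_of_le_pi hθ.1 hθ.2
  generalize √(((k : ℝ) - 1) * d) = q at hq hq0
  rw [abs_neg, abs_of_nonneg (by positivity), adjacencyDensity, angleWeight, angleDen]
  have e1 : 4 * ((k : ℝ) - 1) * d - (1 - d + 2 * q * Real.cos θ - 1 + d) ^ 2 =
      (2 * q * Real.sin θ) ^ 2 := by
    rw [mul_pow, mul_pow, Real.sin_sq]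
    linear_combination -4 * hq
  have e2 : (d : ℝ) * k + (1 - d + 2 * q * Real.cos θ) = q ^ 2 + 1 + 2 * q * Real.cos θ := by
    rw [hq]; ring
  have e3 : (k : ℝ) - (1 - d + 2 * q * Real.cos θ) = k - 1 + d - 2 * q * Real.cos θ := by ring
  rw [e1, Real.sqrt_sq (by positivity), e2, e3]
  ring

theorem injOn_angle (hd : 1 ≤ d) (hk : d + 1 ≤ k) : Set.InjOn
    (fun θ => 1 - (d : ℝ) + 2 * √(((k : ℝ) - 1) * d) * Real.cos θ)
    (Set.Icc 0 Real.pi) := by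
  intro x hx y hy h
  have hq0 := sqrt_sub_one_mul_pos hd hk
  refine Real.injOn_cos hx hy ?_
  have := add_left_cancel h
  exact mul_left_cancel₀ (by positivity) this

theorem hasDerivWithinAt_angle (q c : ℝ) (s : Set ℝ) (θ : ℝ) :
    HasDerivWithinAt (fun θ => c + 2 * q * Real.cos θ) (-(2 * q * Real.sin θ)) s θ :=
  ((((Real.hasDerivAt_cos θ).const_mul (2 * q)).const_add c).congr_deriv
    (by ring)).hasDerivWithinAt

theorem integral_adjacencyDensity_mul (hd : 1 ≤ d) (hk : d + 1 ≤ k) (F : ℝ → ℝ) :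
    ∫ x in adjacencyInterval d k, adjacencyDensity d k x * F x =
      ∫ θ in Set.Icc 0 Real.pi, angleWeight d k (√(((k : ℝ) - 1) * d)) θ *
        (Real.sin θ * F (1 - d + 2 * √(((k : ℝ) - 1) * d) * Real.cos θ)) := by
  rw [adjacencyInterval_eq_image d k (sqrt_sub_one_mul_pos hd hk),
    integral_image_eq_integral_abs_deriv_smul measurableSet_Icc
      (fun θ _ => hasDerivWithinAt_angle _ _ _ θ) (injOn_angle hd hk)]
  refine setIntegral_congr_fun measurableSet_Icc fun θ hθ => ?_
  simp only [smul_eq_mul]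
  rw [← mul_assoc, mul_adjacencyDensity hd hk hθ, mul_assoc]

theorem cast_hypotheses (hd : 1 ≤ d) (hk : d + 1 ≤ k) : (1 : ℝ) ≤ d ∧ (d : ℝ) + 1 ≤ k :=
  ⟨by exact_mod_cast hd, by exact_mod_cast hk⟩

theorem integrableOn_adjacencyDensity (hd : 1 ≤ d) (hk : d + 1 ≤ k) :
    IntegrableOn (adjacencyDensity d k) (adjacencyInterval d k) := by
  obtain ⟨h1, h2⟩ := cast_hypotheses hd hk
  have hq := sq_sqrt_sub_one_mul (d := d) (k := k) (by omega)
  rw [adjacencyInterval_eq_image d k (sqrt_sub_one_mul_pos hd hk),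
    integrableOn_image_iff_integrableOn_abs_deriv_smul measurableSet_Icc
      (fun θ _ => hasDerivWithinAt_angle _ _ _ θ) (injOn_angle hd hk)]
  have h := (integrableOn_angleWeight_right h1 h2 (sqrt_sub_one_mul_pos hd hk) hq).const_mul
    ((d : ℝ) * k)⁻¹
  refine IntegrableOn.congr_fun h (fun θ hθ => ?_) measurableSet_Icc
  simp only [smul_eq_mul]
  rw [mul_adjacencyDensity hd hk hθ, hq]
  have : (d : ℝ) ≠ 0 := by linarith
  have : (k : ℝ) ≠ 0 := by linarith
  field_simp
  ring

/-- The polynomials `wordPoly d k m` with `m ≥ 1` have mean zero for the limit law. -/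
theorem integral_adjacencyDensity_mul_wordPoly (hd : 1 ≤ d) (hk : d + 1 ≤ k) (m : ℕ) :
    ∫ x in adjacencyInterval d k, adjacencyDensity d k x * (wordPoly d k m).eval x =
      if m = 0 then 1 else 0 := by
  obtain ⟨h1, h2⟩ := cast_hypotheses hd hk
  have hq := sq_sqrt_sub_one_mul (d := d) (k := k) (by omega)
  have hq0 := sqrt_sub_one_mul_pos hd hk
  rw [integral_adjacencyDensity_mul hd hk]
  generalize √(((k : ℝ) - 1) * d) = q at hq hq0
  have hdk : (d : ℝ) * k ≠ 0 := mul_ne_zero (by linarith) (by linarith)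
  cases m with
  | zero =>
    have e : ∀ θ, angleWeight d k q θ *
        (Real.sin θ * (wordPoly d k 0).eval (1 - (d : ℝ) + 2 * q * Real.cos θ)) =
        ((d : ℝ) * k)⁻¹ * (angleWeight d k q θ * angleFun d q 0 θ) := by
      intro θ
      have : q ^ 2 + d = d * k := by rw [hq]; ring
      simp only [wordPoly, angleFun, Polynomial.eval_one, this, Nat.cast_zero, zero_mul,
        Real.sin_zero, Real.cos_zero]
      rw [mul_zero, zero_add, mul_one, mul_one]
      linear_combination -(angleWeight d k q θ * Real.sin θ) * inv_mul_cancel₀ hdk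
    simp only [e]
    rw [integral_const_mul, integral_angleWeight_mul_angleFun h1 h2 hq0 hq]
    simp only [if_true]
    exact inv_mul_cancel₀ hdk
  | succ m =>
    have e : ∀ θ, angleWeight d k q θ *
        (Real.sin θ * (wordPoly d k (m + 1)).eval (1 - (d : ℝ) + 2 * q * Real.cos θ)) =
        (q ^ 2)⁻¹ * q ^ (m + 1) * (angleWeight d k q θ * angleFun d q (m + 1) θ) := by
      intro θ
      have := sin_mul_eval_wordPoly hq m θ
      field_simp
      linear_combination angleWeight d k q θ * this
    simp only [e]
    rw [integral_const_mul, integral_angleWeight_mul_angleFun h1 h2 hq0 hq,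
      if_neg (Nat.succ_ne_zero m), if_neg (Nat.succ_ne_zero m), mul_zero]

theorem adjacencyDensity_nonneg (hd : 1 ≤ d) (hk : d + 1 ≤ k) {x : ℝ}
    (hx : x ∈ adjacencyInterval d k) :
    0 ≤ adjacencyDensity d k x := by
  obtain ⟨h1, h2⟩ := cast_hypotheses hd hk
  have hq := sq_sqrt_sub_one_mul (d := d) (k := k) (by omega)
  have hq0 := sqrt_sub_one_mul_pos hd hk
  rw [adjacencyInterval] at hx
  generalize √(((k : ℝ) - 1) * d) = q at hq hq0 hx
  rw [adjacencyDensity]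
  have e1 : 2 * q ≤ k - 1 + d := by
    refine (le_abs_self _).trans (abs_le_of_sq_le_sq ?_ (by linarith))
    nlinarith [sq_nonneg ((k : ℝ) - 1 - d)]
  have e2 : 0 ≤ (k : ℝ) - x := by linarith [hx.2]
  have e3 : 0 ≤ (d : ℝ) * k + x := by nlinarith [hx.1, sq_nonneg (q - 1)]
  have := Real.pi_pos
  positivity

theorem integral_adjacencyDensity (hd : 1 ≤ d) (hk : d + 1 ≤ k) :
    ∫ x in adjacencyInterval d k, adjacencyDensity d k x = 1 := by
  have := integral_adjacencyDensity_mul_wordPoly hd hk 0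
  simpa [wordPoly] using this

theorem measurable_adjacencyDensity (d k : ℕ) : Measurable (adjacencyDensity d k) := by
  unfold adjacencyDensity
  fun_prop

theorem laplacianInterval_eq_preimage (hk : 1 ≤ k) :
    laplacianInterval d k = (fun x => (k : ℝ) - x) ⁻¹' adjacencyInterval d k := by
  have h1 : (1 : ℝ) ≤ k := by exact_mod_cast hk
  have hs : ((√((k : ℝ) - 1)) ^ 2) = (k : ℝ) - 1 := Real.sq_sqrt (by linarith)
  have hs' : (√(d : ℝ)) ^ 2 = d := Real.sq_sqrt (by positivity)
  rw [laplacianInterval, adjacencyInterval, Set.preimage_const_sub_Icc,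
    Real.sqrt_mul (by linarith)]
  congr 1
  · linear_combination hs + hs'
  · linear_combination hs + hs'

theorem laplacianDensity_eq (d k : ℕ) (x : ℝ) :
    laplacianDensity d k x = adjacencyDensity d k ((k : ℝ) - x) := by
  rw [laplacianDensity, adjacencyDensity]
  congr 1
  · congr 3; ring
  · ring

theorem adjacencyLimit_eq (hk : 1 ≤ k) : adjacencyLimit d k =
    (volume.restrict (adjacencyInterval d k)).withDensity
      fun x => ENNReal.ofReal (adjacencyDensity d k x) := by
  have hmeas : Measurable fun x : ℝ => (k : ℝ) - x := by fun_prop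
  have hmp : MeasurePreserving (fun x : ℝ => (k : ℝ) - x) volume volume :=
    Measure.measurePreserving_sub_left volume (k : ℝ)
  have hemb : MeasurableEmbedding fun x : ℝ => (k : ℝ) - x :=
    (MeasurableEquiv.subLeft (k : ℝ)).measurableEmbedding
  ext B hB
  rw [adjacencyLimit, Measure.map_apply hmeas hB, laplacianLimit, withDensity_apply _ (hmeas hB),
    withDensity_apply _ hB, Measure.restrict_restrict (hmeas hB), Measure.restrict_restrict hB,
    laplacianInterval_eq_preimage hk, ← Set.preimage_inter]
  simp only [laplacianDensity_eq]
  exact hmp.setLIntegral_comp_preimage_emb hemb (fun x => ENNReal.ofReal (adjacencyDensity d k x)) _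

theorem isProbabilityWithDensity_adjacencyLimit (hd : 1 ≤ d) (hk : d + 1 ≤ k) :
    IsProbabilityWithDensity (adjacencyLimit d k) (adjacencyInterval d k)
      (adjacencyDensity d k) := by
  rw [adjacencyLimit_eq (by omega)]
  exact isProbabilityWithDensity_withDensity (measurableSet_adjacencyInterval d k)
    (fun x hx => adjacencyDensity_nonneg hd hk hx) (integrableOn_adjacencyDensity hd hk)
    (integral_adjacencyDensity hd hk)

theorem isProbabilityWithDensity_laplacianLimit (hd : 1 ≤ d) (hk : d + 1 ≤ k) :
    IsProbabilityWithDensity (laplacianLimit d k) (laplacianInterval d k)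
      (laplacianDensity d k) := by
  have hk1 : 1 ≤ k := by omega
  have hmp : MeasurePreserving (fun x : ℝ => (k : ℝ) - x) volume volume :=
    Measure.measurePreserving_sub_left volume (k : ℝ)
  have hemb : MeasurableEmbedding fun x : ℝ => (k : ℝ) - x :=
    (MeasurableEquiv.subLeft (k : ℝ)).measurableEmbedding
  have he : laplacianDensity d k = adjacencyDensity d k ∘ fun x => (k : ℝ) - x :=
    funext fun x => laplacianDensity_eq d k x
  refine isProbabilityWithDensity_withDensity (measurableSet_laplacianInterval d k) ?_ ?_ ?_
  · intro x hx
    rw [laplacianInterval_eq_preimage hk1] at hx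
    rw [laplacianDensity_eq]
    exact adjacencyDensity_nonneg hd hk hx
  · rw [laplacianInterval_eq_preimage hk1, he, hmp.integrableOn_comp_preimage hemb]
    exact integrableOn_adjacencyDensity hd hk
  · rw [laplacianInterval_eq_preimage hk1, he]
    exact (hmp.setIntegral_preimage_emb hemb (adjacencyDensity d k) _).trans
      (integral_adjacencyDensity hd hk)

theorem integral_adjacencyLimit_wordPoly (hd : 1 ≤ d) (hk : d + 1 ≤ k) (m : ℕ) :
    ∫ x, (wordPoly d k m).eval x ∂(adjacencyLimit d k) = if m = 0 then 1 else 0 := by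
  rw [adjacencyLimit_eq (by omega), integral_withDensity_ofReal
    (measurableSet_adjacencyInterval d k)
    (measurable_adjacencyDensity d k) (fun x hx => adjacencyDensity_nonneg hd hk hx),
    integral_adjacencyDensity_mul_wordPoly hd hk]

theorem ae_mem_adjacencyInterval (hk : 1 ≤ k) :
    ∀ᵐ x ∂(adjacencyLimit d k), x ∈ adjacencyInterval d k := by
  rw [adjacencyLimit_eq hk]
  exact (withDensity_absolutelyContinuous _ _).ae_le (ae_restrict_mem measurableSet_Icc)

theorem ae_mem_laplacianInterval (d k : ℕ) :
    ∀ᵐ x ∂(laplacianLimit d k), x ∈ laplacianInterval d k :=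
  (withDensity_absolutelyContinuous _ _).ae_le (ae_restrict_mem measurableSet_Icc)

end LimitMeasure

/-! ### The union of the Steiner systems -/

section Union

variable {d k n : ℕ}

theorem mem_faces_steinerComplex (hd : 1 ≤ d) (S : Fin k → SteinerSystem d n) (σ : Facet n d) :
    σ.1 ∈ (steinerComplex S).faces :=
  Or.inl ⟨Finset.card_pos.1 (by rw [σ.2]; omega), σ.2.le⟩

open Classical in
theorem faceWeight_steinerComplex (S : Fin k → SteinerSystem d n) (τ : Facet n (d + 1)) :
    faceWeight (steinerComplex S) τ = if ∃ j, τ.1 ∈ (S j).1 then 1 else 0 := by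
  rw [faceWeight]
  refine if_congr ⟨?_, fun ⟨j, hj⟩ => Or.inr (Set.mem_iUnion.2 ⟨j, hj⟩)⟩ rfl rfl
  rintro (⟨-, h⟩ | h)
  · change τ.1.card ≤ d at h
    have := τ.2; omega
  · exact Set.mem_iUnion.1 h

theorem blockWeight_nonneg (S : SteinerSystem d n) (τ : Facet n (d + 1)) :
    0 ≤ blockWeight S τ := by
  rw [blockWeight]; split_ifs <;> norm_num

theorem blockWeight_mul_self (S : SteinerSystem d n) (τ : Facet n (d + 1)) :
    blockWeight S τ * blockWeight S τ = blockWeight S τ := by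
  rw [blockWeight]; split_ifs <;> norm_num

theorem faceWeight_le_sum_blockWeight (S : Fin k → SteinerSystem d n) (τ : Facet n (d + 1)) :
    faceWeight (steinerComplex S) τ ≤ ∑ j, blockWeight (S j) τ := by
  rw [faceWeight_steinerComplex]
  split_ifs with h
  · obtain ⟨j, hj⟩ := h
    refine le_trans (le_of_eq ?_) (Finset.single_le_sum
      (f := fun j => blockWeight (S j) τ) (fun j _ => blockWeight_nonneg _ _) (Finset.mem_univ j))
    rw [blockWeight, if_pos hj]
  · exact Finset.sum_nonneg fun j _ => blockWeight_nonneg _ _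

theorem faceWeight_nonneg {m : ℕ} (X : PreAbstractSimplicialComplex (Fin n)) (τ : Facet n m) :
    0 ≤ faceWeight X τ := by
  rw [faceWeight]; split_ifs <;> norm_num

/-- If `c` systems contain `τ`, this is the inequality `|min c 1 - c| ≤ c ^ 2 - c`. -/
theorem abs_faceWeight_sub_le (S : Fin k → SteinerSystem d n) (τ : Facet n (d + 1)) :
    |faceWeight (steinerComplex S) τ - ∑ j, blockWeight (S j) τ| ≤
      ∑ i, ∑ j, if i ≠ j then blockWeight (S i) τ * blockWeight (S j) τ else 0 := by
  have e : (∑ i, ∑ j, if i ≠ j then blockWeight (S i) τ * blockWeight (S j) τ else 0) =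
      (∑ j, blockWeight (S j) τ) * (∑ j, blockWeight (S j) τ) - ∑ j, blockWeight (S j) τ := by
    rw [Finset.sum_mul_sum, ← Finset.sum_sub_distrib]
    refine Finset.sum_congr rfl fun i _ => ?_
    rw [← Finset.sum_filter, Finset.filter_ne, eq_sub_iff_add_eq]
    have h := Finset.sum_erase_add _ (fun j => blockWeight (S i) τ * blockWeight (S j) τ)
      (Finset.mem_univ i)
    rwa [blockWeight_mul_self] at h
  have h1 := faceWeight_le_sum_blockWeight S τ
  rw [e, abs_sub_comm, abs_of_nonneg (by linarith)]
  rw [faceWeight_steinerComplex] at h1 ⊢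
  split_ifs at h1 ⊢ with h
  · nlinarith
  · have : ∑ j, blockWeight (S j) τ = 0 :=
      Finset.sum_eq_zero fun j _ => by rw [blockWeight, if_neg fun hj => h ⟨j, hj⟩]
    rw [this]; norm_num

open Classical in
theorem sum_blockWeight_mul_le (hd : 1 ≤ d) (S S' : SteinerSystem d n) :
    ∑ τ, blockWeight S τ * blockWeight S' τ ≤
      ∑ σ : Facet n d, ∑ ρ, if BlockAdj S σ ρ ∧ BlockAdj S' ρ σ then 1 else 0 := by
  have h1 : ∑ τ, blockWeight S τ * blockWeight S' τ ≤ ∑ τ : Facet n (d + 1), ∑ σ : Facet n d,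
      if σ.1 ⊆ τ.1 then blockWeight S τ * blockWeight S' τ else 0 := by
    refine Finset.sum_le_sum fun τ _ => ?_
    rw [← Finset.sum_filter, Finset.sum_const, Facet.card_facets, nsmul_eq_mul]
    have h0 := mul_nonneg (blockWeight_nonneg S τ) (blockWeight_nonneg S' τ)
    push_cast
    nlinarith [(Nat.cast_nonneg d : (0 : ℝ) ≤ d)]
  refine h1.trans ?_
  rw [Finset.sum_comm]
  refine Finset.sum_le_sum fun σ _ => ?_
  have hnn : (0 : ℝ) ≤ ∑ ρ, if BlockAdj S σ ρ ∧ BlockAdj S' ρ σ then 1 else 0 :=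
    Finset.sum_nonneg fun _ _ => by split_ifs <;> norm_num
  obtain ⟨τ, hτ⟩ := exists_block S σ
  have hτ' := (hτ τ).2 rfl
  rw [Finset.sum_eq_single τ]
  · rw [if_pos hτ'.2]
    by_cases h2 : τ.1 ∈ S'.1
    · obtain ⟨ρ, hρ, hne⟩ := Finset.exists_mem_ne (s := Finset.univ.filter fun ρ : Facet n d =>
        ρ.1 ⊆ τ.1) (by rw [Facet.card_facets]; omega) σ
      have hρτ := (Finset.mem_filter.1 hρ).2
      refine le_trans ?_ (Finset.single_le_sum
        (f := fun ρ => if BlockAdj S σ ρ ∧ BlockAdj S' ρ σ then (1 : ℝ) else 0)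
        (fun _ _ => by split_ifs <;> norm_num) (Finset.mem_univ ρ))
      rw [if_pos ⟨blockAdj_of_subset hne.symm hτ'.1 hτ'.2 hρτ,
        blockAdj_of_subset hne h2 hρτ hτ'.2⟩, blockWeight, blockWeight, if_pos hτ'.1, if_pos h2]
      norm_num
    · rw [blockWeight, blockWeight, if_neg h2, mul_zero]
      exact hnn
  · intro τ' _ hne
    by_cases h2 : σ.1 ⊆ τ'.1
    · rw [if_pos h2, blockWeight, if_neg fun h => hne ((hτ τ').1 ⟨h, h2⟩), zero_mul]
    · rw [if_neg h2]
  · simp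

/-- A block that belongs to two of the systems gives closed reduced walks with two steps. -/
theorem sum_abs_faceWeight_sub_le (hd : 1 ≤ d) (S : Fin k → SteinerSystem d n) :
    ∑ τ, |(faceWeight (m := d + 1) (steinerComplex S) - ∑ j, blockWeight (S j)) τ| ≤
      closedWalks S 2 := by
  classical
  calc ∑ τ, |(faceWeight (m := d + 1) (steinerComplex S) - ∑ j, blockWeight (S j)) τ|
      ≤ ∑ τ, ∑ i, ∑ j, if i ≠ j then blockWeight (S i) τ * blockWeight (S j) τ else 0 := by
        refine Finset.sum_le_sum fun τ _ => ?_
        rw [Pi.sub_apply, Finset.sum_apply]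
        exact abs_faceWeight_sub_le S τ
    _ = ∑ i, ∑ j, if i ≠ j then ∑ τ, blockWeight (S i) τ * blockWeight (S j) τ else 0 := by
        rw [Finset.sum_comm]
        refine Finset.sum_congr rfl fun i _ => ?_
        rw [Finset.sum_comm]
        refine Finset.sum_congr rfl fun j _ => ?_
        split_ifs
        · rfl
        · simp
    _ ≤ ∑ i, ∑ j, ∑ σ : Facet n d, ∑ ρ,
          if i ≠ j ∧ BlockAdj (S i) σ ρ ∧ BlockAdj (S j) ρ σ then 1 else 0 := by
        refine Finset.sum_le_sum fun i _ => Finset.sum_le_sum fun j _ => ?_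
        by_cases h : i ≠ j
        · simp only [h, true_and, if_true, ne_eq, not_false_eq_true]
          exact sum_blockWeight_mul_le hd (S i) (S j)
        · simp [h]
    _ = ∑ σ : Facet n d, ∑ j, ∑ i, ∑ ρ,
          if i ≠ j ∧ BlockAdj (S i) σ ρ ∧ BlockAdj (S j) ρ σ then 1 else 0 := by
        rw [Finset.sum_comm' (t' := Finset.univ) (s' := fun _ => Finset.univ) (by simp),
          Finset.sum_comm (s := (Finset.univ : Finset (Facet n d)))]
        refine Finset.sum_congr rfl fun j _ => ?_
        rw [Finset.sum_comm]
    _ ≤ closedWalks S 2 := by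
        rw [closedWalks]
        refine Finset.sum_le_sum fun σ _ => ?_
        rw [sum_stepLists_succ, Fintype.sum_prod_type]
        refine Finset.sum_le_sum fun j _ => ?_
        refine le_trans (le_of_eq ?_) (Finset.single_le_sum (f := fun σ' =>
          ∑ l ∈ stepLists d k n 1, if IsReducedWalk S σ ((j, σ') :: l) ∧
            lastFacet σ ((j, σ') :: l) = σ then (1 : ℝ) else 0)
          (fun σ' _ => Finset.sum_nonneg fun _ _ => by split_ifs <;> norm_num)
          (Finset.mem_univ σ))
        rw [sum_stepLists_succ, Fintype.sum_prod_type]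
        refine Finset.sum_congr rfl fun i _ => Finset.sum_congr rfl fun ρ _ => ?_
        rw [stepLists, Finset.sum_singleton]
        refine if_congr ?_ rfl rfl
        simp only [IsReducedWalk, lastFacet, List.head?_cons, List.head?_nil, Option.mem_def,
          Option.some.injEq, forall_eq', reduceCtorEq, false_imp_iff, implies_true, true_and,
          and_true]
        tauto

theorem sum_sum_blockWeight (S : Fin k → SteinerSystem d n) (σ : Facet n d) :
    ∑ τ with σ.1 ⊆ τ.1, (∑ j, blockWeight (S j)) τ = k := by
  simp only [Finset.sum_apply]
  rw [Finset.sum_comm]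
  simp only [sum_blockWeight, Finset.sum_const, Finset.card_univ, Fintype.card_fin, nsmul_eq_mul,
    mul_one]

theorem sum_abs_laplacianMatrix_le_of_le (S : Fin k → SteinerSystem d n)
    {w : Facet n (d + 1) → ℝ} (h0 : ∀ τ, 0 ≤ w τ) (h1 : ∀ τ, w τ ≤ (∑ j, blockWeight (S j)) τ)
    (σ : Facet n d) : ∑ σ', |laplacianMatrix w σ σ'| ≤ (d + 1) * k := by
  refine (sum_abs_laplacianMatrix_le w σ).trans ?_
  rw [← sum_sum_blockWeight S σ]
  gcongr with τ
  rw [abs_of_nonneg (h0 τ)]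
  exact h1 τ

theorem laplacianMatrix_sum_blockWeight (S : Fin k → SteinerSystem d n) :
    laplacianMatrix (∑ j, blockWeight (S j)) =
      (k : ℝ) • (1 : Matrix (Facet n d) (Facet n d) ℝ) -
        ∑ j, adjacencyMatrix (blockWeight (S j)) := by
  simp only [adjacencyMatrix_blockWeight, Finset.sum_sub_distrib, sum_laplacianMatrix]
  rw [Finset.sum_const, Finset.card_univ, Fintype.card_fin, ← Nat.cast_smul_eq_nsmul ℝ]
  abel

end Union

/-! ### Traces of polynomials -/

section Traces

theorem integrable_of_ae_mem_Icc {μ : Measure ℝ} [IsFiniteMeasure μ] {a b : ℝ}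
    (h : ∀ᵐ x ∂μ, x ∈ Set.Icc a b) {f : ℝ → ℝ} (hf : Continuous f) : Integrable f μ := by
  obtain ⟨C, hC⟩ := (isCompact_Icc (a := a) (b := b)).exists_bound_of_continuousOn hf.continuousOn
  exact Integrable.of_bound hf.aestronglyMeasurable C (h.mono fun x hx => hC x hx)

/-- The trace of a polynomial in the sum of the adjacency matrices of `k` Steiner systems differs
from its prediction by the limit law by at most a multiple of the number of closed reduced walks.
-/
theorem exists_abs_trace_sub_integral_le {d k : ℕ} (hd : 1 ≤ d) (hk : d + 1 ≤ k)
    (p : Polynomial ℝ) :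
    ∃ (C : ℝ) (M : ℕ), 0 ≤ C ∧ ∀ (n : ℕ) (S : Fin k → SteinerSystem d n),
      |(Polynomial.aeval (∑ j, adjacencyMatrix (blockWeight (S j))) p).trace -
        Fintype.card (Facet n d) * ∫ x, p.eval x ∂(adjacencyLimit d k)| ≤
      C * ∑ m ∈ Finset.range M, closedWalks S (m + 1) := by
  have := (isProbabilityWithDensity_adjacencyLimit hd hk).1
  have hint : ∀ p : Polynomial ℝ, Integrable (fun x => p.eval x) (adjacencyLimit d k) := fun p =>
    integrable_of_ae_mem_Icc (ae_mem_adjacencyInterval (by omega)) p.continuous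
  have hp := mem_span_wordPoly d k p
  induction hp using Submodule.span_induction with
  | mem q h =>
    obtain ⟨m, rfl⟩ := h
    refine ⟨1, m, zero_le_one, fun n S => ?_⟩
    rw [integral_adjacencyLimit_wordPoly hd hk]
    cases m with
    | zero => simp [wordPoly]
    | succ m =>
      rw [if_neg (Nat.succ_ne_zero m), mul_zero, sub_zero, one_mul,
        aeval_wordPoly fun j => adjacencyMatrix_blockWeight_mul_self (S j)]
      refine (abs_trace_reducedWords_le S m).trans ?_
      exact Finset.single_le_sum (f := fun m => closedWalks S (m + 1))
        (fun _ _ => closedWalks_nonneg _ _) (Finset.self_mem_range_succ m)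
  | zero => exact ⟨0, 0, le_rfl, fun n S => by simp⟩
  | add p q _ _ h h' =>
    obtain ⟨C, M, hC, h⟩ := h
    obtain ⟨C', M', hC', h'⟩ := h'
    refine ⟨C + C', max M M', add_nonneg hC hC', fun n S => ?_⟩
    simp only [Polynomial.eval_add]
    rw [integral_add (hint p) (hint q), map_add, Matrix.trace_add, mul_add, add_sub_add_comm,
      add_mul]
    refine (abs_add_le _ _).trans (add_le_add ((h n S).trans ?_) ((h' n S).trans ?_))
    · refine mul_le_mul_of_nonneg_left (Finset.sum_le_sum_of_subset_of_nonneg ?_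
        fun _ _ _ => closedWalks_nonneg _ _) hC
      exact Finset.range_subset_range.2 (le_max_left _ _)
    · refine mul_le_mul_of_nonneg_left (Finset.sum_le_sum_of_subset_of_nonneg ?_
        fun _ _ _ => closedWalks_nonneg _ _) hC'
      exact Finset.range_subset_range.2 (le_max_right _ _)
  | smul c p _ h =>
    obtain ⟨C, M, hC, h⟩ := h
    refine ⟨|c| * C, M, by positivity, fun n S => ?_⟩
    simp only [Polynomial.eval_smul, smul_eq_mul]
    rw [integral_const_mul, map_smul, Matrix.trace_smul, smul_eq_mul, mul_left_comm, ← mul_sub,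
      abs_mul, mul_assoc]
    exact mul_le_mul_of_nonneg_left (h n S) (abs_nonneg c)

theorem closedWalks_le_sum {d k n : ℕ} (S : Fin k → SteinerSystem d n) (M : ℕ) :
    closedWalks S 2 ≤ ∑ m ∈ Finset.range (M + 2), closedWalks S (m + 1) :=
  Finset.single_le_sum (f := fun m => closedWalks S (m + 1))
    (fun _ _ => closedWalks_nonneg _ _) (Finset.mem_range.2 (by omega : 1 < M + 2))

theorem sum_closedWalks_le_sum {d k n : ℕ} (S : Fin k → SteinerSystem d n) (M : ℕ) :
    ∑ m ∈ Finset.range M, closedWalks S (m + 1) ≤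
      ∑ m ∈ Finset.range (M + 2), closedWalks S (m + 1) :=
  Finset.sum_le_sum_of_subset_of_nonneg (Finset.range_subset_range.2 (by omega))
    fun _ _ _ => closedWalks_nonneg _ _

theorem sum_sum_abs_laplacianMatrix_sub_le {d k n : ℕ} (hd : 1 ≤ d)
    (S : Fin k → SteinerSystem d n) :
    ∑ σ : Facet n d, ∑ σ', |(laplacianMatrix (m := d) (faceWeight (steinerComplex S)) -
      laplacianMatrix (∑ j, blockWeight (S j))) σ σ'| ≤ (d + 1) ^ 2 * closedWalks S 2 := by
  rw [laplacianMatrix_sub]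
  refine (sum_sum_abs_laplacianMatrix_le _).trans ?_
  gcongr
  exact sum_abs_faceWeight_sub_le hd S

theorem sum_sum_abs_adjacencyMatrix_sub_le {d k n : ℕ} (hd : 1 ≤ d)
    (S : Fin k → SteinerSystem d n) :
    ∑ σ : Facet n d, ∑ σ', |(adjacencyMatrix (m := d) (faceWeight (steinerComplex S)) -
      ∑ j, adjacencyMatrix (blockWeight (S j))) σ σ'| ≤ (d + 1) ^ 2 * closedWalks S 2 := by
  refine le_trans ?_ (sum_sum_abs_laplacianMatrix_sub_le hd S)
  rw [sum_adjacencyMatrix, adjacencyMatrix_sub, laplacianMatrix_sub]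
  exact Finset.sum_le_sum fun σ _ => Finset.sum_le_sum fun σ' _ => abs_adjacencyMatrix_le _ _ _

theorem isHermitian_abs_col_le {ι : Type*} [Fintype ι] {M : Matrix ι ι ℝ} (hM : M.IsHermitian)
    {K : ℝ} (h : ∀ i, ∑ j, |M i j| ≤ K) (j : ι) : ∑ i, |M i j| ≤ K := by
  refine le_trans (le_of_eq ?_) (h j)
  refine Finset.sum_congr rfl fun i _ => ?_
  have := congrFun (congrFun hM i) j
  rw [Matrix.conjTranspose_apply, star_trivial] at this
  rw [this]

theorem exists_abs_trace_adjacencyMatrix_sub_integral_le {d k : ℕ} (hd : 1 ≤ d) (hk : d + 1 ≤ k)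
    (p : Polynomial ℝ) :
    ∃ (C : ℝ) (M : ℕ), 0 ≤ C ∧ ∀ (n : ℕ) (S : Fin k → SteinerSystem d n),
      |(Polynomial.aeval (adjacencyMatrix (m := d) (faceWeight (steinerComplex S))) p).trace -
        Fintype.card (Facet n d) * ∫ x, p.eval x ∂(adjacencyLimit d k)| ≤
      C * ∑ m ∈ Finset.range M, closedWalks S (m + 1) := by
  obtain ⟨C, M, hC, h⟩ := exists_abs_trace_sub_integral_le hd hk p
  obtain ⟨C', hC', h'⟩ := exists_abs_trace_aeval_sub_le p ((d + 1) * k) (by positivity)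
  refine ⟨C' * (d + 1) ^ 2 + C, M + 2, by positivity, fun n S => ?_⟩
  have h1 := h n S
  have h2 := h' (Facet n d) (adjacencyMatrix (faceWeight (steinerComplex S)))
    (∑ j, adjacencyMatrix (blockWeight (S j))) ?_ ?_
  · have h3 := sum_sum_abs_adjacencyMatrix_sub_le hd S
    have h4 := abs_sub_le
      (Polynomial.aeval (adjacencyMatrix (m := d) (faceWeight (steinerComplex S))) p).trace
      (Polynomial.aeval (∑ j, adjacencyMatrix (blockWeight (S j))) p).trace
      (Fintype.card (Facet n d) * ∫ x, p.eval x ∂(adjacencyLimit d k))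
    refine h4.trans ?_
    rw [add_mul]
    refine add_le_add (h2.trans ?_) (h1.trans ?_)
    · rw [mul_assoc]
      refine mul_le_mul_of_nonneg_left (h3.trans ?_) hC'
      exact mul_le_mul_of_nonneg_left (closedWalks_le_sum S M) (by positivity)
    · exact mul_le_mul_of_nonneg_left (sum_closedWalks_le_sum S M) hC
  · intro σ
    refine (Finset.sum_le_sum fun σ' _ => abs_adjacencyMatrix_le _ _ _).trans ?_
    refine sum_abs_laplacianMatrix_le_of_le S (faceWeight_nonneg _) (fun τ => ?_) σ
    rw [Finset.sum_apply]
    exact faceWeight_le_sum_blockWeight S τ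
  · rw [sum_adjacencyMatrix]
    refine isHermitian_abs_col_le (adjacencyMatrix_isHermitian _) fun σ => ?_
    refine (Finset.sum_le_sum fun σ' _ => abs_adjacencyMatrix_le _ _ _).trans ?_
    refine sum_abs_laplacianMatrix_le_of_le S (fun τ => ?_) (fun τ => le_rfl) σ
    rw [Finset.sum_apply]
    exact Finset.sum_nonneg fun j _ => blockWeight_nonneg _ _

theorem exists_abs_trace_laplacianMatrix_sub_integral_le {d k : ℕ} (hd : 1 ≤ d) (hk : d + 1 ≤ k)
    (p : Polynomial ℝ) :
    ∃ (C : ℝ) (M : ℕ), 0 ≤ C ∧ ∀ (n : ℕ) (S : Fin k → SteinerSystem d n),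
      |(Polynomial.aeval (laplacianMatrix (m := d) (faceWeight (steinerComplex S))) p).trace -
        Fintype.card (Facet n d) * ∫ x, p.eval x ∂(laplacianLimit d k)| ≤
      C * ∑ m ∈ Finset.range M, closedWalks S (m + 1) := by
  obtain ⟨C, M, hC, h⟩ := exists_abs_trace_sub_integral_le hd hk
    (p.comp (Polynomial.C (k : ℝ) - Polynomial.X))
  obtain ⟨C', hC', h'⟩ := exists_abs_trace_aeval_sub_le p ((d + 1) * k) (by positivity)
  refine ⟨C' * (d + 1) ^ 2 + C, M + 2, by positivity, fun n S => ?_⟩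
  have h1 := h n S
  have e1 : ∫ x, (p.comp (Polynomial.C (k : ℝ) - Polynomial.X)).eval x ∂(adjacencyLimit d k) =
      ∫ x, p.eval x ∂(laplacianLimit d k) := by
    rw [adjacencyLimit, integral_map (by fun_prop)
      (Polynomial.continuous _).aestronglyMeasurable]
    simp
  have e2 : Polynomial.aeval (∑ j, adjacencyMatrix (blockWeight (S j)))
      (p.comp (Polynomial.C (k : ℝ) - Polynomial.X)) =
      Polynomial.aeval (laplacianMatrix (∑ j, blockWeight (S j))) p := by
    rw [Polynomial.aeval_comp, laplacianMatrix_sum_blockWeight, map_sub, Polynomial.aeval_C,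
      Polynomial.aeval_X, Algebra.algebraMap_eq_smul_one]
  rw [e1, e2] at h1
  have h2 := h' (Facet n d) (laplacianMatrix (faceWeight (steinerComplex S)))
    (laplacianMatrix (∑ j, blockWeight (S j))) ?_ ?_
  · have h3 := sum_sum_abs_laplacianMatrix_sub_le hd S
    have h4 := abs_sub_le
      (Polynomial.aeval (laplacianMatrix (m := d) (faceWeight (steinerComplex S))) p).trace
      (Polynomial.aeval (laplacianMatrix (m := d) (∑ j, blockWeight (S j))) p).trace
      (Fintype.card (Facet n d) * ∫ x, p.eval x ∂(laplacianLimit d k))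
    refine h4.trans ?_
    rw [add_mul]
    refine add_le_add (h2.trans ?_) (h1.trans ?_)
    · rw [mul_assoc]
      refine mul_le_mul_of_nonneg_left (h3.trans ?_) hC'
      exact mul_le_mul_of_nonneg_left (closedWalks_le_sum S M) (by positivity)
    · exact mul_le_mul_of_nonneg_left (sum_closedWalks_le_sum S M) hC
  · intro σ
    refine sum_abs_laplacianMatrix_le_of_le S (faceWeight_nonneg _) (fun τ => ?_) σ
    rw [Finset.sum_apply]
    exact faceWeight_le_sum_blockWeight S τ
  · refine isHermitian_abs_col_le (laplacianMatrix_isHermitian _) fun σ => ?_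
    refine sum_abs_laplacianMatrix_le_of_le S (fun τ => ?_) (fun τ => le_rfl) σ
    rw [Finset.sum_apply]
    exact Finset.sum_nonneg fun j _ => blockWeight_nonneg _ _

end Traces

/-! ### Convergence in probability -/

section Probability

variable {d k : ℕ}

instance instMeasurableSingletonClassSteinerSystem (d n : ℕ) :
    MeasurableSingletonClass (SteinerSystem d n) :=
  ⟨fun _ => MeasurableSpace.measurableSet_top⟩

/-- Markov's inequality for a function of independent uniform Steiner systems. -/
theorem measure_lt_le_of_iIndepFun {n : ℕ} {Ω : Type*} [MeasurableSpace Ω] {P : Measure Ω}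
    {S : Fin k → Ω → SteinerSystem d n} (hind : iIndepFun S P)
    (hlaw : ∀ j, HasLaw (S j) (uniformOn Set.univ) P) (g : (Fin k → SteinerSystem d n) → ℝ)
    (hg : ∀ s, 0 ≤ g s) {c : ℝ} (hc : 0 < c) :
    P {ω | c < g fun j => S j ω} ≤
      ENNReal.ofReal ((∑ s, g s) / (c * Fintype.card (Fin k → SteinerSystem d n))) := by
  classical
  have hpoint : ∀ s : Fin k → SteinerSystem d n, P {ω | (fun j => S j ω) = s} =
      ENNReal.ofReal ((Fintype.card (Fin k → SteinerSystem d n) : ℝ)⁻¹) := by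
    intro s
    have e : {ω | (fun j => S j ω) = s} = ⋂ j ∈ (Finset.univ : Finset (Fin k)), S j ⁻¹' {s j} := by
      ext ω
      simp [funext_iff]
    have h1 : ∀ j, P (S j ⁻¹' {s j}) =
        ENNReal.ofReal ((Fintype.card (SteinerSystem d n) : ℝ)⁻¹) := by
      intro j
      have : Nonempty (SteinerSystem d n) := ⟨s j⟩
      have hpos : (0 : ℝ) < Fintype.card (SteinerSystem d n) := by
        exact_mod_cast Fintype.card_pos
      rw [← Measure.map_apply_of_aemeasurable (hlaw j).aemeasurable (measurableSet_singleton _),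
        (hlaw j).map_eq, uniformOn_univ, Measure.count_singleton, ENNReal.ofReal_inv_of_pos hpos,
        ENNReal.ofReal_natCast, one_div]
    rw [e, hind.measure_inter_preimage_eq_mul _ fun j _ => measurableSet_singleton _]
    simp only [h1, Finset.prod_const, Finset.card_univ, Fintype.card_fin, Fintype.card_pi]
    rw [← ENNReal.ofReal_pow (by positivity)]
    push_cast
    rw [inv_pow]
  have hsub : {ω | c < g fun j => S j ω} ⊆
      ⋃ s ∈ Finset.univ.filter (fun s => c < g s), {ω | (fun j => S j ω) = s} := by
    intro ω hω
    exact Set.mem_biUnion (Finset.mem_coe.2 (Finset.mem_filter.2 ⟨Finset.mem_univ _, hω⟩)) rfl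
  refine (measure_mono hsub).trans ((measure_biUnion_finset_le _ _).trans ?_)
  simp only [hpoint, Finset.sum_const, nsmul_eq_mul]
  rw [← ENNReal.ofReal_natCast, ← ENNReal.ofReal_mul (by positivity)]
  apply ENNReal.ofReal_le_ofReal
  rw [← div_div, div_eq_mul_inv _ (Fintype.card (Fin k → SteinerSystem d n) : ℝ)]
  refine mul_le_mul_of_nonneg_right ?_ (by positivity)
  rw [le_div_iff₀ hc, ← nsmul_eq_mul]
  calc _ ≤ ∑ s with c < g s, g s :=
        Finset.card_nsmul_le_sum _ _ _ fun s hs => (Finset.mem_filter.1 hs).2.le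
    _ ≤ ∑ s, g s := Finset.sum_le_sum_of_subset_of_nonneg (Finset.filter_subset _ _)
        fun s _ _ => hg s

theorem tendsto_mean_closedWalks (d k m : ℕ) :
    Tendsto (fun n : ℕ => (∑ S : Fin k → SteinerSystem d n, closedWalks S (m + 1)) /
      (Fintype.card (Facet n d) * Fintype.card (Fin k → SteinerSystem d n))) atTop (𝓝 0) := by
  obtain ⟨C, hC, h⟩ := exists_sum_closedWalks_le d k m
  have hlim : Tendsto (fun n : ℕ => C / ((n : ℝ) - (m + 1 : ℕ) * d)) atTop (𝓝 0) :=
    Tendsto.const_div_atTop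
      (tendsto_atTop_add_const_right _ _ tendsto_natCast_atTop_atTop) _
  refine tendsto_of_tendsto_of_tendsto_of_le_of_le' tendsto_const_nhds hlim
    (Eventually.of_forall fun n => ?_) ?_
  · exact div_nonneg (Finset.sum_nonneg fun S _ => closedWalks_nonneg S _) (by positivity)
  · filter_upwards [eventually_gt_atTop ((m + 1) * d)] with n hn
    have hpos : 0 < (n : ℝ) - (m + 1 : ℕ) * d := by
      have : (((m + 1) * d : ℕ) : ℝ) < n := by exact_mod_cast hn
      rw [Nat.cast_mul] at this
      linarith
    refine div_le_of_le_mul₀ (by positivity) (by positivity) ?_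
    rw [div_mul_eq_mul_div, le_div_iff₀ hpos, mul_comm, ← mul_assoc]
    exact h n

/-- The moment method: if the operator `T` on the forms of the random Steiner complexes is given by
symmetric matrices with bounded row sums and the traces of its polynomials are controlled by closed
reduced walks, its empirical spectral distributions converge weakly in probability. -/
theorem convergesWeaklyInProbability_of_trace (hd : 1 ≤ d) {n : ℕ → ℕ} (hn : ∀ i, d ≤ n i)
    (hn' : Tendsto n atTop atTop) {Ω : ℕ → Type*} [∀ i, MeasurableSpace (Ω i)]
    {P : ∀ i, Measure (Ω i)} {X : ∀ i, Ω i → PreAbstractSimplicialComplex (Fin (n i))}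
    (hX : ∀ i, IsRandomSteinerComplex (P i) d k (n i) (X i))
    (T : ∀ {n : ℕ} (X : PreAbstractSimplicialComplex (Fin n)), Form X d →ₗ[ℝ] Form X d)
    (A : ∀ {n : ℕ}, (Fin k → SteinerSystem d n) → Matrix (Facet n d) (Facet n d) ℝ)
    (hT : ∀ {n : ℕ} (S : Fin k → SteinerSystem d n) (f : Form (steinerComplex S) d),
      Facet.formEquiv (mem_faces_steinerComplex hd S) (T (steinerComplex S) f) =
        (A S).mulVec (Facet.formEquiv (mem_faces_steinerComplex hd S) f))
    (hA : ∀ {n : ℕ} (S : Fin k → SteinerSystem d n), (A S).IsHermitian) {K : ℝ}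
    (hK : ∀ {n : ℕ} (S : Fin k → SteinerSystem d n) (σ : Facet n d), ∑ σ', |A S σ σ'| ≤ K)
    {μ : Measure ℝ} [IsProbabilityMeasure μ] {a b : ℝ} (hμ : ∀ᵐ x ∂μ, x ∈ Set.Icc a b)
    (htr : ∀ p : Polynomial ℝ, ∃ (C : ℝ) (M : ℕ), 0 ≤ C ∧
      ∀ (n : ℕ) (S : Fin k → SteinerSystem d n),
        |(Polynomial.aeval (A S) p).trace - Fintype.card (Facet n d) * ∫ x, p.eval x ∂μ| ≤
          C * ∑ m ∈ Finset.range M, closedWalks S (m + 1)) :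
    ConvergesWeaklyInProbability P (fun i ω => empiricalSpectralDistribution (T (X i ω))) μ := by
  intro f ε hε
  obtain ⟨p, hp⟩ := exists_polynomial_near_of_continuousOn (min a (-K)) (max b K) f
    f.continuous.continuousOn (ε / 4) (by positivity)
  obtain ⟨C, M, hC, h⟩ := htr p
  have hfp : |∫ x, p.eval x ∂μ - ∫ x, f x ∂μ| ≤ ε / 4 := by
    rw [← integral_sub (integrable_of_ae_mem_Icc hμ p.continuous)
      (integrable_of_ae_mem_Icc hμ f.continuous)]
    have := norm_integral_le_of_norm_le_const (μ := μ) (f := fun x => p.eval x - f x) (C := ε / 4)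
      (hμ.mono fun x hx => by
        rw [Real.norm_eq_abs]
        exact (hp x ⟨(min_le_left _ _).trans hx.1, hx.2.trans (le_max_left _ _)⟩).le)
    simpa using this
  have hdet : ∀ {n : ℕ} (S : Fin k → SteinerSystem d n), d ≤ n →
      ε < |∫ x, f x ∂(empiricalSpectralDistribution (T (steinerComplex S))) - ∫ x, f x ∂μ| →
      Fintype.card (Facet n d) * (ε / 2) <
        C * ∑ m ∈ Finset.range M, closedWalks S (m + 1) := by
    intro n S hdn hlt
    have hr : (0 : ℝ) < Fintype.card (Facet n d) := by
      rw [Facet.card_eq]; exact_mod_cast Nat.choose_pos hdn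
    have hESD := integral_empiricalSpectralDistribution (T (steinerComplex S))
      (Facet.formEquiv (mem_faces_steinerComplex hd S)) (hA S) (hT S)
    have htrace := h n S
    rw [trace_aeval_eq_sum_eigenvalues (hA S)] at htrace
    rw [hESD] at hlt
    set lam := (hA S).eigenvalues
    have hsum : |∑ i, f (lam i) - ∑ i, p.eval (lam i)| ≤
        Fintype.card (Facet n d) * (ε / 4) := by
      rw [← Finset.sum_sub_distrib]
      refine (Finset.abs_sum_le_sum_abs _ _).trans ?_
      rw [← nsmul_eq_mul]
      refine Finset.sum_le_card_nsmul _ _ _ fun i _ => ?_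
      have hi := abs_le.1 (abs_eigenvalues_le (hA S) (hK S) i)
      rw [abs_sub_comm]
      exact (hp _ ⟨(min_le_right _ _).trans hi.1, hi.2.trans (le_max_right _ _)⟩).le
    have hscale : Fintype.card (Facet n d) * ε <
        |∑ i, f (lam i) - Fintype.card (Facet n d) * ∫ x, f x ∂μ| := by
      have e : ∑ i, f (lam i) - Fintype.card (Facet n d) * ∫ x, f x ∂μ =
          Fintype.card (Facet n d) *
            ((Fintype.card (Facet n d) : ℝ)⁻¹ * ∑ i, f (lam i) - ∫ x, f x ∂μ) := by
        field_simp
      rw [e, abs_mul, abs_of_pos hr]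
      exact mul_lt_mul_of_pos_left hlt hr
    have h1 := abs_sub_le (∑ i, f (lam i)) (∑ i, p.eval (lam i))
      (Fintype.card (Facet n d) * ∫ x, f x ∂μ)
    have h2 := abs_sub_le (∑ i, p.eval (lam i))
      (Fintype.card (Facet n d) * ∫ x, p.eval x ∂μ)
      (Fintype.card (Facet n d) * ∫ x, f x ∂μ)
    have h3 : |Fintype.card (Facet n d) * ∫ x, p.eval x ∂μ -
        Fintype.card (Facet n d) * ∫ x, f x ∂μ| ≤ Fintype.card (Facet n d) * (ε / 4) := by
      rw [← mul_sub, abs_mul, abs_of_pos hr]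
      exact mul_le_mul_of_nonneg_left hfp hr.le
    linarith
  have hlim : Tendsto (fun i => ENNReal.ofReal (2 * C / ε * ∑ m ∈ Finset.range M,
      (∑ S : Fin k → SteinerSystem d (n i), closedWalks S (m + 1)) /
        (Fintype.card (Facet (n i) d) * Fintype.card (Fin k → SteinerSystem d (n i)))))
      atTop (𝓝 0) := by
    rw [← ENNReal.ofReal_zero]
    apply ENNReal.tendsto_ofReal
    have := (tendsto_finsetSum (Finset.range M) fun m _ =>
      (tendsto_mean_closedWalks d k m).comp hn').const_mul (2 * C / ε)
    rw [Finset.sum_const_zero, mul_zero] at this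
    exact this
  refine tendsto_of_tendsto_of_tendsto_of_le_of_le tendsto_const_nhds hlim
    (fun i => bot_le) fun i => ?_
  obtain ⟨S, hind, hlaw, hXS⟩ := hX i
  have hr : (0 : ℝ) < Fintype.card (Facet (n i) d) := by
    rw [Facet.card_eq]; exact_mod_cast Nat.choose_pos (hn i)
  have hsub : {ω | ε < |∫ x, f x ∂(empiricalSpectralDistribution (T (X i ω))) - ∫ x, f x ∂μ|} ⊆
      {ω | Fintype.card (Facet (n i) d) * (ε / 2) <
        C * ∑ m ∈ Finset.range M, closedWalks (fun j => S j ω) (m + 1)} := by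
    intro ω hω
    refine hdet _ (hn i) ?_
    rw [← hXS ω]
    exact hω
  refine (measure_mono hsub).trans ((measure_lt_le_of_iIndepFun hind hlaw
    (fun s => C * ∑ m ∈ Finset.range M, closedWalks s (m + 1))
    (fun s => mul_nonneg hC (Finset.sum_nonneg fun _ _ => closedWalks_nonneg _ _))
    (mul_pos hr (half_pos hε))).trans_eq ?_)
  congr 1
  rw [← Finset.mul_sum, Finset.sum_comm, ← Finset.sum_div]
  generalize (∑ m ∈ Finset.range M, ∑ S : Fin k → SteinerSystem d (n i),
    closedWalks S (m + 1)) = Q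
  ring

end Probability

theorem theorem2p2 (d k : ℕ) (hd : 1 ≤ d) (hk : d + 1 ≤ k)
    (n : ℕ → ℕ) (hn : ∀ i, IsAdmissible d (n i)) (hn' : Tendsto n atTop atTop)
    (Ω : ℕ → Type*) [∀ i, MeasurableSpace (Ω i)]
    (P : ∀ i, Measure (Ω i)) [∀ i, IsProbabilityMeasure (P i)]
    (X : ∀ i, Ω i → PreAbstractSimplicialComplex (Fin (n i)))
    (hX : ∀ i, IsRandomSteinerComplex (P i) d k (n i) (X i)) :
    (IsProbabilityWithDensity (laplacianLimit d k) (laplacianInterval d k)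
        (laplacianDensity d k) ∧
      (∀ ν : Measure ℝ,
        IsProbabilityWithDensity ν (laplacianInterval d k) (laplacianDensity d k) →
          ν = laplacianLimit d k) ∧
      ConvergesWeaklyInProbability P
        (fun i ω => empiricalSpectralDistribution (upperLaplacian (X i ω) d))
        (laplacianLimit d k)) ∧
    (IsProbabilityWithDensity (adjacencyLimit d k) (adjacencyInterval d k)
        (adjacencyDensity d k) ∧
      ConvergesWeaklyInProbability P
        (fun i ω => empiricalSpectralDistribution (adjacencyOperator (X i ω) d))
        (adjacencyLimit d k)) := by
  have hL := isProbabilityWithDensity_laplacianLimit hd hk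
  have hA := isProbabilityWithDensity_adjacencyLimit hd hk
  have := hL.1
  have := hA.1
  have hdn : ∀ i, d ≤ n i := fun i => (Nat.le_succ d).trans (hn i).1
  have hrow : ∀ {n : ℕ} (S : Fin k → SteinerSystem d n) (σ : Facet n d),
      ∑ σ', |laplacianMatrix (faceWeight (steinerComplex S)) σ σ'| ≤ (d + 1) * k := by
    intro n S σ
    refine sum_abs_laplacianMatrix_le_of_le S (faceWeight_nonneg _) (fun τ => ?_) σ
    rw [Finset.sum_apply]
    exact faceWeight_le_sum_blockWeight S τ
  refine ⟨⟨hL, fun ν hν => hν.unique hL, ?_⟩, hA, ?_⟩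
  · exact convergesWeaklyInProbability_of_trace hd hdn hn' hX (fun X => upperLaplacian X d)
      (fun S => laplacianMatrix (faceWeight (steinerComplex S)))
      (fun S f => formEquiv_upperLaplacian (mem_faces_steinerComplex hd S) f)
      (fun S => laplacianMatrix_isHermitian _) hrow (ae_mem_laplacianInterval d k)
      (exists_abs_trace_laplacianMatrix_sub_integral_le hd hk)
  · exact convergesWeaklyInProbability_of_trace hd hdn hn' hX (fun X => adjacencyOperator X d)
      (fun S => adjacencyMatrix (faceWeight (steinerComplex S)))
      (fun S f => formEquiv_adjacencyOperator (mem_faces_steinerComplex hd S) f)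
      (fun S => adjacencyMatrix_isHermitian _)
      (fun S σ => (Finset.sum_le_sum fun σ' _ => abs_adjacencyMatrix_le _ _ _).trans (hrow S σ))
      (ae_mem_adjacencyInterval (by omega))
      (exists_abs_trace_adjacencyMatrix_sub_integral_le hd hk)
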